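/- Let $k$ be a commutative ring (for instance a field) and let $A$ be an associative unital $k$-algebra that is projective as a $k$-module. For any associative unital $k$-algebra $\Lambda$ write $\Lambda^e=\Lambda\otimes_k\Lambda^{op}$, so that left $\Lambda^e$-modules are $\Lambda$-bimodules, and regard each $\mathrm{Ext}^i_{\Lambda^e}(\Lambda,\Lambda\otimes_k\Lambda)$, computed with the outer bimodule structure of $\Lambda\otimes_k\Lambda$, as a $\Lambda$-bimodule through the inner structure $a(x\otimes y)b=xb\otimes ay$. Let $d\ge 0$ be an integer. Suppose that $A$ satisfies the conditions for van den Bergh duality of dimension $d$: (i) $A$ has a resolution of finite length by finitely generated projective $A$-bimodules; (ii) $\mathrm{Ext}^i_{A^e}(A,A\otimes_k A)=0$ for all $i\ne d$; and (iii) the $A$-bimodule $U=\mathrm{Ext}^d_{A^e}(A,A\otimes_k A)$ is invertible, that is, there is an $A$-bimodule $V$ with $U\otimes_A V\cong A\cong V\otimes_A U$ as $A$-bimodules. Then the tensor algebra $B=A[U]=\bigoplus_{n\ge 0}U^{\otimes_A n}$ is a Calabi–Yau algebra of dimension $d+1$: $B$ has a resolution of finite length by finitely generated projective $B$-bimodules,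 $\mathrm{Ext}^i_{B^e}(B,B\otimes_k B)=0$ for all $i\ne d+1$, and $\mathrm{Ext}^{d+1}_{B^e}(B,B\otimes_k B)\cong B$ as $B$-bimodules. -/

import Mathlib

open TensorProduct MulOpposite CategoryTheory

universe u v

noncomputable section

namespace VdB

/-! ### Bimodules and their tensor products -/

section Bimodules

variable (k : Type u) [CommRing k] (A : Type v) [Ring A] [Algebra k A]

/-- A bundled `A`-bimodule over `k`: a left and a right `A`-module structure (the right one as a
module structure over `Aᵐᵒᵖ`) which commute and on which `k` acts in the same way. -/
structure Bimod where
  carrier : Type v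
  [addCommGroup : AddCommGroup carrier]
  [moduleBase : Module k carrier]
  [moduleLeft : Module A carrier]
  [moduleRight : Module Aᵐᵒᵖ carrier]
  [towerLeft : IsScalarTower k A carrier]
  [towerRight : IsScalarTower k Aᵐᵒᵖ carrier]
  [comm : SMulCommClass A Aᵐᵒᵖ carrier]

instance : CoeSort (Bimod k A) (Type v) := ⟨Bimod.carrier⟩

attribute [instance] Bimod.addCommGroup Bimod.moduleBase Bimod.moduleLeft Bimod.moduleRight
  Bimod.towerLeft Bimod.towerRight Bimod.comm

/-- `A` as a bimodule over itself. -/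
abbrev Bimod.self : Bimod k A := { carrier := A }

variable {k A}

/-- `M` and `N` are isomorphic as bimodules. -/
def Bimod.IsIso (M N : Bimod k A) : Prop :=
  ∃ e : M ≃ₗ[A] N, ∀ (b : Aᵐᵒᵖ) (x : M), e (b • x) = b • e x

/-- The submodule of `M ⊗[k] N` generated by all `m a ⊗ n - m ⊗ a n`. -/
def balancing (M N : Bimod k A) : Submodule k (M ⊗[k] N) :=
  Submodule.span k {x | ∃ (m : M) (a : A) (n : N), x = (op a • m) ⊗ₜ[k] n - m ⊗ₜ[k] (a • n)}

/-- The underlying group of `M ⊗_A N`. -/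
def RelTensor (M N : Bimod k A) : Type v := (M ⊗[k] N) ⧸ balancing M N

namespace RelTensor

variable (M N : Bimod k A)

instance : AddCommGroup (RelTensor M N) :=
  inferInstanceAs (AddCommGroup ((M ⊗[k] N) ⧸ balancing M N))

instance : Module k (RelTensor M N) :=
  inferInstanceAs (Module k ((M ⊗[k] N) ⧸ balancing M N))

variable {M N}

/-- The class `m ⊗_A n`, bilinearly in `m` and `n`. -/
def mk : M →ₗ[k] N →ₗ[k] RelTensor M N :=
  (TensorProduct.mk k M N).compr₂ (balancing M N).mkQ

theorem mk_balanced (m : M) (a : A) (n : N) : mk (op a • m) n = mk m (a • n) := by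
  change (balancing M N).mkQ _ = (balancing M N).mkQ _
  rw [← sub_eq_zero, ← map_sub, Submodule.mkQ_apply, Submodule.Quotient.mk_eq_zero]
  exact Submodule.subset_span ⟨m, a, n, rfl⟩

@[elab_as_elim]
theorem induction {p : RelTensor M N → Prop} (h0 : p 0) (hmk : ∀ m n, p (mk m n))
    (hadd : ∀ x y, p x → p y → p (x + y)) (x : RelTensor M N) : p x := by
  obtain ⟨t, rfl⟩ := Submodule.mkQ_surjective (balancing M N) x
  induction t using TensorProduct.induction_on with
  | zero => rw [map_zero]; exact h0
  | tmul m n => exact hmk m n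
  | add x y hx hy => rw [map_add]; exact hadd _ _ hx hy

/-- The map out of `M ⊗_A N` given by an `A`-balanced bilinear map. -/
def lift {P : Type*} [AddCommGroup P] [Module k P] (f : M →ₗ[k] N →ₗ[k] P)
    (hf : ∀ (m : M) (a : A) (n : N), f (op a • m) n = f m (a • n)) : RelTensor M N →ₗ[k] P :=
  (balancing M N).liftQ (TensorProduct.lift f) <| by
    refine Submodule.span_le.2 ?_
    rintro _ ⟨m, a, n, rfl⟩
    simp [hf]

@[simp]
theorem lift_mk {P : Type*} [AddCommGroup P] [Module k P] (f : M →ₗ[k] N →ₗ[k] P)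
    (hf : ∀ (m : M) (a : A) (n : N), f (op a • m) n = f m (a • n)) (m : M) (n : N) :
    lift f hf (mk m n) = f m n :=
  (Submodule.liftQ_apply (balancing M N) (TensorProduct.lift f) (m ⊗ₜ[k] n)).trans
    (TensorProduct.lift.tmul m n)

/-- Left multiplication by `a` on `M ⊗_A N`. -/
def leftEnd (a : A) : Module.End k (RelTensor M N) :=
  lift (mk ∘ₗ Algebra.lsmul k k M a) fun m b n => by
    simp [smul_comm a (op b) m, mk_balanced]

/-- Right multiplication by `b` on `M ⊗_A N`. -/
def rightEnd (b : Aᵐᵒᵖ) : Module.End k (RelTensor M N) :=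
  lift (mk.compl₂ (Algebra.lsmul k k N b)) fun m a n => by
    simp [smul_comm a b n, mk_balanced]

@[simp]
theorem leftEnd_mk (a : A) (m : M) (n : N) : leftEnd a (mk m n) = mk (a • m) n :=
  lift_mk (mk ∘ₗ Algebra.lsmul k k M a) _ m n

@[simp]
theorem rightEnd_mk (b : Aᵐᵒᵖ) (m : M) (n : N) : rightEnd b (mk m n) = mk m (b • n) :=
  lift_mk (mk.compl₂ (Algebra.lsmul k k N b)) _ m n

theorem end_ext {f g : Module.End k (RelTensor M N)} (h : ∀ m n, f (mk m n) = g (mk m n)) :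
    f = g := by
  ext x
  induction x using induction with
  | h0 => simp
  | hmk m n => exact h m n
  | hadd x y hx hy => simp [hx, hy]

variable (M N)

/-- The left action of `A`. -/
def leftHom : A →+* Module.End k (RelTensor M N) where
  toFun := leftEnd
  map_one' := end_ext fun m n => by simp
  map_mul' a b := end_ext fun m n => by simp [mul_smul]
  map_zero' := end_ext fun m n => by simp
  map_add' a b := end_ext fun m n => by simp [add_smul]

/-- The right action of `A`. -/
def rightHom : Aᵐᵒᵖ →+* Module.End k (RelTensor M N) where
  toFun := rightEnd
  map_one' := end_ext fun m n => by simp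
  map_mul' a b := end_ext fun m n => by simp [mul_smul]
  map_zero' := end_ext fun m n => by simp
  map_add' a b := end_ext fun m n => by simp [add_smul]

instance : Module A (RelTensor M N) := Module.compHom _ (leftHom M N)

instance : Module Aᵐᵒᵖ (RelTensor M N) := Module.compHom _ (rightHom M N)

variable {M N}

@[simp]
theorem smul_mk (a : A) (m : M) (n : N) : a • (mk m n : RelTensor M N) = mk (a • m) n :=
  leftEnd_mk a m n

@[simp]
theorem op_smul_mk (b : Aᵐᵒᵖ) (m : M) (n : N) : b • (mk m n : RelTensor M N) = mk m (b • n) :=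
  rightEnd_mk b m n

instance : IsScalarTower k A (RelTensor M N) where
  smul_assoc c a x := by
    induction x using induction with
    | h0 => simp
    | hmk m n => simp
    | hadd x y hx hy => rw [smul_add, smul_add, smul_add, hx, hy]

instance : IsScalarTower k Aᵐᵒᵖ (RelTensor M N) where
  smul_assoc c a x := by
    induction x using induction with
    | h0 => simp
    | hmk m n => simp
    | hadd x y hx hy => rw [smul_add, smul_add, smul_add, hx, hy]

instance : SMulCommClass A Aᵐᵒᵖ (RelTensor M N) where
  smul_comm a b x := by
    induction x using induction with
    | h0 => simp
    | hmk m n => simp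
    | hadd x y hx hy => simp only [smul_add, hx, hy]

end RelTensor

/-- The bimodule `M ⊗_A N`, with `a (m ⊗ n) b = a m ⊗ n b`. -/
abbrev Bimod.tensor (M N : Bimod k A) : Bimod k A := { carrier := RelTensor M N }

/-- `U` is an invertible bimodule. -/
def Bimod.IsInvertible (U : Bimod k A) : Prop :=
  ∃ V : Bimod k A, (U.tensor V).IsIso (Bimod.self k A) ∧ (V.tensor U).IsIso (Bimod.self k A)

/-- The tensor powers of a bimodule: `A`, `U ⊗_A A`, `U ⊗_A (U ⊗_A A)`, ... -/
def Bimod.tpow (U : Bimod k A) : ℕ → Bimod k A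
  | 0 => Bimod.self k A
  | n + 1 => U.tensor (Bimod.tpow U n)

end Bimodules

/-! ### The tensor algebra of a bimodule -/

section TensorAlgebra

variable {k : Type u} [CommRing k] {A : Type v} [Ring A] [Algebra k A]

/-- The tensor algebra `A[U]`, the direct sum of all tensor powers of `U` over `A`. -/
def TensorAlg (U : Bimod k A) : Type v := DirectSum ℕ fun n => U.tpow n

namespace TensorAlg

variable (U : Bimod k A)

instance : AddCommGroup (TensorAlg U) :=
  inferInstanceAs (AddCommGroup (DirectSum ℕ fun n => U.tpow n))

instance : Module k (TensorAlg U) :=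
  inferInstanceAs (Module k (DirectSum ℕ fun n => U.tpow n))

instance : Module A (TensorAlg U) :=
  inferInstanceAs (Module A (DirectSum ℕ fun n => U.tpow n))

instance : IsScalarTower k A (TensorAlg U) :=
  inferInstanceAs (IsScalarTower k A (DirectSum ℕ fun n => U.tpow n))

/-- The inclusion of the `n`-th tensor power. -/
def incl (n : ℕ) : U.tpow n →ₗ[A] TensorAlg U := DirectSum.lof A ℕ (fun n => U.tpow n) n

variable {U}

@[elab_as_elim]
theorem induction {p : TensorAlg U → Prop} (h0 : p 0) (hincl : ∀ n t, p (incl U n t))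
    (hadd : ∀ x y, p x → p y → p (x + y)) (x : TensorAlg U) : p x :=
  DirectSum.induction_on x h0 hincl hadd

/-- The `k`-linear map out of `A[U]` with given components. -/
def desc {P : Type*} [AddCommGroup P] [Module k P] (f : ∀ n, U.tpow n →ₗ[k] P) :
    TensorAlg U →ₗ[k] P := DirectSum.toModule k ℕ P f

@[simp]
theorem desc_incl {P : Type*} [AddCommGroup P] [Module k P] (f : ∀ n, U.tpow n →ₗ[k] P)
    (n : ℕ) (t : U.tpow n) : desc f (incl U n t) = f n t :=
  DirectSum.toModule_lof (M := fun n => U.tpow n) k n t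

/-- The element `u ⊗ t` of the `(n + 1)`-st tensor power. -/
def cons (n : ℕ) : U →ₗ[k] U.tpow n →ₗ[k] U.tpow (n + 1) :=
  (RelTensor.mk : U →ₗ[k] U.tpow n →ₗ[k] RelTensor U (U.tpow n))

theorem cons_balanced (n : ℕ) (u : U) (a : A) (t : U.tpow n) :
    cons n (op a • u) t = cons n u (a • t) := RelTensor.mk_balanced u a t

theorem smul_cons (n : ℕ) (a : A) (u : U) (t : U.tpow n) :
    a • cons n u t = cons n (a • u) t := RelTensor.smul_mk a u t

@[elab_as_elim]
theorem tpow_induction {n : ℕ} {p : U.tpow (n + 1) → Prop} (h0 : p 0)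
    (hcons : ∀ u t, p (cons n u t)) (hadd : ∀ x y, p x → p y → p (x + y))
    (x : U.tpow (n + 1)) : p x :=
  RelTensor.induction (p := p) h0 hcons hadd x

/-- Left multiplication by `u ∈ U`, which sends `t ∈ U^{⊗ n}` to `u ⊗ t ∈ U^{⊗ (n + 1)}`. -/
def insert : U →ₗ[k] TensorAlg U →ₗ[k] TensorAlg U :=
  LinearMap.flip <| desc fun n =>
    ((cons n).compr₂ ((incl U (n + 1)).restrictScalars k)).flip

@[simp]
theorem insert_incl (u : U) (n : ℕ) (t : U.tpow n) :
    insert u (incl U n t) = incl U (n + 1) (cons n u t) := by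
  simp [insert]

theorem insert_balanced (u : U) (a : A) (x : TensorAlg U) :
    insert (op a • u) x = insert u (a • x) := by
  induction x using induction with
  | h0 => simp
  | hincl n t => rw [← map_smul, insert_incl, insert_incl, cons_balanced]
  | hadd x y hx hy => rw [smul_add, map_add, map_add, hx, hy]

theorem smul_insert (a : A) (u : U) (x : TensorAlg U) :
    a • insert u x = insert (a • u) x := by
  induction x using induction with
  | h0 => simp
  | hincl n t => rw [insert_incl, insert_incl, ← map_smul, smul_cons]
  | hadd x y hx hy => rw [map_add, map_add, smul_add, hx, hy]

theorem mulSucc_balanced {n : ℕ} (f : U.tpow n →ₗ[A] Module.End k (TensorAlg U)) (u : U) (a : A)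
    (t : U.tpow n) :
    ((LinearMap.llcomp k _ _ _).compl₂ (f.restrictScalars k) ∘ₗ insert) (op a • u) t =
      ((LinearMap.llcomp k _ _ _).compl₂ (f.restrictScalars k) ∘ₗ insert) u (a • t) := by
  ext x
  simp [insert_balanced]

/-- The linear map on the `(n + 1)`-st tensor power given by `u ⊗ t ↦ (x ↦ u ⊗ f t x)`. -/
def mulSucc {n : ℕ} (f : U.tpow n →ₗ[A] Module.End k (TensorAlg U)) :
    U.tpow (n + 1) →ₗ[A] Module.End k (TensorAlg U) :=
  let g : RelTensor U (U.tpow n) →ₗ[k] Module.End k (TensorAlg U) :=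
    RelTensor.lift ((LinearMap.llcomp k _ _ _).compl₂ (f.restrictScalars k) ∘ₗ insert)
      (mulSucc_balanced f)
  { toFun := g
    map_add' := map_add g
    map_smul' := fun a x => by
      induction x using tpow_induction with
      | h0 =>
        rw [smul_zero]
        exact (map_zero g).trans ((smul_zero a).symm.trans (congrArg (a • ·) (map_zero g).symm))
      | hcons u t =>
        ext x
        rw [smul_cons]
        change g (RelTensor.mk (a • u) t) x = a • g (RelTensor.mk u t) x
        simp [g, smul_insert]
      | hadd x y hx hy =>
        rw [smul_add]
        refine (map_add g _ _).trans ?_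
        rw [hx, hy, ← smul_add]
        exact congrArg (a • ·) (map_add g x y).symm }

theorem mulSucc_cons {n : ℕ} (f : U.tpow n →ₗ[A] Module.End k (TensorAlg U)) (u : U)
    (t : U.tpow n) (x : TensorAlg U) : mulSucc f (cons n u t) x = insert u (f t x) :=
  LinearMap.congr_fun (RelTensor.lift_mk _ (mulSucc_balanced f) u t) x

/-- Left multiplication by an element of a tensor power: an element `a ∈ A = U^{⊗ 0}` acts
through the left action of `A`, and `(u ⊗ t) x = u ⊗ (t x)`. -/
def mulLeft : ∀ n, U.tpow n →ₗ[A] Module.End k (TensorAlg U)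
  | 0 => LinearMap.toSpanSingleton A (Module.End k (TensorAlg U)) 1
  | n + 1 => mulSucc (mulLeft n)

variable (U) in
/-- The identification of `A` with the zeroth tensor power. -/
def scalar : A →ₗ[A] U.tpow 0 := (LinearMap.id : A →ₗ[A] A)

/-- The multiplication of `A[U]`. -/
def mulMap : TensorAlg U →ₗ[k] TensorAlg U →ₗ[k] TensorAlg U :=
  desc fun n => (mulLeft n).restrictScalars k

instance : Mul (TensorAlg U) := ⟨fun x y => mulMap x y⟩

instance : One (TensorAlg U) := ⟨incl U 0 (scalar U 1)⟩

theorem mul_def (x y : TensorAlg U) : x * y = mulMap x y := rfl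

theorem exists_scalar (t : U.tpow 0) : ∃ a, scalar U a = t := ⟨t, rfl⟩

theorem incl_zero_mul (a : A) (x : TensorAlg U) : incl U 0 (scalar U a) * x = a • x := by
  rw [mul_def, mulMap, desc_incl]
  rfl

theorem incl_cons_mul (n : ℕ) (u : U) (t : U.tpow n) (x : TensorAlg U) :
    incl U (n + 1) (cons n u t) * x = insert u (incl U n t * x) := by
  rw [mul_def, mulMap, desc_incl, mul_def, mulMap, desc_incl]
  exact mulSucc_cons (mulLeft n) u t x

protected theorem add_mul' (x y z : TensorAlg U) : (x + y) * z = x * z + y * z := by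
  simp [mul_def]

protected theorem mul_add' (x y z : TensorAlg U) : x * (y + z) = x * y + x * z := by
  simp [mul_def]

protected theorem zero_mul' (x : TensorAlg U) : 0 * x = 0 := by simp [mul_def]

protected theorem mul_zero' (x : TensorAlg U) : x * 0 = 0 := by simp [mul_def]

theorem smul_mul (a : A) (x y : TensorAlg U) : (a • x) * y = a • (x * y) := by
  induction x using induction with
  | h0 => simp [TensorAlg.zero_mul']
  | hincl n t =>
    rw [← map_smul, mul_def, mulMap, desc_incl, mul_def, mulMap, desc_incl]
    simp
  | hadd x₁ x₂ h₁ h₂ => rw [smul_add, TensorAlg.add_mul', TensorAlg.add_mul', smul_add, h₁, h₂]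

theorem insert_mul (u : U) (x y : TensorAlg U) : insert u x * y = insert u (x * y) := by
  induction x using induction with
  | h0 => simp [TensorAlg.zero_mul']
  | hincl n t => rw [insert_incl, incl_cons_mul]
  | hadd x₁ x₂ h₁ h₂ => rw [map_add, TensorAlg.add_mul', TensorAlg.add_mul', map_add, h₁, h₂]

protected theorem mul_assoc' (x y z : TensorAlg U) : x * y * z = x * (y * z) := by
  induction x using induction with
  | h0 => simp [TensorAlg.zero_mul']
  | hincl n t =>
    induction n with
    | zero =>
      obtain ⟨a, rfl⟩ := exists_scalar t
      rw [incl_zero_mul, incl_zero_mul, smul_mul]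
    | succ n ih =>
      induction t using tpow_induction with
      | h0 => simp [TensorAlg.zero_mul']
      | hcons u t => rw [incl_cons_mul, incl_cons_mul, insert_mul, ih]
      | hadd s t hs ht => simp only [map_add, TensorAlg.add_mul', hs, ht]
  | hadd x₁ x₂ h₁ h₂ => simp only [TensorAlg.add_mul', h₁, h₂]

protected theorem one_mul' (x : TensorAlg U) : 1 * x = x := by
  change incl U 0 (scalar U 1) * x = x
  rw [incl_zero_mul, one_smul]

protected theorem mul_one' (x : TensorAlg U) : x * 1 = x := by
  induction x using induction with
  | h0 => simp [TensorAlg.zero_mul']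
  | hincl n t =>
    induction n with
    | zero =>
      obtain ⟨a, rfl⟩ := exists_scalar t
      rw [incl_zero_mul]
      change a • incl U 0 (scalar U 1) = _
      rw [← map_smul, ← map_smul, smul_eq_mul, mul_one]
    | succ n ih =>
      induction t using tpow_induction with
      | h0 => simp [TensorAlg.zero_mul']
      | hcons u t => rw [incl_cons_mul, ih, insert_incl]
      | hadd s t hs ht => rw [map_add, TensorAlg.add_mul', hs, ht]
  | hadd x₁ x₂ h₁ h₂ => rw [TensorAlg.add_mul', h₁, h₂]

instance : Ring (TensorAlg U) :=
  { (inferInstance : AddCommGroup (TensorAlg U)) with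
    left_distrib := TensorAlg.mul_add'
    right_distrib := TensorAlg.add_mul'
    zero_mul := TensorAlg.zero_mul'
    mul_zero := TensorAlg.mul_zero'
    mul_assoc := TensorAlg.mul_assoc'
    one_mul := TensorAlg.one_mul'
    mul_one := TensorAlg.mul_one' }

instance : Algebra k (TensorAlg U) :=
  Algebra.ofModule (fun c x y => by simp [mul_def]) (fun c x y => by simp [mul_def])

end TensorAlg

end TensorAlgebra

/-! ### Homological conditions -/

section Duality

variable (k : Type u) [CommRing k] (A : Type v) [Ring A] [Algebra k A]

/-- The enveloping algebra `A^e`. -/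
abbrev Env : Type v := A ⊗[k] Aᵐᵒᵖ

/-- `A` as a left `A^e`-module, with `(a ⊗ b) x = a x b`. -/
def diag : ModuleCat.{v} (Env k A) :=
  letI : Module (Env k A) A := instModuleTensorProductMop k A
  ModuleCat.of (Env k A) A

/-- `A` has a resolution of finite length by finitely generated projective bimodules. -/
def HomologicallySmooth : Prop :=
  ∃ P : ProjectiveResolution (diag k A),
    (∀ n, Module.Finite (Env k A) (P.complex.X n)) ∧
      ∃ N, ∀ n, N ≤ n → Limits.IsZero (P.complex.X n)

/-- `Ext^n_{A^e}(A, A ⊗ A)`. With the outer bimodule structure, `A ⊗ A` is the left regular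
`A^e`-module. -/
def ExtEnv (n : ℕ) : Type v :=
  Abelian.Ext.{v} (diag k A) (ModuleCat.of (Env k A) (Env k A)) n

variable {k A}

section

variable {R : Type v} [Ring R]

/-- Right multiplication by `r`, an endomorphism of the left regular module. -/
def rightMul (r : R) : ModuleCat.of R R ⟶ ModuleCat.of R R :=
  ModuleCat.ofHom (LinearMap.toSpanSingleton R R r)

theorem rightMul_apply (r x : R) : (rightMul r).hom x = x * r := rfl

/-- The right `R`-module structure on `Ext^n_R(X, R)` induced by right multiplication on `R`. -/
abbrev extRightModule (X : ModuleCat.{v} R) (n : ℕ) :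
    Module Rᵐᵒᵖ (Abelian.Ext.{v} X (ModuleCat.of R R) n) where
  smul r x := x.comp (Abelian.Ext.mk₀ (rightMul r.unop)) (add_zero n)
  one_smul x := by
    have : rightMul (1 : R) = 𝟙 _ := by ext; simp [rightMul]
    change x.comp (Abelian.Ext.mk₀ (rightMul (1 : R))) (add_zero n) = x
    rw [this, Abelian.Ext.comp_mk₀_id]
  mul_smul r s x := by
    have : rightMul (s.unop * r.unop) = rightMul s.unop ≫ rightMul r.unop := by
      ext; simp [rightMul]
    change x.comp (Abelian.Ext.mk₀ (rightMul (s.unop * r.unop))) (add_zero n) =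
      (x.comp (Abelian.Ext.mk₀ (rightMul s.unop)) (add_zero n)).comp
        (Abelian.Ext.mk₀ (rightMul r.unop)) (add_zero n)
    rw [this, ← Abelian.Ext.mk₀_comp_mk₀, Abelian.Ext.comp_assoc]
    omega
  smul_zero r := Abelian.Ext.zero_comp _ _ _ _ _
  smul_add r x y := Abelian.Ext.add_comp _ _ _ _
  add_smul r s x := by
    have : rightMul (r.unop + s.unop) = rightMul r.unop + rightMul s.unop := by
      ext; simp [rightMul]
    change x.comp (Abelian.Ext.mk₀ (rightMul (r.unop + s.unop))) (add_zero n) =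
      x.comp (Abelian.Ext.mk₀ (rightMul r.unop)) (add_zero n) +
        x.comp (Abelian.Ext.mk₀ (rightMul s.unop)) (add_zero n)
    rw [this, Abelian.Ext.mk₀_add, Abelian.Ext.comp_add]
  zero_smul x := by
    have : rightMul (0 : R) = 0 := by ext; simp [rightMul]
    change x.comp (Abelian.Ext.mk₀ (rightMul (0 : R))) (add_zero n) = 0
    rw [this, Abelian.Ext.mk₀_zero, Abelian.Ext.comp_zero]

end

namespace ExtEnv

variable {n : ℕ}

instance : AddCommGroup (ExtEnv k A n) :=
  inferInstanceAs (AddCommGroup (Abelian.Ext.{v} (diag k A) _ n))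

instance : Module (Env k A)ᵐᵒᵖ (ExtEnv k A n) := extRightModule (diag k A) n

variable (k A) in
/-- The ring map through which `A` acts on the left: `a` goes to `1 ⊗ a`. -/
def leftHom : A →+* (Env k A)ᵐᵒᵖ where
  toFun a := op (1 ⊗ₜ op a)
  map_one' := rfl
  map_mul' a b := unop_injective (by simp)
  map_zero' := unop_injective (by simp)
  map_add' a b := unop_injective (by simp [TensorProduct.tmul_add])

variable (k A) in
/-- The ring map through which `A` acts on the right: `b` goes to `b ⊗ 1`. -/
def rightHom : Aᵐᵒᵖ →+* (Env k A)ᵐᵒᵖ where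
  toFun b := op (b.unop ⊗ₜ 1)
  map_one' := rfl
  map_mul' a b := unop_injective (by simp)
  map_zero' := unop_injective (by simp)
  map_add' a b := unop_injective (by simp [TensorProduct.add_tmul])

/- These are the actions induced by the inner bimodule structure `a (x ⊗ y) b = x b ⊗ a y`
of `A ⊗ A`. -/
instance : Module A (ExtEnv k A n) := Module.compHom _ (leftHom k A)

instance : Module Aᵐᵒᵖ (ExtEnv k A n) := Module.compHom _ (rightHom k A)

instance : Module k (ExtEnv k A n) := Module.compHom _ (algebraMap k (Env k A)ᵐᵒᵖ)

theorem smul_def (a : A) (x : ExtEnv k A n) :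
    a • x = (op (1 ⊗ₜ op a) : (Env k A)ᵐᵒᵖ) • x := rfl

theorem op_smul_def (b : Aᵐᵒᵖ) (x : ExtEnv k A n) :
    b • x = (op (b.unop ⊗ₜ 1) : (Env k A)ᵐᵒᵖ) • x := rfl

theorem base_smul_def (c : k) (x : ExtEnv k A n) :
    c • x = algebraMap k (Env k A)ᵐᵒᵖ c • x := rfl

instance : IsScalarTower k A (ExtEnv k A n) where
  smul_assoc c a x := by
    rw [smul_def, smul_def, base_smul_def, ← mul_smul]
    congr 1
    rw [← Algebra.smul_def]
    exact unop_injective (by simp)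

instance : IsScalarTower k Aᵐᵒᵖ (ExtEnv k A n) where
  smul_assoc c a x := by
    rw [op_smul_def, op_smul_def, base_smul_def, ← mul_smul]
    congr 1
    rw [← Algebra.smul_def]
    exact unop_injective (by simp [TensorProduct.smul_tmul'])

instance : SMulCommClass A Aᵐᵒᵖ (ExtEnv k A n) where
  smul_comm a b x := by
    rw [smul_def, smul_def, op_smul_def, op_smul_def, ← mul_smul, ← mul_smul]
    congr 1
    exact unop_injective (by simp)

end ExtEnv

variable (k A)

/-- `Ext^n_{A^e}(A, A ⊗ A)` as an `A`-bimodule. -/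
abbrev extBimod (n : ℕ) : Bimod k A := { carrier := ExtEnv k A n }

/-- `A` satisfies the conditions for van den Bergh duality of dimension `d`. -/
structure VanDenBerghDuality (d : ℕ) : Prop where
  smooth : HomologicallySmooth k A
  vanishing : ∀ i, i ≠ d → Subsingleton (ExtEnv k A i)
  invertible : (extBimod k A d).IsInvertible

/-- `A` is a Calabi-Yau algebra of dimension `d`. -/
structure IsCalabiYau (d : ℕ) : Prop where
  smooth : HomologicallySmooth k A
  vanishing : ∀ i, i ≠ d → Subsingleton (ExtEnv k A i)
  dualizing : (extBimod k A d).IsIso (Bimod.self k A)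

end Duality

end VdB

end

/-! Vanishing of `Ext` above `d` lets a finite resolution of `A` be cut down to a complex `P` of
finitely generated projective bimodules of length `d`. Vanishing below `d` says that the dual
complex `P^∨`, reindexed by `n ↦ d - n`, resolves `U = Ext^d`. For `B = A[U]` there is the exact
sequence `0 → B ⊗_A U ⊗_A B → B ⊗_A B → B → 0` whose first map sends `x ⊗ u ⊗ y` to `xu ⊗ y - x ⊗
uy` (`exists_koszul_eq`, `koszul_injective`). An invertible bimodule is projective on both sides, so
`B` is projective over `A` on both sides, and base change turns `P` and `P^∨` into resolutions of
the middle and left terms. If `Φ` is a chain map from the second to the first covering that arrow up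
to sign, its mapping cone is a resolution of `B` of length `d + 1` (`total_exact`).

The dual of the cone of `Φ` is the cone of the adjoint `Φ^*`. So if `Φ^* = ±Φ` on the nose, the cone
is isomorphic to its own dual up to a shift by `d + 1` (`cone_isSelfDual`). Then `Ext^m_{B^e}(B,
B^e)` is the homology of a resolution of `B` in degree `d + 1 - m`: zero for `m ≠ d + 1`, and `B`
for `m = d + 1` (`ext_eq_zero`, `extBimod_isIso`).

To obtain the symmetry, lift only the half `u ↦ 1 ⊗ u` of the arrow to a chain map `G`; this can be
done over `A ⊗ Bᵒᵖ`. The adjoint of `G` covers `c (u ⊗ 1)` with a sign `c` depending only on `d`, so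
`Φ = G - c G^*` covers minus the arrow and satisfies `Φ^* = -c Φ` strictly (`exists_form`). The
claim about the adjoint (`exists_symmetric_comparison`) comes from a homotopy between the two maps
`P ⊗_A P → P` given by augmenting either factor (`exists_homotopy`), evaluated on `G` and folded
into `B` by a trace-like map. The homotopy is built from a right `B`-linear contraction of the half
base change (`exists_contraction`), and that is where projectivity of `A` over `k` enters.

All complexes are stored as matrices over enveloping algebras acting on row vectors: an idempotent
`E` cuts out the projective terms, `D` is the total differential, and dualizing is the conjugate
transpose for the flip `x ⊗ y ↦ y ⊗ x`. -/

noncomputable section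

namespace VdB

/-! ### Row vectors with values in a module -/

section RowDot

variable {R : Type*} [Ring R] {M : Type*} [AddCommGroup M] [Module R M] {ι : Type*} [Fintype ι]

/-- The pairing of a row vector over `R` with a column of elements of an `R`-module. -/
def rowDot (v : ι → R) (p : ι → M) : M := ∑ s, v s • p s

theorem rowDot_add (v w : ι → R) (p : ι → M) : rowDot (v + w) p = rowDot v p + rowDot w p := by
  simp [rowDot, add_smul, Finset.sum_add_distrib]

theorem rowDot_sub (v w : ι → R) (p : ι → M) : rowDot (v - w) p = rowDot v p - rowDot w p := by
  simp [rowDot, sub_smul, Finset.sum_sub_distrib]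

theorem rowDot_neg (v : ι → R) (p : ι → M) : rowDot (-v) p = -rowDot v p := by
  simp [rowDot]

theorem rowDot_smul (r : R) (v : ι → R) (p : ι → M) : rowDot (r • v) p = r • rowDot v p := by
  simp [rowDot, mul_smul, Finset.smul_sum]

@[simp]
theorem rowDot_zero (p : ι → M) : rowDot (0 : ι → R) p = 0 := by simp [rowDot]

@[simp]
theorem rowDot_zero_right (v : ι → R) : rowDot v (0 : ι → M) = 0 := by simp [rowDot]

open Matrix in
theorem rowDot_vecMul {κ : Type*} [Fintype κ] (v : κ → R) (D : Matrix κ ι R) (p : ι → M) :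
    rowDot (v ᵥ* D) p = rowDot v fun s => rowDot (D s) p := by
  simp only [rowDot, Matrix.vecMul, dotProduct, Finset.sum_smul, Finset.smul_sum, mul_smul]
  exact Finset.sum_comm

end RowDot

/-! ### Two-sided scalars -/

section Two

variable (k : Type u) [CommRing k] (A B : Type v) [Ring A] [Algebra k A] [Ring B] [Algebra k B]

/-- The algebra `A ⊗ Bᵒᵖ`, whose left modules are the `A`-`B`-bimodules. -/
def Two : Type v := A ⊗[k] Bᵐᵒᵖ

instance : Ring (Two k A B) := inferInstanceAs (Ring (A ⊗[k] Bᵐᵒᵖ))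

instance : Algebra k (Two k A B) := inferInstanceAs (Algebra k (A ⊗[k] Bᵐᵒᵖ))

variable {k A B}

namespace Two

/-- The element `a ⊗ b`. -/
def tm : A →ₗ[k] B →ₗ[k] Two k A B :=
  (TensorProduct.mk k A Bᵐᵒᵖ).compl₂ (opLinearEquiv k).toLinearMap

theorem tm_mul_tm (a a' : A) (b b' : B) :
    (tm a b * tm a' b' : Two k A B) = tm (a * a') (b' * b) :=
  Algebra.TensorProduct.tmul_mul_tmul a a' (op b) (op b')

theorem one_def : (1 : Two k A B) = tm 1 1 := rfl

@[elab_as_elim]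
theorem induction {p : Two k A B → Prop} (h0 : p 0) (htm : ∀ a b, p (tm a b))
    (hadd : ∀ x y, p x → p y → p (x + y)) (x : Two k A B) : p x :=
  TensorProduct.induction_on (motive := p) x h0 (fun a b => htm a b.unop) hadd

/-- The linear map out of `A ⊗ Bᵒᵖ` given by a bilinear map. -/
def lift {P : Type*} [AddCommGroup P] [Module k P] (f : A →ₗ[k] B →ₗ[k] P) : Two k A B →ₗ[k] P :=
  TensorProduct.lift (f.compl₂ (opLinearEquiv k).symm.toLinearMap)

@[simp]
theorem lift_tm {P : Type*} [AddCommGroup P] [Module k P] (f : A →ₗ[k] B →ₗ[k] P) (a : A) (b : B) :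
    lift f (tm a b) = f a b :=
  TensorProduct.lift.tmul (R := k) a (op b)

/-- The algebra map induced by maps of the two factors. -/
def map {A' B' : Type v} [Ring A'] [Algebra k A'] [Ring B'] [Algebra k B'] (f : A →ₐ[k] A')
    (g : B →ₐ[k] B') : Two k A B →ₐ[k] Two k A' B' :=
  (Algebra.TensorProduct.map f (AlgHom.op g) : A ⊗[k] Bᵐᵒᵖ →ₐ[k] A' ⊗[k] B'ᵐᵒᵖ)

@[simp]
theorem map_tm {A' B' : Type v} [Ring A'] [Algebra k A'] [Ring B'] [Algebra k B'] (f : A →ₐ[k] A')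
    (g : B →ₐ[k] B') (a : A) (b : B) : map f g (tm a b) = tm (f a) (g b) := rfl

/-- The flip `x ⊗ y ↦ y ⊗ x`. -/
def flip : Two k A A →ₗ[k] Two k A A := lift tm.flip

@[simp]
theorem flip_tm (a b : A) : flip (tm a b : Two k A A) = tm b a := by simp [flip]

/-- The flip is an anti-automorphism of `A^e`. It turns right modules into left modules, so the dual
of a complex given by a matrix is again a complex of left modules, given by the conjugate transpose.
-/
instance : StarRing (Two k A A) where
  star := flip
  star_involutive x := by
    induction x using induction with
    | h0 => simp
    | htm a b => simp
    | hadd x y hx hy => simp only [map_add, hx, hy]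
  star_mul x y := by
    induction x using induction with
    | h0 => simp
    | htm a b =>
      induction y using induction with
      | h0 => simp
      | htm c e => simp [tm_mul_tm]
      | hadd y z hy hz => simp only [mul_add, map_add, hy, hz, add_mul]
    | hadd x z hx hz => simp only [add_mul, map_add, hx, hz, mul_add]
  star_add x y := map_add flip x y

@[simp]
theorem star_tm (a b : A) : star (tm a b : Two k A A) = tm b a := flip_tm a b

section

variable (M : Type v) [AddCommGroup M] [Module k M] [Module A M] [Module Aᵐᵒᵖ M]
  [IsScalarTower k A M] [IsScalarTower k Aᵐᵒᵖ M] [SMulCommClass A Aᵐᵒᵖ M]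

/-- The action of the enveloping algebra on a bimodule. -/
abbrev module : Module (Two k A A) M :=
  (TensorProduct.Algebra.module : Module (A ⊗[k] Aᵐᵒᵖ) M)

theorem module_isScalarTower :
    letI := module (k := k) (A := A) M
    IsScalarTower k (Two k A A) M :=
  letI := module (k := k) (A := A) M
  { smul_assoc := fun c x m => LinearMap.congr_fun
      (map_smul (TensorProduct.Algebra.moduleAux (R := k) (A := A) (B := Aᵐᵒᵖ) (M := M)) c x) m }

end

instance bimodModule (M : Bimod k A) : Module (Two k A A) M := module M

theorem tm_smul {M : Bimod k A} (a b : A) (m : M) :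
    (tm a b : Two k A A) • m = a • op b • m := rfl

instance (M : Bimod k A) : IsScalarTower k (Two k A A) M := module_isScalarTower M

instance selfModule : Module (Two k A A) A := module A

instance : IsScalarTower k (Two k A A) A := module_isScalarTower A

@[simp]
theorem tm_smul_self (a b x : A) : (tm a b : Two k A A) • x = a * x * b :=
  (mul_assoc a x b).symm

end Two

end Two

/-! ### Projectivity along an algebra map -/

section RightProj

variable {k : Type u} [CommRing k]

/-- `S` is projective as a right `R`-module through `f`, witnessed by a dual basis. -/
def RightProj {R S : Type v} [Ring R] [Ring S] [Algebra k R] [Algebra k S] (f : R →ₐ[k] S) :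
    Prop :=
  ∃ (J : Type v) (b : J → S) (l : S →ₗ[k] J →₀ R), (∀ x r j, l (x * f r) j = l x j * r) ∧
    ∀ x, ((l x).sum fun j r => b j * f r) = x

theorem RightProj.id (R : Type v) [Ring R] [Algebra k R] : RightProj (AlgHom.id k R) := by
  refine ⟨PUnit, fun _ => 1, Finsupp.lsingle PUnit.unit, fun x r j => ?_, fun x => ?_⟩
  · simp [Finsupp.lsingle_apply]
  · simp [Finsupp.lsingle_apply]

/-- Products of dual basis elements form a dual basis of the tensor product. Working with dual bases
avoids any flatness hypothesis over `k`. -/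
theorem RightProj.map {R S R' S' : Type v} [Ring R] [Ring S] [Algebra k R] [Algebra k S]
    [Ring R'] [Ring S'] [Algebra k R'] [Algebra k S'] {f : R →ₐ[k] S} {g : R' →ₐ[k] S'}
    (hf : RightProj f) (hg : RightProj g) : RightProj (Algebra.TensorProduct.map f g) := by
  obtain ⟨J, b, l, h₁, h₂⟩ := hf
  obtain ⟨J', b', l', h₁', h₂'⟩ := hg
  have key : ∀ x y j, (finsuppTensorFinsupp k k R R' J J' ((TensorProduct.map l l') (x ⊗ₜ y))) j =
      l x j.1 ⊗ₜ[k] l' y j.2 := fun x y j => by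
    rw [TensorProduct.map_tmul, finsuppTensorFinsupp_apply]
  refine ⟨J × J', fun j => b j.1 ⊗ₜ b' j.2,
    (finsuppTensorFinsupp k k R R' J J').toLinearMap ∘ₗ TensorProduct.map l l', ?_, ?_⟩
  · intro x r j
    induction x using TensorProduct.induction_on with
    | zero => simp
    | tmul x y =>
      induction r using TensorProduct.induction_on with
      | zero => simp
      | tmul r r' =>
        rw [Algebra.TensorProduct.map_tmul, Algebra.TensorProduct.tmul_mul_tmul]
        simp only [LinearMap.comp_apply, LinearEquiv.coe_coe, key, h₁, h₁',
          Algebra.TensorProduct.tmul_mul_tmul]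
      | add r s hr hs => simp only [map_add, mul_add, Finsupp.add_apply, hr, hs]
    | add x y hx hy => simp only [map_add, add_mul, Finsupp.add_apply, hx, hy]
  · intro x
    induction x using TensorProduct.induction_on with
    | zero => simp
    | tmul x y =>
      conv_rhs => rw [← h₂ x, ← h₂' y]
      rw [Finsupp.sum_of_support_subset (s := (l x).support ×ˢ (l' y).support)]
      · rw [Finsupp.sum, Finsupp.sum, TensorProduct.sum_tmul, Finset.sum_product]
        refine Finset.sum_congr rfl fun i _ => ?_
        rw [TensorProduct.tmul_sum]
        refine Finset.sum_congr rfl fun j _ => ?_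
        simp only [LinearMap.comp_apply, LinearEquiv.coe_coe, key,
          Algebra.TensorProduct.map_tmul, Algebra.TensorProduct.tmul_mul_tmul]
      · intro j hj
        simp only [LinearMap.comp_apply, LinearEquiv.coe_coe, Finsupp.mem_support_iff, key] at hj
        rw [Finset.mem_product, Finsupp.mem_support_iff, Finsupp.mem_support_iff]
        exact ⟨fun h => hj (by rw [h, TensorProduct.zero_tmul]),
          fun h => hj (by rw [h, TensorProduct.tmul_zero])⟩
      · simp
    | add x y hx hy =>
      rw [map_add, Finsupp.sum_add_index', hx, hy]
      · simp
      · intro a b c; rw [map_add, mul_add]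

/-- `S` is projective as a left `R`-module through `f`, witnessed by a dual basis. -/
def LeftProj {R S : Type v} [Ring R] [Ring S] [Algebra k R] [Algebra k S] (f : R →ₐ[k] S) :
    Prop :=
  ∃ (J : Type v) (b : J → S) (l : S →ₗ[k] J →₀ R), (∀ x r j, l (f r * x) j = r * l x j) ∧
    ∀ x, ((l x).sum fun j r => f r * b j) = x

theorem LeftProj.op {R S : Type v} [Ring R] [Ring S] [Algebra k R] [Algebra k S] {f : R →ₐ[k] S}
    (hf : LeftProj f) : RightProj (AlgHom.op f) := by
  obtain ⟨J, b, l, h₁, h₂⟩ := hf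
  refine ⟨J, fun j => MulOpposite.op (b j), Finsupp.mapRange.linearMap (opLinearEquiv k).toLinearMap ∘ₗ
    l ∘ₗ (opLinearEquiv k).symm.toLinearMap, fun x r j => ?_, fun x => ?_⟩
  · apply unop_injective
    simp [h₁]
  · apply unop_injective
    conv_rhs => rw [← h₂ x.unop]
    rw [LinearMap.comp_apply, Finsupp.mapRange.linearMap_apply,
      Finsupp.sum_mapRange_index (by simp), Finsupp.sum, Finsupp.sum, Finset.unop_sum]
    rfl

/-- The second tensor factor is an opposite algebra, which is why the second map has to be
projective on the left. -/
theorem RightProj.two {A B A' B' : Type v} [Ring A] [Algebra k A] [Ring B] [Algebra k B]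
    [Ring A'] [Algebra k A'] [Ring B'] [Algebra k B'] {f : A →ₐ[k] A'} {g : B →ₐ[k] B'}
    (hf : RightProj f) (hg : LeftProj g) : RightProj (Two.map f g) :=
  hf.map hg.op

end RightProj

/-! ### Base change along an algebra map -/

section BaseChange

variable {k : Type u} [CommRing k] {R S : Type v} [Ring R] [Ring S] [Algebra k R] [Algebra k S]
  (f : R →ₐ[k] S) (M : Type v) [AddCommGroup M] [Module k M] [Module R M]

/-- The submodule of `S ⊗[k] M` generated by all `s f(r) ⊗ m - s ⊗ r m`. -/
def baseChangeRel : Submodule S (S ⊗[k] M) :=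
  Submodule.span S {x | ∃ (r : R) (m : M), x = f r ⊗ₜ[k] m - 1 ⊗ₜ[k] (r • m)}

/-- The extension of scalars of the left `R`-module `M` along `f`. -/
def BaseChange : Type v := (S ⊗[k] M) ⧸ baseChangeRel f M

instance : AddCommGroup (BaseChange f M) :=
  inferInstanceAs (AddCommGroup ((S ⊗[k] M) ⧸ baseChangeRel f M))

instance : Module S (BaseChange f M) :=
  inferInstanceAs (Module S ((S ⊗[k] M) ⧸ baseChangeRel f M))

instance : Module k (BaseChange f M) :=
  inferInstanceAs (Module k ((S ⊗[k] M) ⧸ baseChangeRel f M))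

instance : IsScalarTower k S (BaseChange f M) :=
  inferInstanceAs (IsScalarTower k S ((S ⊗[k] M) ⧸ baseChangeRel f M))

variable {M}

namespace BaseChange

/-- The canonical map from `M` to its base change. -/
def of : M →ₗ[k] BaseChange f M :=
  ((baseChangeRel f M).mkQ.restrictScalars k) ∘ₗ TensorProduct.mk k S M 1

theorem of_smul (r : R) (m : M) : of f (r • m) = f r • of f m := by
  symm
  change f r • (baseChangeRel f M).mkQ _ = (baseChangeRel f M).mkQ _
  rw [← map_smul, ← sub_eq_zero, ← map_sub, Submodule.mkQ_apply, Submodule.Quotient.mk_eq_zero]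
  refine Submodule.subset_span ⟨r, m, ?_⟩
  simp [TensorProduct.smul_tmul']

variable {f}

@[elab_as_elim]
theorem induction {P : BaseChange f M → Prop} (h0 : P 0) (hof : ∀ (s : S) (m : M), P (s • of f m))
    (hadd : ∀ x y, P x → P y → P (x + y)) (x : BaseChange f M) : P x := by
  obtain ⟨t, rfl⟩ := Submodule.mkQ_surjective _ x
  induction t using TensorProduct.induction_on with
  | zero => rw [map_zero]; exact h0
  | tmul s m =>
    have : s ⊗ₜ[k] m = s • ((1 : S) ⊗ₜ[k] m) := by simp [TensorProduct.smul_tmul']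
    rw [this, map_smul]
    exact hof s m
  | add x y hx hy => rw [map_add]; exact hadd _ _ hx hy

/-- A `k`-linear map out of the base change given by a balanced bilinear map. -/
def liftBase {N : Type*} [AddCommGroup N] [Module k N] (φ : S →ₗ[k] M →ₗ[k] N)
    (hφ : ∀ s r m, φ (s * f r) m = φ s (r • m)) : BaseChange f M →+ N :=
  QuotientAddGroup.lift (baseChangeRel f M).toAddSubgroup (TensorProduct.lift φ).toAddMonoidHom <| by
    intro x hx
    -- The relations generate an `S`-submodule while `φ` is only `k`-linear in `S`, so vanishing has
    -- to be carried along for all multiples.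
    suffices h : ∀ s : S, TensorProduct.lift φ (s • x) = 0 by simpa using h 1
    refine Submodule.span_induction (p := fun x _ => ∀ s : S, TensorProduct.lift φ (s • x) = 0)
      ?_ ?_ ?_ ?_ hx
    · rintro _ ⟨r, m, rfl⟩ s
      rw [smul_sub, TensorProduct.smul_tmul', TensorProduct.smul_tmul']
      simp [hφ]
    · simp
    · intro x y _ _ h₁ h₂ s
      rw [smul_add, map_add, h₁, h₂, add_zero]
    · intro a x _ h s
      rw [← mul_smul, h]

theorem liftBase_smul_of {N : Type*} [AddCommGroup N] [Module k N] (φ : S →ₗ[k] M →ₗ[k] N)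
    (hφ : ∀ s r m, φ (s * f r) m = φ s (r • m)) (s : S) (m : M) :
    liftBase φ hφ (s • of f m) = φ s m := by
  have : s • of f m = (baseChangeRel f M).mkQ (s ⊗ₜ[k] m) := by
    change s • (baseChangeRel f M).mkQ _ = _
    rw [← map_smul, TensorProduct.mk_apply, TensorProduct.smul_tmul']
    simp
  rw [this]
  exact TensorProduct.lift.tmul s m

end BaseChange

open Matrix in
/-- Exactness of a complex of free modules with an augmentation is preserved by a projective
base change. -/
theorem RightProj.exact [IsScalarTower k R M] {f : R →ₐ[k] S} (hf : RightProj f) {ι : Type*} [Fintype ι]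
    {E D : Matrix ι ι R} {p : ι → M}
    (hex : ∀ v : ι → R, v ᵥ* E = v → v ᵥ* D = 0 → rowDot v p = 0 → ∃ w, w ᵥ* D = v)
    (v : ι → S) (hE : v ᵥ* E.map f = v) (hD : v ᵥ* D.map f = 0)
    (hp : rowDot v (fun s => BaseChange.of f (p s)) = 0) : ∃ w, w ᵥ* D.map f = v := by
  classical
  obtain ⟨J, b, l, h₁, h₂⟩ := hf
  -- Dual basis coordinates are right `R`-linear, so they commute with matrices coming from `R`: a
  -- row over `S` splits into rows over `R`, to which the hypothesis applies one at a time.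
  have hl : ∀ (M : Matrix ι ι R) (v : ι → S) j,
      (fun t => l ((v ᵥ* M.map f) t) j) = (fun t => l (v t) j) ᵥ* M := fun M v j => by
    funext t
    simp only [Matrix.vecMul, dotProduct, map_sum, Matrix.map_apply, Finsupp.coe_finsetSum,
      Finset.sum_apply, h₁]
  -- The map `s ⊗ m ↦ l(s)_j m` is balanced, so it descends to the base change and carries the
  -- vanishing of the augmentation to each coordinate row.
  have hr : ∀ j, rowDot (fun t => l (v t) j) p = 0 := fun j => by
    let φ : S →ₗ[k] M →ₗ[k] M := (Algebra.lsmul k k M).toLinearMap ∘ₗ Finsupp.lapply j ∘ₗ l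
    have hφ : ∀ s r m, φ (s * f r) m = φ s (r • m) := fun s r m => by
      change l (s * f r) j • m = l s j • r • m
      rw [h₁, mul_smul]
    have := congrArg (BaseChange.liftBase φ hφ) hp
    rw [rowDot, map_sum, map_zero] at this
    rw [← this]
    exact Finset.sum_congr rfl fun s _ => (BaseChange.liftBase_smul_of φ hφ (v s) (p s)).symm
  have hw : ∀ j, ∃ w, w ᵥ* D = fun t => l (v t) j := fun j => by
    refine hex _ ?_ ?_ (hr j)
    · rw [← hl, hE]
    · rw [← hl, hD]; funext t; simp
  choose w hw using hw
  -- Only finitely many coordinates of `v` are nonzero; the primitives found over `R` are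
  -- reassembled with the dual basis.
  let T : Finset J := Finset.univ.biUnion fun t => (l (v t)).support
  refine ⟨fun s => ∑ j ∈ T, b j * f (w j s), ?_⟩
  funext t
  conv_rhs => rw [← h₂ (v t)]
  rw [Finsupp.sum_of_support_subset (s := T) _
    (Finset.subset_biUnion_of_mem (fun t => (l (v t)).support) (Finset.mem_univ t)) _ (by simp)]
  simp only [Matrix.vecMul, dotProduct, Finset.sum_mul, Matrix.map_apply]
  rw [Finset.sum_comm]
  refine Finset.sum_congr rfl fun j _ => ?_
  have := congrFun (hw j) t
  simp only [Matrix.vecMul, dotProduct] at this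
  rw [← this, map_sum, Finset.mul_sum]
  exact Finset.sum_congr rfl fun s _ => by rw [map_mul, mul_assoc]

end BaseChange

open Matrix

/-! ### Maps between enveloping algebras -/

section EnvMap

variable {k : Type u} [CommRing k] {A B : Type v} [Ring A] [Algebra k A] [Ring B] [Algebra k B]
  (i : A →ₐ[k] B)

/-- The map `A ⊗ Aᵒᵖ → A ⊗ Bᵒᵖ` induced by `i`. -/
abbrev toHalf : Two k A A →ₐ[k] Two k A B := Two.map (AlgHom.id k A) i

/-- The map `A ⊗ Bᵒᵖ → B ⊗ Bᵒᵖ` induced by `i`. -/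
abbrev ofHalf : Two k A B →ₐ[k] Two k B B := Two.map i (AlgHom.id k B)

/-- The map of enveloping algebras induced by `i`. -/
abbrev envMap : Two k A A →ₐ[k] Two k B B := Two.map i i

theorem ofHalf_toHalf (x : Two k A A) : ofHalf i (toHalf i x) = envMap i x := by
  induction x using Two.induction with
  | h0 => simp
  | htm a b => simp
  | hadd x y hx hy => simp only [map_add, hx, hy]

theorem star_envMap (x : Two k A A) : star (envMap i x) = envMap i (star x) := by
  induction x using Two.induction with
  | h0 => simp
  | htm a b => simp
  | hadd x y hx hy => simp only [map_add, star_add, hx, hy]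

theorem envMap_smul (x : Two k A A) (a : A) : envMap i x • i a = i (x • a) := by
  induction x using Two.induction with
  | h0 => simp
  | htm b c => simp
  | hadd x y hx hy => simp only [map_add, add_smul, hx, hy]

theorem rowDot_envMap {ι : Type*} [Fintype ι] (v : ι → Two k A A) (p : ι → A) :
    rowDot (fun t => envMap i (v t)) (fun t => i (p t)) = i (rowDot v p) := by
  simp [rowDot, envMap_smul]

end EnvMap

/-! ### Finite projective resolutions of the diagonal bimodule, as matrices -/

/-- A complex of finitely generated projective bimodules resolving `A`, given by matrices over the
enveloping algebra: the module of row vectors `v` with `v E = v` is graded by the degrees of the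
coordinates, the differential is `v ↦ v D`, and the augmentation is `v ↦ v p`. -/
structure ResData (k : Type u) [CommRing k] (A : Type v) [Ring A] [Algebra k A] (ι : Type)
    [Fintype ι] where
  deg : ι → ℕ
  E : Matrix ι ι (Two k A A)
  D : Matrix ι ι (Two k A A)
  p : ι → A
  p₀ : ι → Two k A A
  E_E : E * E = E
  E_D : E * D = D
  D_E : D * E = D
  D_D : D * D = 0
  E_deg : ∀ s t, deg s ≠ deg t → E s t = 0
  D_deg : ∀ s t, deg s ≠ deg t + 1 → D s t = 0
  p_deg : ∀ s, deg s ≠ 0 → p s = 0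
  E_p : ∀ s, rowDot (E s) p = p s
  D_p : ∀ s, rowDot (D s) p = 0
  p₀_deg : ∀ s, deg s ≠ 0 → p₀ s = 0
  p₀_E : p₀ ᵥ* E = p₀
  p₀_p : rowDot p₀ p = 1
  exact : ∀ v : ι → Two k A A, v ᵥ* E = v → v ᵥ* D = 0 → rowDot v p = 0 → ∃ w, w ᵥ* D = v

namespace ResData

variable {k : Type u} [CommRing k] {A B : Type v} [Ring A] [Algebra k A] [Ring B] [Algebra k B]
  {ι : Type} [Fintype ι] (X : ResData k A ι) (i : A →ₐ[k] B)

theorem p₀_D : X.p₀ ᵥ* X.D = 0 := by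
  funext t
  refine Finset.sum_eq_zero fun s _ => ?_
  change X.p₀ s * X.D s t = 0
  by_cases hs : X.deg s = 0
  · rw [X.D_deg s t (by omega), mul_zero]
  · rw [X.p₀_deg s hs, zero_mul]

/-- Right multiplication by a matrix over `A ⊗ Aᵒᵖ` on row vectors over `A ⊗ Bᵒᵖ`. -/
def rmul (M : Matrix ι ι (Two k A A)) : Module.End k (ι → Two k A B) :=
  ((M.map (toHalf i)).vecMulLinear).restrictScalars k

theorem rmul_apply (M : Matrix ι ι (Two k A A)) (v : ι → Two k A B) :
    rmul i M v = v ᵥ* M.map (toHalf i) := rfl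

theorem rmul_apply_apply (M : Matrix ι ι (Two k A A)) (v : ι → Two k A B) (t : ι) :
    rmul i M v t = ∑ j, v j * toHalf i (M j t) := rfl

theorem rmul_smul (M : Matrix ι ι (Two k A A)) (c : Two k A B) (v : ι → Two k A B) :
    rmul i M (c • v) = c • rmul i M v := by
  rw [rmul_apply, rmul_apply, Matrix.smul_vecMul]

theorem rmul_rmul (M N : Matrix ι ι (Two k A A)) (v : ι → Two k A B) :
    rmul i N (rmul i M v) = rmul i (M * N) v := by
  rw [rmul_apply, rmul_apply, rmul_apply, Matrix.vecMul_vecMul, Matrix.map_mul]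

theorem rmul_zero (v : ι → Two k A B) : rmul i (0 : Matrix ι ι (Two k A A)) v = 0 := by
  rw [rmul_apply, Matrix.map_zero _ (map_zero _), Matrix.vecMul_zero]

theorem rmul_toHalf (M : Matrix ι ι (Two k A A)) (v : ι → Two k A A) :
    rmul i M (fun t => toHalf i (v t)) = fun t => toHalf i ((v ᵥ* M) t) := by
  funext t
  simp [rmul_apply, Matrix.vecMul, dotProduct]

theorem D_D_apply (v : ι → Two k A B) : rmul i X.D (rmul i X.D v) = 0 := by
  rw [rmul_rmul, X.D_D, rmul_zero]

theorem D_E_apply (v : ι → Two k A B) : rmul i X.E (rmul i X.D v) = rmul i X.D v := by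
  rw [rmul_rmul, X.D_E]

theorem E_D_apply (v : ι → Two k A B) : rmul i X.D (rmul i X.E v) = rmul i X.D v := by
  rw [rmul_rmul, X.E_D]

theorem E_E_apply (v : ι → Two k A B) : rmul i X.E (rmul i X.E v) = rmul i X.E v := by
  rw [rmul_rmul, X.E_E]

/-- The augmentation `v ↦ v p` on row vectors over `A ⊗ Bᵒᵖ`. -/
def aug : (ι → Two k A B) →ₗ[k] B :=
  ∑ t, (LinearMap.flip (Algebra.lsmul k k B).toLinearMap (i (X.p t))) ∘ₗ
    (ofHalf i).toLinearMap ∘ₗ LinearMap.proj t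

theorem aug_apply (v : ι → Two k A B) :
    X.aug i v = rowDot (fun t => ofHalf i (v t)) (fun t => i (X.p t)) := by
  simp [aug, rowDot, LinearMap.sum_apply]

theorem aug_smul (c : Two k A B) (v : ι → Two k A B) :
    X.aug i (c • v) = ofHalf i c • X.aug i v := by
  rw [aug_apply, aug_apply, ← rowDot_smul]
  congr 1
  funext t
  simp

theorem aug_smul_right (b : B) (v : ι → Two k A B) :
    X.aug i ((Two.tm 1 b : Two k A B) • v) = X.aug i v * b := by
  rw [aug_smul]
  simp

theorem aug_smul_left (a : A) (v : ι → Two k A B) :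
    X.aug i ((Two.tm a 1 : Two k A B) • v) = i a * X.aug i v := by
  rw [aug_smul]
  simp

theorem aug_rmul (M : Matrix ι ι (Two k A A)) (v : ι → Two k A B) :
    X.aug i (rmul i M v) = rowDot (fun t => ofHalf i (v t)) fun s => i (rowDot (M s) X.p) := by
  have : (fun t => ofHalf i ((rmul i M v) t)) = (fun t => ofHalf i (v t)) ᵥ* M.map (envMap i) := by
    funext t
    simp [rmul_apply, Matrix.vecMul, dotProduct, ofHalf_toHalf]
  rw [aug_apply, this, rowDot_vecMul]
  simp only [← rowDot_envMap]
  rfl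

theorem aug_D (v : ι → Two k A B) : X.aug i (rmul i X.D v) = 0 := by
  rw [aug_rmul]
  simp only [X.D_p, map_zero]
  exact rowDot_zero_right _

theorem aug_E (v : ι → Two k A B) : X.aug i (rmul i X.E v) = X.aug i v := by
  rw [aug_rmul, aug_apply]
  simp only [X.E_p]

theorem aug_toHalf (v : ι → Two k A A) : X.aug i (fun t => toHalf i (v t)) = i (rowDot v X.p) := by
  rw [aug_apply]
  simp only [ofHalf_toHalf]
  exact rowDot_envMap i v X.p

theorem aug_eq_zero_of_deg (v : ι → Two k A B) (hv : ∀ t, X.deg t = 0 → v t = 0) :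
    X.aug i v = 0 := by
  rw [aug_apply]
  refine Finset.sum_eq_zero fun t _ => ?_
  by_cases ht : X.deg t = 0
  · simp [hv t ht]
  · simp [X.p_deg t ht]

/-- Exactness of the resolution after base change to `A ⊗ Bᵒᵖ`. -/
theorem exact_half (hi : LeftProj i) (v : ι → Two k A B) (hE : rmul i X.E v = v)
    (hD : rmul i X.D v = 0) (hp : X.aug i v = 0) : ∃ w, rmul i X.D w = v := by
  have hf : RightProj (toHalf i) := (RightProj.id A).two hi
  refine hf.exact (M := A) X.exact v hE hD ?_
  -- The base change of `A` to `A ⊗ Bᵒᵖ` is generated by the class of `1` over the right factor `B`,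
  -- because left scalars from `A` cross the middle. Hence vanishing of `aug` forces vanishing of
  -- the augmentation in the base change.
  have key : ∀ (c : Two k A B) (a : A), c • BaseChange.of (toHalf i) a =
      (Two.tm 1 (ofHalf i c • i a) : Two k A B) • BaseChange.of (toHalf i) (1 : A) := by
    intro c a
    induction c using Two.induction with
    | h0 => simp
    | htm x b =>
      have h1 : a = (Two.tm a 1 : Two k A A) • (1 : A) := by simp
      have h2 : (Two.tm (x * a) 1 : Two k A A) • (1 : A) =
          (Two.tm 1 (x * a) : Two k A A) • (1 : A) := by simp
      have h3 : (Two.tm x b : Two k A B) * toHalf i (Two.tm a 1) =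
          Two.tm 1 b * toHalf i (Two.tm (x * a) 1) := by simp [Two.tm_mul_tm]
      conv_lhs => rw [h1, BaseChange.of_smul, ← mul_smul]
      rw [h3, mul_smul, ← BaseChange.of_smul, h2, BaseChange.of_smul, ← mul_smul]
      simp [Two.tm_mul_tm]
    | hadd x y hx hy => simp only [add_smul, map_add, hx, hy]
  have : rowDot v (fun s => BaseChange.of (toHalf i) (X.p s)) =
      (Two.tm 1 (X.aug i v) : Two k A B) • BaseChange.of (toHalf i) (1 : A) := by
    rw [aug_apply, rowDot, rowDot]
    rw [map_sum, Finset.sum_smul]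
    exact Finset.sum_congr rfl fun s _ => key _ _
  rw [this, hp]
  simp

/-! ### A contracting homotopy -/

/-- The `k`-linear endomorphisms of row vectors which commute with the right action of `B`. -/
def RightLin (φ : Module.End k (ι → Two k A B)) : Prop :=
  ∀ (b : B) v, φ ((Two.tm 1 b : Two k A B) • v) = (Two.tm 1 b : Two k A B) • φ v

/-- A right `B`-linear map on rows over `A ⊗ Bᵒᵖ` is determined by a `k`-linear map on each copy of
`A ⊗ 1`. Since `A` is projective over `k`, these maps lift through `D` onto its range, and the lifts
extend right `B`-linearly. -/
theorem exists_lift [DecidableEq ι] [Module.Projective k A]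
    (D G : Module.End k (ι → Two k A B)) (hD : RightLin D) (hG : RightLin G)
    (h : ∀ v, ∃ w, D w = G v) : ∃ G', RightLin G' ∧ ∀ v, D (G' v) = G v := by
  let g (t : ι) : A →ₗ[k] LinearMap.range D :=
    LinearMap.codRestrict _ (G ∘ₗ LinearMap.single k (fun _ => Two k A B) t ∘ₗ
      Two.tm.flip 1) fun x => h _
  have hg (t : ι) : ∃ g' : A →ₗ[k] (ι → Two k A B), D.rangeRestrict ∘ₗ g' = g t :=
    Module.projective_lifting_property _ (g t) D.surjective_rangeRestrict
  choose g' hg' using hg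
  have hg'' (t : ι) (x : A) : D (g' t x) = G (Pi.single t (Two.tm x 1)) :=
    congrArg Subtype.val (LinearMap.congr_fun (hg' t) x)
  let L : B →ₗ[k] Module.End k (ι → Two k A B) :=
    (Algebra.lsmul k k (ι → Two k A B)).toLinearMap ∘ₗ Two.tm (1 : A)
  have hL (b : B) (v : ι → Two k A B) : L b v = (Two.tm 1 b : Two k A B) • v := rfl
  let G' : Module.End k (ι → Two k A B) :=
    ∑ t, Two.lift (L.flip ∘ₗ g' t) ∘ₗ LinearMap.proj t
  have hG' (v) : G' v = ∑ t, Two.lift (L.flip ∘ₗ g' t) (v t) := by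
    simp [G', LinearMap.sum_apply]
  refine ⟨G', fun b v => ?_, fun v => ?_⟩
  · rw [hG', hG', Finset.smul_sum]
    refine Finset.sum_congr rfl fun t _ => ?_
    rw [Pi.smul_apply]
    induction v t using Two.induction with
    | h0 => simp
    | htm x c =>
      rw [smul_eq_mul, Two.tm_mul_tm, Two.lift_tm, Two.lift_tm]
      simp only [LinearMap.comp_apply, LinearMap.flip_apply, hL, ← mul_smul, Two.tm_mul_tm,
        one_mul]
    | hadd x y hx hy => rw [smul_add, map_add, hx, hy, map_add, smul_add]
  · rw [hG', map_sum]
    conv_rhs => rw [← Finset.univ_sum_single v, map_sum]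
    refine Finset.sum_congr rfl fun t _ => ?_
    induction v t using Two.induction with
    | h0 => simp
    | htm x c =>
      have h1 : Pi.single (M := fun _ => Two k A B) t (Two.tm x c) =
          (Two.tm 1 c : Two k A B) • Pi.single t (Two.tm x 1) := by
        rw [← Pi.single_smul, smul_eq_mul, Two.tm_mul_tm, one_mul, one_mul]
      rw [h1, hG, ← hg'', ← hD, Two.lift_tm]
      simp only [LinearMap.comp_apply, LinearMap.flip_apply, hL]
    | hadd x y hx hy => rw [map_add, map_add, hx, hy, Pi.single_add, map_add]

/-- The projection onto the coordinates whose degree satisfies a predicate. -/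
def coordProj (P : ℕ → Prop) [DecidablePred P] : Module.End k (ι → Two k A B) :=
  LinearMap.pi fun t => if P (X.deg t) then LinearMap.proj t else 0

theorem coordProj_apply (P : ℕ → Prop) [DecidablePred P] (v : ι → Two k A B) (t : ι) :
    X.coordProj P v t = if P (X.deg t) then v t else 0 := by
  simp only [coordProj, LinearMap.pi_apply]
  split_ifs <;> rfl

theorem coordProj_rightLin (P : ℕ → Prop) [DecidablePred P] :
    RightLin (X.coordProj (B := B) P) := by
  intro b v
  funext t
  simp only [coordProj_apply, Pi.smul_apply]
  split_ifs <;> simp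

/-- After base change to `A ⊗ Bᵒᵖ` the augmented complex resolves `B`; over `B` acting on the right
it consists of relatively free terms on `k`-projectives, so it is contractible by right `B`-linear
maps. The contraction is not left `A`-linear. The last term of the identity is the section of the
augmentation determined by `p₀`. -/
theorem exists_contraction [DecidableEq ι] [Module.Projective k A]
    (hi : LeftProj i) :
    ∃ s : Module.End k (ι → Two k A B), RightLin s ∧ (∀ v, X.aug i (s v) = 0) ∧
      (∀ v, rmul i X.E (s v) = s v) ∧
      ∀ v, rmul i X.D (s v) + s (rmul i X.D v) =
        rmul i X.E v - (Two.tm 1 (X.aug i v) : Two k A B) • fun t => toHalf i (X.p₀ t) := by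
  let P₀ : ι → Two k A B := fun t => toHalf i (X.p₀ t)
  have hP₀D : rmul i X.D P₀ = 0 := by
    rw [rmul_toHalf, X.p₀_D]; funext t; simp
  have hP₀E : rmul i X.E P₀ = P₀ := by
    rw [rmul_toHalf, X.p₀_E]
  have hP₀p : X.aug i P₀ = 1 := by
    rw [aug_toHalf, X.p₀_p, map_one]
  -- Induction on `n`: the homotopy identity is required only on vectors supported in degrees below
  -- `n`.
  suffices H : ∀ n, ∃ s : Module.End k (ι → Two k A B), RightLin s ∧ (∀ v, X.aug i (s v) = 0) ∧
      (∀ v, rmul i X.E (s v) = s v) ∧ ∀ v : ι → Two k A B, (∀ t, n ≤ X.deg t → v t = 0) →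
      rmul i X.D (s v) + s (rmul i X.D v) = rmul i X.E v -
        (Two.tm 1 (X.aug i v) : Two k A B) • P₀ by
    obtain ⟨s, h1, h2, h3, h4⟩ := H (∑ t, X.deg t + 1)
    refine ⟨s, h1, h2, h3, fun v => h4 v fun t ht => ?_⟩
    have := Finset.single_le_sum (f := X.deg) (fun _ _ => Nat.zero_le _) (Finset.mem_univ t)
    omega
  intro n
  induction n with
  | zero =>
    refine ⟨0, fun b v => by simp, fun v => by simp, fun v => by simp, fun v hv => ?_⟩
    have : v = 0 := funext fun t => hv t (Nat.zero_le _)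
    subst this
    simp
  | succ n ih =>
    obtain ⟨s, h1, h2, h3, h4⟩ := ih
    let T : Module.End k (ι → Two k A B) := (LinearMap.flip (Algebra.lsmul k k (ι → Two k A B)).toLinearMap P₀) ∘ₗ
      Two.tm (1 : A) ∘ₗ X.aug i
    have hT (v) : T v = (Two.tm 1 (X.aug i v) : Two k A B) • P₀ := rfl
    -- The defect of the homotopy identity. It commutes with `D` and vanishes in degrees below `n`,
    -- so its values on vectors of degree `n` are cycles killed by the augmentation.
    let Y : Module.End k (ι → Two k A B) := rmul i X.E - T - rmul i X.D ∘ₗ s - s ∘ₗ rmul i X.D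
    have hY (v) : Y v = rmul i X.E v - (Two.tm 1 (X.aug i v) : Two k A B) • P₀ - rmul i X.D (s v) -
      s (rmul i X.D v) := rfl
    have hYlin : RightLin Y := by
      intro b v
      rw [hY, hY, rmul_smul, rmul_smul, h1, h1, rmul_smul, aug_smul_right, smul_sub, smul_sub,
        smul_sub, ← mul_smul, Two.tm_mul_tm, one_mul]
    have hYD (v) : rmul i X.D (Y v) = Y (rmul i X.D v) := by
      rw [hY, hY]
      simp only [map_sub, rmul_smul, hP₀D, D_D_apply, aug_D, E_D_apply, D_E_apply]
      simp
    have hYE (v) : rmul i X.E (Y v) = Y v := by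
      rw [hY]
      simp only [map_sub, rmul_smul, hP₀E, D_E_apply, E_E_apply, h3]
    have hYp (v) : X.aug i (Y v) = 0 := by
      rw [hY]
      simp only [map_sub, aug_smul_right, hP₀p, aug_D, aug_E, h2]
      simp
    let π := X.coordProj (k := k) (B := B) (· = n)
    have hπ := X.coordProj_rightLin (k := k) (B := B) (· = n)
    have hpi (v t) : π v t = if X.deg t = n then v t else 0 := X.coordProj_apply _ v t
    have hdeg (v : ι → Two k A B) (hv : ∀ t, n + 1 ≤ X.deg t → v t = 0) (t : ι) (ht : n ≤ X.deg t) :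
        rmul i X.D v t = 0 := by
      rw [rmul_apply_apply]
      refine Finset.sum_eq_zero fun j _ => ?_
      by_cases hj : n + 1 ≤ X.deg j
      · rw [hv j hj, zero_mul]
      · rw [X.D_deg j t (by omega), map_zero, mul_zero]
    have hYπ (v) : rmul i X.D (Y (π v)) = 0 := by
      rw [hYD, hY, ← h4]
      · abel
      · refine hdeg _ fun t ht => ?_
        rw [hpi, if_neg (by omega)]
    obtain ⟨G, hG1, hG2⟩ := exists_lift (rmul i X.D) (Y ∘ₗ π)
      (fun b v => rmul_smul i _ _ v)
      (fun b v => by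
        rw [LinearMap.comp_apply, LinearMap.comp_apply, hπ, hYlin])
      (fun v => X.exact_half i hi _ (hYE _) (hYπ v) (hYp _))
    -- Discarding the degree zero part of the lift does not change its image under `D`, and makes
    -- its augmentation vanish.
    let π' := X.coordProj (k := k) (B := B) (0 < ·)
    have hπ' := X.coordProj_rightLin (k := k) (B := B) (0 < ·)
    have hpi' (v t) : π' v t = if 0 < X.deg t then v t else 0 := X.coordProj_apply _ v t
    have hDπ' (v) : rmul i X.D (π' v) = rmul i X.D v := by
      funext t
      rw [rmul_apply_apply, rmul_apply_apply]
      refine Finset.sum_congr rfl fun j _ => ?_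
      rw [hpi']
      split_ifs with hj
      · rfl
      · rw [X.D_deg j t (by omega), map_zero, mul_zero, mul_zero]
    refine ⟨s + rmul i X.E ∘ₗ π' ∘ₗ G ∘ₗ π, fun b v => ?_, fun v => ?_, fun v => ?_,
      fun v hv => ?_⟩
    · simp only [LinearMap.add_apply, LinearMap.comp_apply, smul_add, h1 b v]
      rw [hπ, hG1, hπ', rmul_smul]
    · simp only [LinearMap.add_apply, LinearMap.comp_apply, map_add, h2, aug_E, zero_add]
      refine X.aug_eq_zero_of_deg i _ fun t ht => ?_
      rw [hpi', if_neg (by omega)]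
    · simp only [LinearMap.add_apply, LinearMap.comp_apply, map_add, h3, E_E_apply]
    · have h5 : π (rmul i X.D v) = 0 := by
        funext t
        rw [hpi]
        split_ifs with ht
        · exact hdeg v hv t (by omega)
        · rfl
      have h6 : π (π v) = π v := by
        funext t
        simp only [hpi]
        split_ifs <;> rfl
      have h7 : Y (v - π v) = 0 := by
        rw [hY, ← h4 (v - π v)]
        · abel
        · intro t ht
          rw [Pi.sub_apply, hpi]
          split_ifs with h
          · rw [sub_self]
          · rw [hv t (by omega), sub_zero]
      simp only [LinearMap.add_apply, LinearMap.comp_apply, map_add, h5, map_zero, add_zero,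
        E_D_apply, hDπ']
      rw [hG2, LinearMap.comp_apply, h6]
      have h8 : Y (π v) = Y v := by
        rw [map_sub, sub_eq_zero] at h7
        exact h7.symm
      rw [h8, hY]
      abel

end ResData

namespace ResData

variable {k : Type u} [CommRing k] {A B : Type v} [Ring A] [Algebra k A] [Ring B] [Algebra k B]
  {ι : Type} [Fintype ι] (X : ResData k A ι) (i : A →ₐ[k] B)

/-! ### Comparing the resolution with its dual -/

/-- Left multiplication by the adjoint of a matrix over `A ⊗ Aᵒᵖ` on matrices over `A ⊗ Bᵒᵖ`. -/
def lact (M : Matrix ι ι (Two k A A)) (F : ι → ι → Two k A B) (s : ι) : ι → Two k A B :=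
  ∑ t, toHalf i (star (M t s)) • F t

theorem lact_apply (M : Matrix ι ι (Two k A A)) (F : ι → ι → Two k A B) (s t : ι) :
    lact i M F s t = ∑ u, toHalf i (star (M u s)) * F u t := by
  simp [lact, Finset.sum_apply]

theorem lact_lact (M N : Matrix ι ι (Two k A A)) (F : ι → ι → Two k A B) :
    lact i M (lact i N F) = lact i (N * M) F := by
  funext s
  simp only [lact, Finset.smul_sum, ← mul_smul, ← map_mul, ← star_mul, Matrix.mul_apply, star_sum,
    map_sum, Finset.sum_smul]
  exact Finset.sum_comm

theorem lact_zero (F : ι → ι → Two k A B) : lact i 0 F = 0 := by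
  funext s
  simp [lact]

theorem lact_add (M : Matrix ι ι (Two k A A)) (F G : ι → ι → Two k A B) (s : ι) :
    lact i M (fun t => F t + G t) s = lact i M F s + lact i M G s := by
  simp [lact, Finset.sum_add_distrib]

theorem lact_sub (M : Matrix ι ι (Two k A A)) (F G : ι → ι → Two k A B) (s : ι) :
    lact i M (fun t => F t - G t) s = lact i M F s - lact i M G s := by
  simp [lact, smul_sub, Finset.sum_sub_distrib]

theorem rmul_lact (M N : Matrix ι ι (Two k A A)) (F : ι → ι → Two k A B) (s : ι) :
    rmul i N (lact i M F s) = lact i M (fun t => rmul i N (F t)) s := by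
  simp [lact, rmul_smul]

theorem aug_lact (M : Matrix ι ι (Two k A A)) (F : ι → ι → Two k A B) (s : ι) :
    X.aug i (lact i M F s) =
      rowDot (fun t => envMap i (star (M t s))) (fun t => X.aug i (F t)) := by
  simp [lact, aug_smul, ofHalf_toHalf, rowDot]

theorem lact_congr (M : Matrix ι ι (Two k A A)) (F G : ι → ι → Two k A B) (s : ι)
    (h : ∀ t, M t s ≠ 0 → F t = G t) : lact i M F s = lact i M G s := by
  refine Finset.sum_congr rfl fun t _ => ?_
  by_cases ht : M t s = 0
  · simp [ht]
  · rw [h t ht]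

variable {d : ℕ} {q : ι → B}

/-- The comparison theorem, run downwards from degree `d`: a naive lift of `q` has some defect `Y`,
and subtracting the contraction of `Y` cures one more degree. -/
theorem exists_comparison_aux [DecidableEq ι] [Module.Projective k A] (hi : LeftProj i)
    (hd : ∀ s, X.deg s ≤ d)
    (hDq : ∀ s, rowDot (fun t => envMap i (star (X.D t s))) q = 0) :
    ∃ F : ι → ι → Two k A B, (∀ s, rmul i X.E (F s) = F s) ∧
      (∀ s, rmul i X.D (F s) + lact i X.D F s = 0) ∧ ∀ s, X.aug i (F s) = q s := by
  obtain ⟨σ, h1, h2, h3, h4⟩ := X.exists_contraction i hi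
  suffices H : ∀ n, ∃ F : ι → ι → Two k A B, (∀ s, rmul i X.E (F s) = F s) ∧
      (∀ s, d < X.deg s + n → rmul i X.D (F s) + lact i X.D F s = 0) ∧
      ∀ s, X.aug i (F s) = q s by
    obtain ⟨F, hF1, hF2, hF3⟩ := H (d + 1)
    exact ⟨F, hF1, fun s => hF2 s (by omega), hF3⟩
  intro n
  induction n with
  | zero =>
    -- The naive lift multiplies the cycle `p₀`, of augmentation `1`, by `q s`. No index has degree
    -- above `d`, so nothing else is required at the start.
    refine ⟨fun s => (Two.tm 1 (q s) : Two k A B) • fun t => toHalf i (X.p₀ t), fun s => ?_,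
      fun s hs => ?_, fun s => ?_⟩
    · rw [rmul_smul, rmul_toHalf, X.p₀_E]
    · have := hd s
      omega
    · rw [aug_smul_right, aug_toHalf, X.p₀_p, map_one, one_mul]
  | succ n ih =>
    obtain ⟨F, hF1, hF2, hF3⟩ := ih
    let Y : ι → ι → Two k A B := fun s => rmul i X.D (F s) + lact i X.D F s
    have hY (s) : Y s = rmul i X.D (F s) + lact i X.D F s := rfl
    have hYE (s) : rmul i X.E (Y s) = Y s := by
      simp only [hY, map_add, D_E_apply, rmul_lact, hF1]
    have hYp (s) : X.aug i (Y s) = 0 := by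
      rw [hY, map_add, aug_D, aug_lact, zero_add]
      simp only [hF3, hDq]
    have hYD (s) : rmul i X.D (Y s) = lact i X.D Y s := by
      rw [hY, map_add, D_D_apply, rmul_lact, zero_add]
      have : lact i X.D Y s = lact i X.D (fun t => rmul i X.D (F t)) s +
          lact i X.D (lact i X.D F) s := lact_add i _ _ _ s
      rw [this, lact_lact, X.D_D, lact_zero]
      simp
    refine ⟨fun s => F s - σ (Y s), fun s => ?_, fun s hs => ?_, fun s => ?_⟩
    · rw [map_sub, hF1, h3]
    · have h5 : rmul i X.D (σ (Y s)) = Y s - σ (lact i X.D Y s) := by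
        have := h4 (Y s)
        rw [hYE, hYp, hYD] at this
        rw [eq_sub_iff_add_eq, this]
        simp
      -- The dual differential at `s` only involves indices of degree one higher, where the defect
      -- is already zero; hence the correction does not disturb that term.
      have h6 : ∀ t, X.D t s ≠ 0 → Y t = 0 := fun t ht => by
        have : X.deg t = X.deg s + 1 := by
          by_contra h
          exact ht (X.D_deg t s h)
        exact hF2 t (by omega)
      have h7 : lact i X.D Y s = 0 := by
        rw [lact_congr i X.D Y 0 s h6]
        simp [lact]
      have h8 : lact i X.D (fun t => σ (Y t)) s = 0 := by
        rw [lact_congr i X.D (fun t => σ (Y t)) 0 s fun t ht => by simp [h6 t ht]]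
        simp [lact]
      rw [map_sub, lact_sub, h8, h5, h7, hY]
      simp
    · rw [map_sub, hF3, h2, sub_zero]

/-- The lift `F` of `q` to a homogeneous map from the dual complex to the resolution. -/
theorem exists_comparison [DecidableEq ι] [Module.Projective k A] (hi : LeftProj i)
    (hd : ∀ s, X.deg s ≤ d) (hq : ∀ s, X.deg s ≠ d → q s = 0)
    (hDq : ∀ s, rowDot (fun t => envMap i (star (X.D t s))) q = 0)
    (hEq : ∀ s, rowDot (fun t => envMap i (star (X.E t s))) q = q s) :
    ∃ F : ι → ι → Two k A B, (∀ s, rmul i X.E (F s) = F s) ∧ (∀ s, lact i X.E F s = F s) ∧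
      (∀ s t, X.deg s + X.deg t ≠ d → F s t = 0) ∧
      (∀ s, rmul i X.D (F s) + lact i X.D F s = 0) ∧ ∀ s, X.aug i (F s) = q s := by
  obtain ⟨F₀, hF1, hF2, hF3⟩ := X.exists_comparison_aux i hi hd hDq
  obtain ⟨F, hF1, hF2, hF3, hF4⟩ : ∃ F : ι → ι → Two k A B, (∀ s, rmul i X.E (F s) = F s) ∧
      (∀ s, lact i X.E F s = F s) ∧
      (∀ s, rmul i X.D (F s) + lact i X.D F s = 0) ∧ ∀ s, X.aug i (F s) = q s := by
    -- Composing with the dual idempotent makes the map live on the projective terms of the dual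
    -- complex, and `hEq` shows that it still covers `q`.
    refine ⟨lact i X.E F₀, fun s => ?_, fun s => ?_, fun s => ?_, fun s => ?_⟩
    · rw [rmul_lact]
      simp only [hF1]
    · rw [lact_lact, X.E_E]
    · have : lact i X.D (lact i X.E F₀) s = lact i X.E (lact i X.D F₀) s := by
        rw [lact_lact, lact_lact, X.E_D, X.D_E]
      rw [rmul_lact, this, ← lact_add]
      simp only [hF2]
      simp [lact]
    · rw [aug_lact]
      simp only [hF3, hEq]
  -- `E` preserves degrees and `D` lowers them by one, so every identity is homogeneous and survives
  -- restriction to the components of total degree `d`.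
  refine ⟨fun s t => if X.deg s + X.deg t = d then F s t else 0, fun s => ?_, fun s => ?_,
    fun s t h => if_neg h, fun s => ?_, fun s => ?_⟩
  · funext t
    rw [rmul_apply_apply]
    have h1 : ∀ j, (if X.deg s + X.deg j = d then F s j else 0) * toHalf i (X.E j t) =
        if X.deg s + X.deg t = d then F s j * toHalf i (X.E j t) else 0 := fun j => by
      by_cases hj : X.deg j = X.deg t
      · rw [hj]; split_ifs <;> simp
      · rw [X.E_deg j t hj]; simp
    simp only [h1]
    split_ifs
    · rw [← rmul_apply_apply, hF1]
    · simp
  · funext t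
    rw [lact_apply]
    have h1 : ∀ j, toHalf i (star (X.E j s)) * (if X.deg j + X.deg t = d then F j t else 0) =
        if X.deg s + X.deg t = d then toHalf i (star (X.E j s)) * F j t else 0 := fun j => by
      by_cases hj : X.deg j = X.deg s
      · rw [hj]; split_ifs <;> simp
      · rw [X.E_deg j s hj]; simp
    simp only [h1]
    split_ifs
    · rw [← lact_apply, hF2]
    · simp
  · funext t
    rw [Pi.add_apply, rmul_apply_apply, lact_apply]
    have h1 : ∀ j, (if X.deg s + X.deg j = d then F s j else 0) * toHalf i (X.D j t) =
        if X.deg s + X.deg t + 1 = d then F s j * toHalf i (X.D j t) else 0 := fun j => by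
      by_cases hj : X.deg j = X.deg t + 1
      · rw [hj, add_assoc]; split_ifs <;> simp
      · rw [X.D_deg j t hj]; simp
    have h2 : ∀ j, toHalf i (star (X.D j s)) * (if X.deg j + X.deg t = d then F j t else 0) =
        if X.deg s + X.deg t + 1 = d then toHalf i (star (X.D j s)) * F j t else 0 := fun j => by
      by_cases hj : X.deg j = X.deg s + 1
      · rw [hj, add_right_comm]; split_ifs <;> simp
      · rw [X.D_deg j s hj]; simp
    simp only [h1, h2]
    split_ifs
    · rw [← rmul_apply_apply, ← lact_apply]
      exact congrFun (hF3 s) t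
    · simp
  · by_cases hs : X.deg s = d
    · rw [← hF4, ← sub_eq_zero, ← map_sub]
      refine X.aug_eq_zero_of_deg i _ fun t ht => ?_
      change (if X.deg s + X.deg t = d then F s t else 0) - F s t = 0
      rw [if_pos (by omega), sub_self]
    · rw [hq s hs]
      refine X.aug_eq_zero_of_deg i _ fun t ht => ?_
      exact if_neg (by omega)

/-! ### Symmetry of the comparison map -/

variable (ι) in
/-- Left multiplication by elements of `A` on row vectors. -/
def leftOp : A →ₐ[k] Module.End k (ι → Two k A B) where
  toFun a := Algebra.lsmul k k (ι → Two k A B) (Two.tm a 1 : Two k A B)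
  map_one' := by rw [← Two.one_def, map_one]
  map_mul' a b := by rw [← map_mul, Two.tm_mul_tm, one_mul]
  map_zero' := by rw [map_zero, LinearMap.zero_apply, map_zero]
  map_add' a b := by rw [map_add, LinearMap.add_apply, map_add]
  commutes' c := by
    rw [Algebra.algebraMap_eq_smul_one, map_smul, LinearMap.smul_apply, ← Two.one_def, map_smul,
      map_one, Algebra.algebraMap_eq_smul_one]

theorem leftOp_apply (a : A) (v : ι → Two k A B) :
    leftOp ι a v = (Two.tm a 1 : Two k A B) • v := rfl

variable (ι B) in
/-- The action of `A ⊗ Aᵒᵖ` on endomorphisms of row vectors by composition on both sides with left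
multiplications. -/
def opAct : Two k A A →ₐ[k] Module.End k (Module.End k (ι → Two k A B)) :=
  (AlgHom.mulLeftRight k (Module.End k (ι → Two k A B))).comp
    (Two.map (leftOp ι) (leftOp ι) : Two k A A →ₐ[k] Two k (Module.End k (ι → Two k A B))
      (Module.End k (ι → Two k A B)))

theorem opAct_tm (a b : A) (φ : Module.End k (ι → Two k A B)) :
    opAct B ι (Two.tm a b) φ = leftOp ι a * φ * leftOp ι b :=
  AlgHom.mulLeftRight_apply k _ (leftOp ι a) (op (leftOp ι b)) φ

theorem opAct_mul_left {T : Module.End k (ι → Two k A B)}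
    (hT : ∀ a, Commute (leftOp ι a) T) (x : Two k A A) (φ) :
    opAct B ι x (T * φ) = T * opAct B ι x φ := by
  induction x using Two.induction with
  | h0 => simp
  | htm a b => rw [opAct_tm, opAct_tm, ← mul_assoc, (hT a).eq]; simp only [mul_assoc]
  | hadd x y hx hy => simp only [map_add, LinearMap.add_apply, hx, hy, mul_add]

theorem opAct_mul_right {T : Module.End k (ι → Two k A B)}
    (hT : ∀ a, Commute (leftOp ι a) T) (x : Two k A A) (φ) :
    opAct B ι x (φ * T) = opAct B ι x φ * T := by
  induction x using Two.induction with
  | h0 => simp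
  | htm a b => rw [opAct_tm, opAct_tm, mul_assoc, mul_assoc, ← (hT b).eq]; simp only [mul_assoc]
  | hadd x y hx hy => simp only [map_add, LinearMap.add_apply, hx, hy, add_mul]

theorem commute_leftOp_rmul (M : Matrix ι ι (Two k A A)) (a : A) :
    Commute (leftOp ι a) (rmul i M) :=
  LinearMap.ext fun v => (rmul_smul i M _ v).symm

theorem rightLin_opAct (x : Two k A A) {φ : Module.End k (ι → Two k A B)} (hφ : RightLin φ) :
    RightLin (opAct B ι x φ) := by
  induction x using Two.induction with
  | h0 => intro b v; simp
  | htm a c =>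
    intro b v
    rw [opAct_tm]
    simp only [Module.End.mul_apply, leftOp_apply]
    rw [← mul_smul, Two.tm_mul_tm, mul_one, mul_one]
    have : (Two.tm c b : Two k A B) = Two.tm 1 b * Two.tm c 1 := by simp [Two.tm_mul_tm]
    rw [this, mul_smul, hφ, ← mul_smul, ← mul_smul, Two.tm_mul_tm, Two.tm_mul_tm]
    simp
  | hadd x y hx hy =>
    intro b v
    simp only [map_add, LinearMap.add_apply, hx b v, hy b v, smul_add]

/-- The operator `v ↦ (1 ⊗ v p) r` attached to a row vector `r`. -/
def rankOne (r : ι → Two k A A) : Module.End k (ι → Two k A B) :=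
  (LinearMap.flip (Algebra.lsmul k k (ι → Two k A B)).toLinearMap fun t => toHalf i (r t)) ∘ₗ
    Two.tm (1 : A) ∘ₗ X.aug i

theorem rankOne_apply (r : ι → Two k A A) (v : ι → Two k A B) :
    X.rankOne i r v = (Two.tm 1 (X.aug i v) : Two k A B) • fun t => toHalf i (r t) := rfl

theorem rankOne_add (r r' : ι → Two k A A) :
    X.rankOne i (r + r') = X.rankOne i r + X.rankOne i r' := by
  ext1 v
  rw [LinearMap.add_apply, rankOne_apply, rankOne_apply, rankOne_apply, ← smul_add]
  congr 1
  funext t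
  simp

theorem rankOne_zero : X.rankOne i 0 = 0 := by
  ext1 v
  rw [rankOne_apply]
  simp only [Pi.zero_apply, map_zero]
  exact smul_zero _

theorem rankOne_sum {κ : Type*} (S : Finset κ) (r : κ → ι → Two k A A) :
    X.rankOne i (∑ j ∈ S, r j) = ∑ j ∈ S, X.rankOne i (r j) := by
  classical
  induction S using Finset.induction_on with
  | empty => simp [rankOne_zero]
  | insert a S ha ih => rw [Finset.sum_insert ha, Finset.sum_insert ha, rankOne_add, ih]

theorem opAct_rankOne (x : Two k A A) (r : ι → Two k A A) :
    opAct B ι x (X.rankOne i r) = X.rankOne i (x • r) := by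
  induction x using Two.induction with
  | h0 => simp [rankOne_zero]
  | htm a b =>
    ext1 v
    rw [opAct_tm]
    simp only [Module.End.mul_apply, leftOp_apply, rankOne_apply, aug_smul_left]
    rw [← mul_smul, Two.tm_mul_tm]
    funext t
    simp only [Pi.smul_apply, smul_eq_mul, map_mul, Two.map_tm, ← mul_assoc, Two.tm_mul_tm,
      AlgHom.id_apply, mul_one, one_mul]
  | hadd x y hx hy => simp only [map_add, LinearMap.add_apply, hx, hy, add_smul, rankOne_add]

theorem rmul_mul_rankOne (M : Matrix ι ι (Two k A A)) (r : ι → Two k A A) :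
    rmul i M * X.rankOne i r = X.rankOne i (r ᵥ* M) := by
  ext1 v
  rw [Module.End.mul_apply, rankOne_apply, rmul_smul, rmul_toHalf, rankOne_apply]

theorem opAct_leftOp (x : Two k A A) (a : A) :
    opAct B ι x (leftOp ι a) = leftOp ι (x • a) := by
  induction x using Two.induction with
  | h0 => simp
  | htm b c => rw [opAct_tm, Two.tm_smul_self, map_mul, map_mul]
  | hadd x y hx hy => simp only [map_add, LinearMap.add_apply, hx, hy, add_smul]

/-- The difference of the two actions of the basis vector `j` through the augmentation. -/
def augDiff (j : ι) : Module.End k (ι → Two k A B) :=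
  leftOp ι (X.p j) * rmul i X.E - X.rankOne i (X.E j)

/-- Compatibility with the differential of the first tensor factor: the term through `p` dies
because `D` followed by the augmentation is zero, and the rank one terms add up by `D E = D`. -/
theorem sum_opAct_augDiff (j : ι) :
    ∑ l, opAct B ι (X.D j l) (X.augDiff i l) = -X.rankOne i (X.D j) := by
  have h1 : ∑ l, opAct B ι (X.D j l) (leftOp ι (X.p l) * rmul i X.E) = 0 := by
    simp only [opAct_mul_right (commute_leftOp_rmul i X.E), opAct_leftOp]
    rw [← Finset.sum_mul, ← map_sum]
    have := X.D_p j
    rw [rowDot] at this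
    rw [this, map_zero, zero_mul]
  have h2 : ∑ l, X.D j l • X.E l = X.D j := by
    conv_rhs => rw [← X.D_E]
    funext t
    simp [Matrix.mul_apply, Finset.sum_apply]
  simp only [augDiff, map_sub, Finset.sum_sub_distrib, opAct_rankOne]
  rw [h1, ← rankOne_sum, h2, zero_sub]

/-- Augmenting the first or the second factor gives two maps `P ⊗_A P → P` which agree after
augmentation, hence are homotopic. Here `h j` is the homotopy on `e_j ⊗ -`; bimodule coefficients `x
e_j y` act by left multiplication on both sides of the operator, which is `opAct`, and the power of
`-1` is the Koszul sign for passing `e_j`. The operators are only right `B`-linear. -/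
theorem exists_homotopy [DecidableEq ι] [Module.Projective k A] (hi : LeftProj i) :
    ∃ h : ι → Module.End k (ι → Two k A B), (∀ j, RightLin (h j)) ∧
      ∀ j, rmul i X.D * h j + ∑ l, opAct B ι (X.D j l) (h l) +
        (-1 : ℤ) ^ X.deg j • (h j * rmul i X.D) = X.augDiff i j := by
  obtain ⟨σ, h1, h2, h3, h4⟩ := X.exists_contraction i hi
  have hg (j) : RightLin (X.augDiff i j) := by
    intro b v
    simp only [augDiff, LinearMap.sub_apply, Module.End.mul_apply, rmul_smul, leftOp_apply,
      rankOne_apply, aug_smul_right, smul_sub, ← mul_smul, Two.tm_mul_tm, one_mul, mul_one]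
  obtain ⟨h, hh⟩ : ∃ h : ι → Module.End k (ι → Two k A B),
      ∀ j, h j = σ * (X.augDiff i j - ∑ l, opAct B ι (X.D j l) (h l)) := by
    -- The recursion descends along nonzero entries `D j l`, for which `l` has degree one less; it
    -- is therefore run on the degree and evaluated at the degree of `j`.
    let hN : ℕ → ι → Module.End k (ι → Two k A B) := fun n => Nat.rec
      (fun j => σ * X.augDiff i j)
      (fun _ h j => σ * (X.augDiff i j - ∑ l, opAct B ι (X.D j l) (h l))) n
    refine ⟨fun j => hN (X.deg j) j, fun j => ?_⟩
    change hN (X.deg j) j = σ * (X.augDiff i j - ∑ l, opAct B ι (X.D j l) (hN (X.deg l) l))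
    rcases hj : X.deg j with _ | n
    · have : ∀ l, X.D j l = 0 := fun l => X.D_deg j l (by omega)
      simp only [this, map_zero, LinearMap.zero_apply, Finset.sum_const_zero, sub_zero]
      rfl
    · change σ * (X.augDiff i j - ∑ l, opAct B ι (X.D j l) (hN n l)) = _
      congr 2
      refine Finset.sum_congr rfl fun l _ => ?_
      by_cases hl : X.deg j = X.deg l + 1
      · rw [show X.deg l = n by omega]
      · rw [X.D_deg j l hl, map_zero, LinearMap.zero_apply, LinearMap.zero_apply]
  have hRL : ∀ n j, X.deg j < n → RightLin (h j) := by
    intro n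
    induction n with
    | zero => intro j hj; omega
    | succ n ih =>
      intro j hj b v
      have : ∀ l, opAct B ι (X.D j l) (h l) ((Two.tm 1 b : Two k A B) • v) =
          (Two.tm 1 b : Two k A B) • opAct B ι (X.D j l) (h l) v := fun l => by
        by_cases hl : X.deg j = X.deg l + 1
        · exact rightLin_opAct _ (ih l (by omega)) b v
        · rw [X.D_deg j l hl]
          simp
      rw [hh j, Module.End.mul_apply, Module.End.mul_apply, ← h1]
      simp only [LinearMap.sub_apply, LinearMap.sum_apply, hg j b v, this, smul_sub,
        Finset.smul_sum]
  have hRL' (j) : RightLin (h j) := hRL _ j (Nat.lt_succ_self _)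
  refine ⟨h, hRL', ?_⟩
  let G (j : ι) : Module.End k (ι → Two k A B) := X.augDiff i j - ∑ l, opAct B ι (X.D j l) (h l)
  have hG (j) : G j = X.augDiff i j - ∑ l, opAct B ι (X.D j l) (h l) := rfl
  have hhG (j) : h j = σ * G j := hh j
  have hEh (j) : rmul i X.E * h j = h j := by
    rw [hhG, ← mul_assoc]
    congr 1
    exact LinearMap.ext h3
  have haugh (j v) : X.aug i (h j v) = 0 := by
    rw [hhG]
    exact h2 _
  have haug (x : Two k A A) (l v) : X.aug i (opAct B ι x (h l) v) = 0 := by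
    induction x using Two.induction with
    | h0 => simp
    | htm a b =>
      rw [opAct_tm, Module.End.mul_apply, Module.End.mul_apply, leftOp_apply, aug_smul_left,
        haugh, mul_zero]
    | hadd x y hx hy => simp only [map_add, LinearMap.add_apply, hx, hy, add_zero]
  have hGaug (j v) : X.aug i (G j v) = 0 := by
    rw [hG, LinearMap.sub_apply, map_sub, LinearMap.sum_apply, map_sum]
    simp only [haug, Finset.sum_const_zero, augDiff, LinearMap.sub_apply,
      Module.End.mul_apply, map_sub, leftOp_apply, aug_smul_left, rankOne_apply, aug_smul_right,
      aug_E, aug_toHalf, X.E_p, sub_self]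
  have hGE (j) : rmul i X.E * G j = G j := by
    have e1 : rmul i X.E * rmul i X.E = rmul (B := B) i X.E :=
      LinearMap.ext fun v => X.E_E_apply i v
    have e2 : X.E j ᵥ* X.E = X.E j := congrFun X.E_E j
    rw [hG, mul_sub, Finset.mul_sum]
    simp only [← opAct_mul_left (commute_leftOp_rmul i X.E), hEh]
    congr 1
    rw [augDiff, mul_sub, rmul_mul_rankOne, e2, ← mul_assoc,
      ← (commute_leftOp_rmul i X.E (X.p j)).eq, mul_assoc, e1]
  have hDE : rmul i X.E * rmul i X.D = rmul (B := B) i X.D :=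
    LinearMap.ext fun v => X.D_E_apply i v
  have hED : rmul i X.D * rmul i X.E = rmul (B := B) i X.D :=
    LinearMap.ext fun v => X.E_D_apply i v
  have hrD (r) : X.rankOne (B := B) i r * rmul i X.D = 0 := LinearMap.ext fun v => by
    rw [Module.End.mul_apply, rankOne_apply, aug_D]
    simp
  -- The residual operator `G j` has zero augmentation, so the contraction formula turns signed
  -- commutation of `G j` with `D` into the homotopy identity.
  have hred (j) (hj : rmul i X.D * G j = (-1 : ℤ) ^ X.deg j • (G j * rmul i X.D)) :
      rmul i X.D * h j + ∑ l, opAct B ι (X.D j l) (h l) +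
        (-1 : ℤ) ^ X.deg j • (h j * rmul i X.D) = X.augDiff i j := by
    have h5 : rmul i X.D * h j + (-1 : ℤ) ^ X.deg j • (h j * rmul i X.D) = G j := by
      refine LinearMap.ext fun v => ?_
      have h6 := h4 (G j v)
      rw [hGaug, map_zero, zero_smul, sub_zero] at h6
      have h7 : rmul i X.D (G j v) = ((-1 : ℤ) ^ X.deg j • (G j * rmul i X.D)) v :=
        LinearMap.congr_fun hj v
      have h8 : rmul i X.E (G j v) = G j v := LinearMap.congr_fun (hGE j) v
      rw [h8, h7, LinearMap.smul_apply, map_zsmul] at h6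
      rw [LinearMap.add_apply, LinearMap.smul_apply, hhG j]
      exact h6
    rw [add_right_comm, h5, hG, sub_add_cancel]
  -- The identities for the indices one degree lower are combined with the entries of row `j` of
  -- `D`; the double sum vanishes because `D * D = 0`.
  have hsum (j) (H : ∀ l, X.deg j = X.deg l + 1 → rmul i X.D * h l +
      ∑ m, opAct B ι (X.D l m) (h m) + (-1 : ℤ) ^ X.deg l • (h l * rmul i X.D) = X.augDiff i l) :
      ∑ l, opAct B ι (X.D j l) (rmul i X.D * h l) = -X.rankOne i (X.D j) -
        ∑ l, opAct B ι (X.D j l) ((-1 : ℤ) ^ X.deg l • (h l * rmul i X.D)) := by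
    have h5 : ∑ l, opAct B ι (X.D j l) (∑ m, opAct B ι (X.D l m) (h m)) = 0 := by
      simp only [map_sum, ← Module.End.mul_apply, ← map_mul]
      rw [Finset.sum_comm]
      refine Finset.sum_eq_zero fun m _ => ?_
      rw [← LinearMap.sum_apply, ← map_sum, ← Matrix.mul_apply, X.D_D]
      simp
    rw [← sum_opAct_augDiff, ← sub_zero (∑ l, opAct B ι (X.D j l) (X.augDiff i l)), ← h5,
      ← Finset.sum_sub_distrib, ← Finset.sum_sub_distrib]
    refine Finset.sum_congr rfl fun l _ => ?_
    by_cases hl : X.deg j = X.deg l + 1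
    · rw [← map_sub, ← map_sub, ← H l hl]
      congr 1
      abel
    · rw [X.D_deg j l hl]
      simp
  suffices H : ∀ n j, X.deg j < n → rmul i X.D * h j + ∑ l, opAct B ι (X.D j l) (h l) +
        (-1 : ℤ) ^ X.deg j • (h j * rmul i X.D) = X.augDiff i j from
    fun j => H _ j (Nat.lt_succ_self _)
  intro n
  induction n with
  | zero => intro j hj; omega
  | succ n ih =>
    intro j hj
    apply hred
    have e3 : X.E j ᵥ* X.D = X.D j := congrFun X.E_D j
    rw [hG, mul_sub, sub_mul, Finset.mul_sum, Finset.sum_mul]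
    simp only [← opAct_mul_left (commute_leftOp_rmul i X.D),
      ← opAct_mul_right (commute_leftOp_rmul i X.D)]
    rw [hsum j fun l hl => ih l (by omega), augDiff, mul_sub, sub_mul, hrD, rmul_mul_rankOne, e3,
      ← mul_assoc, ← (commute_leftOp_rmul i X.D (X.p j)).eq, mul_assoc, mul_assoc, hED, hDE,
      sub_zero]
    -- In degree zero, row `j` of `D` is zero and only left multiplication by `p j` remains. In
    -- positive degree `p j = 0`, the rank one terms cancel, and the sign changes by one factor of
    -- `-1`.
    rcases hj0 : X.deg j with _ | m
    · have : ∀ l, X.D j l = 0 := fun l => X.D_deg j l (by omega)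
      have h0 : X.D j = 0 := funext this
      simp [this, h0, rankOne_zero]
    · rw [X.p_deg j (by omega)]
      simp only [map_zero, zero_mul, zero_sub, smul_neg]
      rw [Finset.smul_sum, ← Finset.sum_neg_distrib]
      rw [show ∀ a b : Module.End k (ι → Two k A B), -a - (-a - b) = b from fun a b => by abel]
      refine Finset.sum_congr rfl fun l _ => ?_
      by_cases hl : X.deg j = X.deg l + 1
      · rw [show X.deg l = m by omega, map_zsmul, pow_succ]
        simp
      · rw [X.D_deg j l hl]
        simp

end ResData

/-! ### The adjoint of the comparison map -/

namespace ResData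

variable {k : Type u} [CommRing k] {A B : Type v} [Ring A] [Algebra k A] [Ring B] [Algebra k B]
  {ι : Type} [Fintype ι] (X : ResData k A ι) (i : A →ₐ[k] B)

/-- The map `x ⊗ b ↦ b i(x)`. -/
def foldBack : Two k A B →ₗ[k] B :=
  Two.lift ((LinearMap.mul k B).flip ∘ₗ i.toLinearMap)

@[simp]
theorem foldBack_tm (a : A) (b : B) : foldBack i (Two.tm a b) = b * i a := by
  simp [foldBack]

theorem foldBack_tm_mul (a : A) (c : Two k A B) :
    foldBack i (Two.tm a 1 * c) = star (ofHalf i c) • i a := by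
  induction c using Two.induction with
  | h0 => simp
  | htm x b => simp [Two.tm_mul_tm, mul_assoc]
  | hadd x y hx hy => simp only [mul_add, map_add, star_add, add_smul, hx, hy]

theorem foldBack_tm_one_mul (a : A) (c : Two k A B) :
    foldBack i (Two.tm 1 (i a) * c) = foldBack i (Two.tm a 1 * c) := by
  induction c using Two.induction with
  | h0 => simp
  | htm x b => simp [Two.tm_mul_tm, mul_assoc]
  | hadd x y hx hy => simp only [mul_add, map_add, hx, hy]

theorem foldBack_mul_toHalf (b : B) (x : Two k A A) :
    foldBack i (Two.tm 1 b * toHalf i x) = envMap i (star x) • b := by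
  induction x using Two.induction with
  | h0 => simp
  | htm x y => simp [Two.tm_mul_tm]
  | hadd x y hx hy => simp only [mul_add, map_add, star_add, add_smul, hx, hy]

/-- Folding is cyclic: a left factor from `A` reappears as a factor on the `B` side, which right
linearity of `h` then moves inside. This replaces the operator action of `x` on `h` by the action of
its adjoint on the argument. -/
theorem foldBack_opAct {h : Module.End k (ι → Two k A B)} (hh : RightLin h) (x : Two k A A)
    (y : ι → Two k A B) (t : ι) :
    foldBack i (opAct B ι x h y t) = foldBack i (h (toHalf i (star x) • y) t) := by
  induction x using Two.induction with
  | h0 => simp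
  | htm a b =>
    have : toHalf i (star (Two.tm a b)) = Two.tm 1 (i a) * Two.tm b 1 := by simp [Two.tm_mul_tm]
    rw [opAct_tm, this, mul_smul, hh]
    exact (foldBack_tm_one_mul i a _).symm
  | hadd x y hx hy =>
    simp only [map_add, star_add, LinearMap.add_apply, Pi.add_apply, hx, hy, add_smul]

variable {d : ℕ} {q : ι → B}

/-- A comparison map from the dual complex to the resolution is, up to sign, its own adjoint on
homology. -/
theorem exists_symmetric_comparison [DecidableEq ι] [Module.Projective k A] (hi : LeftProj i)
    (hd : ∀ s, X.deg s ≤ d) (hq : ∀ s, X.deg s ≠ d → q s = 0)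
    (hDq : ∀ s, rowDot (fun t => envMap i (star (X.D t s))) q = 0)
    (hEq : ∀ s, rowDot (fun t => envMap i (star (X.E t s))) q = q s) :
    ∃ (F : ι → ι → Two k A B) (c : ℤ), c * c = 1 ∧
      (∀ s, rmul i X.E (F s) = F s) ∧ (∀ s, lact i X.E F s = F s) ∧
      (∀ s t, X.deg s + X.deg t ≠ d → F s t = 0) ∧
      (∀ s, rmul i X.D (F s) + lact i X.D F s = 0) ∧ (∀ s, X.aug i (F s) = q s) ∧
      ∀ t, rowDot (fun s => star (ofHalf i (F s t))) (fun s => i (X.p s)) = c • q t := by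
  obtain ⟨F, hF1, hF2, hF3, hF4, hF5⟩ := X.exists_comparison i hi hd hq hDq hEq
  obtain ⟨h, hR, hh⟩ := X.exists_homotopy i hi
  -- So `w n` is `(-1)^(n(n-1)/2)`: the recursion is what makes the two sums below cancel against
  -- the Koszul signs of the homotopy.
  obtain ⟨w, hw0, hws⟩ : ∃ w : ℕ → ℤ, w 0 = 1 ∧ ∀ n, w (n + 1) = (-1) ^ n * w n :=
    ⟨fun n => Nat.rec 1 (fun n x => (-1) ^ n * x) n, rfl, fun n => rfl⟩
  have hww (n : ℕ) : w n * w n = 1 := by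
    induction n with
    | zero => simp [hw0]
    | succ n ih =>
      rw [hws, mul_mul_mul_comm, ih, ← mul_pow]
      simp
  refine ⟨F, w d, hww d, hF1, hF2, hF3, hF4, hF5, fun t => ?_⟩
  by_cases ht : X.deg t = d
  swap
  · rw [hq t ht, smul_zero]
    refine Finset.sum_eq_zero fun s _ => ?_
    change star (ofHalf i (F s t)) • i (X.p s) = 0
    by_cases hs : X.deg s = 0
    · rw [hF3 s t (by omega)]
      simp
    · rw [X.p_deg s hs]
      simp
  -- Since `t` has the top degree `d`, column `t` of `D` is zero.
  have e1 (j) (v : ι → Two k A B) : rmul i X.D (h j v) t = 0 := by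
    rw [rmul_apply_apply]
    refine Finset.sum_eq_zero fun m _ => ?_
    rw [X.D_deg m t (by have := hd m; omega)]
    simp
  let a (l : ι) : B := foldBack i (h l (rmul i X.D (F l)) t)
  -- Folding moves `D` from the homotopy onto `F` as the dual differential, which equals minus the
  -- differential of `F` because `F` is a chain map.
  have e2 : ∑ j, w (X.deg j) • ∑ l, foldBack i (opAct B ι (X.D j l) (h l) (F j) t) =
      -∑ l, w (X.deg l + 1) • a l := by
    simp only [Finset.smul_sum]
    rw [Finset.sum_comm, ← Finset.sum_neg_distrib]
    refine Finset.sum_congr rfl fun l _ => ?_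
    have : ∀ j, w (X.deg j) • foldBack i (opAct B ι (X.D j l) (h l) (F j) t) =
        w (X.deg l + 1) • foldBack i (h l (toHalf i (star (X.D j l)) • F j) t) := fun j => by
      by_cases hj : X.deg j = X.deg l + 1
      · rw [foldBack_opAct i (hR l), hj]
      · rw [X.D_deg j l hj]
        simp
    simp only [this]
    rw [← Finset.smul_sum, ← smul_neg, ← map_sum, ← Finset.sum_apply, ← map_sum]
    congr 1
    change foldBack i (h l (lact i X.D F l) t) = _
    rw [← neg_eq_of_add_eq_zero_right (hF4 l), map_neg, Pi.neg_apply, map_neg]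
  have e3 : ∑ j, w (X.deg j) • foldBack i (X.augDiff i j (F j) t) = 0 := by
    have : ∀ j, foldBack i (X.augDiff i j (F j) t) =
        ∑ l, foldBack i (opAct B ι (X.D j l) (h l) (F j) t) + (-1 : ℤ) ^ X.deg j • a j := by
      intro j
      rw [← hh j]
      simp only [LinearMap.add_apply, Pi.add_apply, map_add, Module.End.mul_apply, e1,
        zero_add, LinearMap.sum_apply, Finset.sum_apply, map_sum, LinearMap.smul_apply,
        Pi.smul_apply, map_zsmul, a]
    simp only [this, smul_add, Finset.sum_add_distrib, e2, ← mul_smul]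
    rw [neg_add_eq_zero]
    refine Finset.sum_congr rfl fun l _ => ?_
    rw [hws, mul_comm]
  -- `p` lives in degree `0` and `q` in degree `d`, so the first term only meets the weight `w 0 =
  -- 1` and the second only `w d`. The latter is the sign in the conclusion.
  have e4 : ∀ j, w (X.deg j) • foldBack i (X.augDiff i j (F j) t) =
      star (ofHalf i (F j t)) • i (X.p j) - w d • (envMap i (star (X.E j t)) • q j) := by
    intro j
    have : X.augDiff i j (F j) t =
        Two.tm (X.p j) 1 * F j t - Two.tm 1 (q j) * toHalf i (X.E j t) := by
      simp only [augDiff, LinearMap.sub_apply, Module.End.mul_apply, hF1, leftOp_apply,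
        rankOne_apply, hF5]
      rfl
    rw [this, map_sub, foldBack_tm_mul, foldBack_mul_toHalf, smul_sub]
    congr 1
    · by_cases hj : X.deg j = 0
      · rw [hj, hw0, one_smul]
      · rw [X.p_deg j hj]
        simp
    · by_cases hj : X.deg j = d
      · rw [hj]
      · rw [hq j hj]
        simp
  simp only [e4, Finset.sum_sub_distrib, ← Finset.smul_sum] at e3
  rw [sub_eq_zero] at e3
  rw [rowDot, e3]
  congr 1
  exact hEq t

end ResData

/-! ### Projectivity of invertible bimodules and of their tensor powers -/

section Invertible

variable {k : Type u} [CommRing k] {A : Type v} [Ring A] [Algebra k A]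

theorem RelTensor.exists_sum {M N : Bimod k A} (x : RelTensor M N) :
    ∃ (n : ℕ) (m : Fin n → M) (y : Fin n → N), x = ∑ l, RelTensor.mk (m l) (y l) := by
  induction x using RelTensor.induction with
  | h0 => exact ⟨0, Fin.elim0, Fin.elim0, by simp⟩
  | hmk m y => exact ⟨1, fun _ => m, fun _ => y, by simp⟩
  | hadd x y hx hy =>
    obtain ⟨n, m, y, rfl⟩ := hx
    obtain ⟨n', m', y', rfl⟩ := hy
    exact ⟨n + n', Fin.append m m', Fin.append y y', by simp [Fin.sum_univ_add]⟩

theorem projective_of_factor {R : Type*} [Ring R] {M : Type*} [AddCommGroup M] [Module R M]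
    {m : Type*} [Finite m] (f : M →ₗ[R] m → R) (g : (m → R) →ₗ[R] M)
    (h : Function.Bijective (g ∘ₗ f)) : Module.Projective R M := by
  let e := LinearEquiv.ofBijective (g ∘ₗ f) h
  refine Module.Projective.of_split f (e.symm.toLinearMap ∘ₗ g) (LinearMap.ext fun x => ?_)
  exact e.symm_apply_apply x

/-- The isomorphisms `U ⊗ V ≅ A` and `V ⊗ U ≅ A` are not assumed compatible, so the usual dual basis
formula need not give the identity. The left formula `g ∘ f` and the right formula `g' ∘ f'` are
nevertheless mutually inverse, and a bijection factoring through a finite free module gives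
projectivity. -/
theorem Bimod.IsInvertible.projective {U : Bimod k A} (hU : U.IsInvertible) :
    Module.Projective A U ∧ Module.Projective Aᵐᵒᵖ U := by
  obtain ⟨V, ⟨φ, hφ⟩, ⟨ψ, hψ⟩⟩ := hU
  obtain ⟨m, v, u, hvu⟩ := RelTensor.exists_sum (ψ.symm (1 : A))
  obtain ⟨n, u', v', huv⟩ := RelTensor.exists_sum (φ.symm (1 : A))
  have hvu1 : ∑ l, ψ (RelTensor.mk (v l) (u l)) = (1 : A) := by
    rw [← map_sum, ← hvu, ψ.apply_symm_apply]
  have huv1 : ∑ l, φ (RelTensor.mk (u' l) (v' l)) = (1 : A) := by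
    rw [← map_sum, ← huv, φ.apply_symm_apply]
  let Φ (x : U) (y : V) : A := φ (RelTensor.mk x y)
  let Ψ (y : V) (x : U) : A := ψ (RelTensor.mk y x)
  have Φl (a : A) (x y) : Φ (a • x) y = a * Φ x y := by
    change φ _ = a • φ _
    rw [← map_smul, RelTensor.smul_mk]
  have Φr (a : A) (x y) : Φ x (op a • y) = Φ x y * a := by
    change φ _ = op a • φ _
    rw [← hφ, RelTensor.op_smul_mk]
  have Ψl (a : A) (x y) : Ψ (a • x) y = a * Ψ x y := by
    change ψ _ = a • ψ _
    rw [← map_smul, RelTensor.smul_mk]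
  have Ψr (a : A) (x y) : Ψ x (op a • y) = Ψ x y * a := by
    change ψ _ = op a • ψ _
    rw [← hψ, RelTensor.op_smul_mk]
  have Φb (a : A) (x y) : Φ (op a • x) y = Φ x (a • y) := congrArg φ (RelTensor.mk_balanced x a y)
  have Ψb (a : A) (x y) : Ψ (op a • x) y = Ψ x (a • y) := congrArg ψ (RelTensor.mk_balanced x a y)
  have Φk (c : k) (x y) : Φ x (c • y) = c • Φ x y := by
    change φ (RelTensor.mk x (c • y)) = _
    rw [map_smul]
    exact φ.toLinearMap.map_smul_of_tower c _
  have Ψk (c : k) (x y) : Ψ (c • x) y = c • Ψ x y := by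
    change ψ (RelTensor.mk (c • x) y) = _
    rw [map_smul]
    exact ψ.toLinearMap.map_smul_of_tower c _
  let f : U →ₗ[A] Fin m → A :=
    { toFun := fun x l => Φ x (v l)
      map_add' := fun x y => by funext l; simp [Φ]
      map_smul' := fun a x => by funext l; simp [Φl] }
  let g : (Fin m → A) →ₗ[A] U := Fintype.linearCombination A u
  let f' : U →ₗ[Aᵐᵒᵖ] Fin n → Aᵐᵒᵖ :=
    { toFun := fun x l => op (Ψ (v' l) x)
      map_add' := fun x y => by funext l; simp [Ψ]
      map_smul' := fun a x => by
        funext l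
        apply unop_injective
        exact Ψr a.unop _ _ }
  let g' : (Fin n → Aᵐᵒᵖ) →ₗ[Aᵐᵒᵖ] U := Fintype.linearCombination Aᵐᵒᵖ u'
  have hgf (x) : (g ∘ₗ f) x = ∑ l, Φ x (v l) • u l := rfl
  have hgf' (x) : (g' ∘ₗ f') x = ∑ l, op (Ψ (v' l) x) • u' l := rfl
  let α (x : U) : RelTensor V U →ₗ[k] U := RelTensor.lift
    (LinearMap.mk₂ k (fun y z => Φ x y • z) (fun y y' z => by simp [Φ, add_smul])
      (fun c y z => by rw [Φk, smul_assoc]) (fun y z z' => smul_add _ _ _)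
      (fun c y z => smul_comm _ c z)) fun y a z => by
        simp only [LinearMap.mk₂_apply, Φr, mul_smul]
  have hα (x y z) : α x (RelTensor.mk y z) = Φ x y • z := RelTensor.lift_mk _ _ _ _
  let β (z : U) : RelTensor U V →ₗ[k] U := RelTensor.lift
    (LinearMap.mk₂ k (fun x y => op (Ψ y z) • x) (fun x x' y => smul_add _ _ _)
      (fun c x y => smul_comm _ c x) (fun x y y' => by simp [Ψ, add_smul])
      (fun c x y => by rw [Ψk, op_smul, smul_assoc])) fun x a y => by
        simp only [LinearMap.mk₂_apply, Ψl, op_mul, mul_smul]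
  have hβ (x y z) : β z (RelTensor.mk x y) = op (Ψ y z) • x := RelTensor.lift_mk _ _ _ _
  have h1 (x : U) (y : V) : ∑ l, RelTensor.mk (u' l) (op (Φ x y) • v' l) = RelTensor.mk x y := by
    apply φ.injective
    rw [map_sum]
    change ∑ l, Φ _ _ = Φ x y
    simp only [Φr]
    rw [← Finset.sum_mul]
    exact (congrArg (· * Φ x y) huv1).trans (one_mul _)
  have h2 (y : V) (x : U) : ∑ l, RelTensor.mk (Ψ y x • v l) (u l) = RelTensor.mk y x := by
    apply ψ.injective
    rw [map_sum]
    change ∑ l, Ψ _ _ = Ψ y x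
    simp only [Ψl]
    rw [← Finset.mul_sum]
    exact (congrArg (Ψ y x * ·) hvu1).trans (mul_one _)
  -- This and `h4` exchange the two possible contractions of `x ⊗ y ⊗ z`; each rests on one of the
  -- two isomorphisms only.
  have h3 (x y z) : (g' ∘ₗ f') (Φ x y • z) = op (Ψ y z) • x := by
    rw [hgf', ← hβ, ← h1, map_sum]
    refine Finset.sum_congr rfl fun l _ => ?_
    rw [hβ, Ψb]
  have h4 (x y z) : (g ∘ₗ f) (op (Ψ y z) • x) = Φ x y • z := by
    rw [hgf, ← hα, ← h2, map_sum]
    refine Finset.sum_congr rfl fun l _ => ?_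
    rw [hα, Φb]
  have h5 (x) : (g' ∘ₗ f') ((g ∘ₗ f) x) = x := by
    rw [hgf, map_sum]
    simp only [h3]
    rw [← Finset.sum_smul, ← Finset.op_sum]
    exact (congrArg (fun a => op a • x) hvu1).trans (one_smul _ x)
  have h6 (x) : (g ∘ₗ f) ((g' ∘ₗ f') x) = x := by
    rw [hgf', map_sum]
    simp only [h4]
    rw [← Finset.sum_smul]
    exact (congrArg (fun a => a • x) huv1).trans (one_smul _ x)
  exact ⟨projective_of_factor f g ⟨Function.LeftInverse.injective h5,
      Function.RightInverse.surjective h6⟩,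
    projective_of_factor f' g' ⟨Function.LeftInverse.injective h6,
      Function.RightInverse.surjective h5⟩⟩

/-- Splitting `N` off a free module and tensoring with `M` exhibits `M ⊗_A N` as a direct summand of
a sum of copies of `M`. -/
theorem RelTensor.projective_left (M N : Bimod k A) [Module.Projective A M]
    [Module.Projective A N] : Module.Projective A (RelTensor M N) := by
  obtain ⟨s, hs⟩ := Module.projective_def'.1 ‹Module.Projective A N›
  have hs' (n : N) : (s n).sum (fun j a => a • j) = n := LinearMap.congr_fun hs n
  let F : RelTensor M N →ₗ[k] N →₀ M := RelTensor.lift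
    (LinearMap.mk₂ k (fun m n => (s n).mapRange (fun a => op a • m) (by simp))
      (fun m m' n => by ext; simp) (fun c m n => by ext; simp [smul_comm _ c m])
      (fun m n n' => by ext; simp [add_smul])
      (fun c m n => by
        ext
        simp [LinearMap.map_smul_of_tower])) fun m a n => by
          ext
          simp [mul_smul]
  have hF (m n) : F (RelTensor.mk m n) = (s n).mapRange (fun a => op a • m) (by simp) :=
    RelTensor.lift_mk _ _ _ _
  let F' : RelTensor M N →ₗ[A] N →₀ M :=
    { toFun := F
      map_add' := map_add F
      map_smul' := fun a x => by
        induction x using RelTensor.induction with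
        | h0 => simp
        | hmk m n =>
          rw [RelTensor.smul_mk, hF, hF]
          ext
          simp [smul_comm]
        | hadd x y hx hy => simp only [smul_add, map_add, hx, hy] }
  let G : (N →₀ M) →ₗ[A] RelTensor M N := Finsupp.lsum ℕ fun j =>
    { toFun := fun m => RelTensor.mk m j
      map_add' := fun m m' => by simp
      map_smul' := fun a m => by simp }
  classical
  have hP : Module.Projective A (N →₀ M) :=
    Module.Projective.of_equiv (finsuppLequivDFinsupp (ι := N) (M := M) A).symm
  refine Module.Projective.of_split F' G (LinearMap.ext fun x => ?_)
  change G (F x) = x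
  induction x using RelTensor.induction with
  | h0 => simp
  | hmk m n =>
    rw [hF]
    conv_rhs => rw [← hs' n, Finsupp.sum, map_sum]
    rw [Finsupp.lsum_apply, Finsupp.sum_mapRange_index (by simp)]
    refine Finset.sum_congr rfl fun j _ => ?_
    exact RelTensor.mk_balanced _ _ _
  | hadd x y hx hy => rw [map_add, map_add, hx, hy]

theorem RelTensor.projective_right (M N : Bimod k A) [Module.Projective Aᵐᵒᵖ M]
    [Module.Projective Aᵐᵒᵖ N] : Module.Projective Aᵐᵒᵖ (RelTensor M N) := by
  obtain ⟨s, hs⟩ := Module.projective_def'.1 ‹Module.Projective Aᵐᵒᵖ M›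
  have hs' (n : M) : (s n).sum (fun j a => a • j) = n := LinearMap.congr_fun hs n
  let F : RelTensor M N →ₗ[k] M →₀ N := RelTensor.lift
    (LinearMap.mk₂ k (fun m n => (s m).mapRange (fun a => a.unop • n) (by simp))
      (fun m m' n => by ext; simp [add_smul])
      (fun c m n => by
        ext
        simp [LinearMap.map_smul_of_tower])
      (fun m n n' => by ext; simp)
      (fun c m n => by ext; simp [smul_comm _ c n])) fun m a n => by
          ext
          simp [mul_smul]
  have hF (m n) : F (RelTensor.mk m n) = (s m).mapRange (fun a => a.unop • n) (by simp) :=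
    RelTensor.lift_mk _ _ _ _
  let F' : RelTensor M N →ₗ[Aᵐᵒᵖ] M →₀ N :=
    { toFun := F
      map_add' := map_add F
      map_smul' := fun a x => by
        induction x using RelTensor.induction with
        | h0 => simp
        | hmk m n =>
          rw [RelTensor.op_smul_mk, hF, hF]
          ext
          simp [smul_comm]
        | hadd x y hx hy => simp only [smul_add, map_add, hx, hy] }
  let G : (M →₀ N) →ₗ[Aᵐᵒᵖ] RelTensor M N := Finsupp.lsum ℕ fun j =>
    { toFun := fun n => RelTensor.mk j n
      map_add' := fun m m' => by simp
      map_smul' := fun a m => by simp }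
  classical
  have hP : Module.Projective Aᵐᵒᵖ (M →₀ N) :=
    Module.Projective.of_equiv (finsuppLequivDFinsupp (ι := M) (M := N) Aᵐᵒᵖ).symm
  refine Module.Projective.of_split F' G (LinearMap.ext fun x => ?_)
  change G (F x) = x
  induction x using RelTensor.induction with
  | h0 => simp
  | hmk m n =>
    rw [hF]
    conv_rhs => rw [← hs' m, Finsupp.sum, map_sum, LinearMap.sum_apply]
    rw [Finsupp.lsum_apply, Finsupp.sum_mapRange_index (by simp)]
    refine Finset.sum_congr rfl fun j _ => ?_
    exact (RelTensor.mk_balanced _ _ _).symm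
  | hadd x y hx hy => rw [map_add, map_add, hx, hy]

theorem Bimod.tpow_projective (U : Bimod k A) [Module.Projective A U] (n : ℕ) :
    Module.Projective A (U.tpow n) := by
  induction n with
  | zero => exact inferInstanceAs (Module.Projective A A)
  | succ n ih => exact RelTensor.projective_left U (U.tpow n)

instance (priority := low) : Module.Projective Aᵐᵒᵖ A :=
  Module.Projective.of_equiv (MulOpposite.opLinearEquiv (M := A) Aᵐᵒᵖ).symm

theorem Bimod.tpow_projective_op (U : Bimod k A) [Module.Projective Aᵐᵒᵖ U] (n : ℕ) :
    Module.Projective Aᵐᵒᵖ (U.tpow n) := by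
  induction n with
  | zero => exact inferInstanceAs (Module.Projective Aᵐᵒᵖ A)
  | succ n ih => exact RelTensor.projective_right U (U.tpow n)

end Invertible

/-! ### The tensor algebra as an algebra over `A` -/

namespace TensorAlg

variable {k : Type u} [CommRing k] {A : Type v} [Ring A] [Algebra k A] (U : Bimod k A)

/-- The inclusion of `A` into `A[U]`. -/
def base : A →ₐ[k] TensorAlg U where
  toFun a := incl U 0 (scalar U a)
  map_one' := rfl
  map_mul' a b := by rw [incl_zero_mul, ← map_smul, ← map_smul, smul_eq_mul]
  map_zero' := by simp
  map_add' a b := by simp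
  commutes' c := by
    rw [Algebra.algebraMap_eq_smul_one, Algebra.algebraMap_eq_smul_one]
    rw [LinearMap.map_smul_of_tower, LinearMap.map_smul_of_tower]
    rfl

/-- The inclusion of `U` into `A[U]`. -/
def gen : U →ₗ[k] TensorAlg U := insert.flip 1

variable {U}

theorem base_mul (a : A) (x : TensorAlg U) : base U a * x = a • x := incl_zero_mul a x

theorem gen_mul (u : U) (x : TensorAlg U) : gen U u * x = insert u x := by
  change insert u 1 * x = _
  rw [insert_mul, one_mul]

theorem gen_smul (a : A) (u : U) : gen U (a • u) = base U a * gen U u := by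
  rw [base_mul]
  exact (smul_insert a u 1).symm

theorem gen_op_smul (a : A) (u : U) : gen U (op a • u) = gen U u * base U a := by
  rw [gen_mul]
  refine (insert_balanced u a 1).trans ?_
  rw [← base_mul, mul_one]

/-- An induction principle: `A[U]` is spanned by `A` and is closed under multiplication by
generators. -/
theorem gen_induction {p : TensorAlg U → Prop} (h0 : p 0) (hbase : ∀ a, p (base U a))
    (hgen : ∀ u x, p x → p (gen U u * x)) (hadd : ∀ x y, p x → p y → p (x + y))
    (x : TensorAlg U) : p x := by
  induction x using induction with
  | h0 => exact h0
  | hincl n t =>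
    induction n with
    | zero =>
      obtain ⟨a, rfl⟩ := exists_scalar t
      exact hbase a
    | succ n ih =>
      induction t using tpow_induction with
      | h0 => rwa [map_zero]
      | hcons u t =>
        rw [← insert_incl, ← gen_mul]
        exact hgen u _ (ih t)
      | hadd s t hs ht => rw [map_add]; exact hadd _ _ hs ht
  | hadd x y hx hy => exact hadd x y hx hy

theorem incl_mul_base (n : ℕ) (t : U.tpow n) (a : A) :
    incl U n t * base U a = incl U n (op a • t) := by
  induction n with
  | zero =>
    obtain ⟨b, rfl⟩ := exists_scalar t
    rw [incl_zero_mul]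
    change b • incl U 0 (scalar U a) = incl U 0 (scalar U (b * a))
    rw [← map_smul, ← map_smul, smul_eq_mul]
  | succ n ih =>
    induction t using tpow_induction with
    | h0 => simp
    | hcons u t =>
      rw [incl_cons_mul, ih, insert_incl]
      exact congrArg (incl U (n + 1)) (RelTensor.op_smul_mk (op a) u t).symm
    | hadd s t hs ht => rw [map_add, add_mul, hs, ht, smul_add, map_add]

theorem leftProj_base [Module.Projective A U] : LeftProj (base U) := by
  have (n : ℕ) : Module.Projective A (U.tpow n) := U.tpow_projective n
  have hP : Module.Projective A (TensorAlg U) :=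
    inferInstanceAs (Module.Projective A (DirectSum ℕ fun n => U.tpow n))
  obtain ⟨s, hs⟩ := Module.projective_def'.1 hP
  refine ⟨TensorAlg U, id, s.restrictScalars k, fun x r j => ?_, fun x => ?_⟩
  · simp [base_mul]
  · simp only [base_mul]
    exact LinearMap.congr_fun hs x

theorem rightProj_base [Module.Projective Aᵐᵒᵖ U] : RightProj (base U) := by
  have (n : ℕ) : Module.Projective Aᵐᵒᵖ (U.tpow n) := U.tpow_projective_op n
  let _ : Module Aᵐᵒᵖ (TensorAlg U) :=
    inferInstanceAs (Module Aᵐᵒᵖ (DirectSum ℕ fun n => U.tpow n))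
  have : IsScalarTower k Aᵐᵒᵖ (TensorAlg U) :=
    inferInstanceAs (IsScalarTower k Aᵐᵒᵖ (DirectSum ℕ fun n => U.tpow n))
  have hP : Module.Projective Aᵐᵒᵖ (TensorAlg U) :=
    inferInstanceAs (Module.Projective Aᵐᵒᵖ (DirectSum ℕ fun n => U.tpow n))
  have key (x : TensorAlg U) (a : A) : x * base U a = op a • x := by
    induction x using induction with
    | h0 => simp
    | hincl n t =>
      rw [incl_mul_base]
      exact (DirectSum.lof Aᵐᵒᵖ ℕ (fun n => U.tpow n) n).map_smul (op a) t
    | hadd x y hx hy => rw [add_mul, smul_add, hx, hy]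
  obtain ⟨s, hs⟩ := Module.projective_def'.1 hP
  refine ⟨TensorAlg U, id, Finsupp.mapRange.linearMap (opLinearEquiv k).symm.toLinearMap ∘ₗ
    s.restrictScalars k, fun x r j => ?_, fun x => ?_⟩
  · simp [key]
  · simp only [key]
    rw [LinearMap.comp_apply, Finsupp.mapRange.linearMap_apply,
      Finsupp.sum_mapRange_index (by simp)]
    exact LinearMap.congr_fun hs x

end TensorAlg

/-! ### The standard exact sequence of a tensor algebra -/

section Koszul

variable {k : Type u} [CommRing k] {A B : Type v} [Ring A] [Algebra k A] [Ring B] [Algebra k B]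
  (i : A →ₐ[k] B)

open BaseChange

/-- In `B ⊗_A A ⊗_A B` scalars of `A` cross the middle, since `a · 1 = 1 · a` in `A`. -/
theorem tm_mul_base_smul_of_one (x y : B) (a : A) :
    (Two.tm (x * i a) y : Two k B B) • of (envMap i) (1 : A) =
      (Two.tm x (i a * y) : Two k B B) • of (envMap i) (1 : A) := by
  have h1 : (Two.tm (x * i a) y : Two k B B) = Two.tm x y * envMap i (Two.tm a 1) := by
    simp [Two.tm_mul_tm]
  have h2 : (Two.tm x (i a * y) : Two k B B) = Two.tm x y * envMap i (Two.tm 1 a) := by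
    simp [Two.tm_mul_tm]
  rw [h1, h2, mul_smul, mul_smul, ← of_smul, ← of_smul]
  simp

theorem smul_of_eq (γ : Two k B B) (a : A) :
    γ • of (envMap i) a = (γ * Two.tm (i a) 1) • of (envMap i) (1 : A) := by
  have h : (Two.tm (i a) 1 : Two k B B) = envMap i (Two.tm a 1) := by simp
  rw [mul_smul, h, ← of_smul]
  simp

/-- The map `B ⊗_A A ⊗_A B → B` given by multiplication. -/
def multiply : BaseChange (envMap i) A →+ B :=
  liftBase ((Algebra.lsmul k k B).toLinearMap.compl₂ i.toLinearMap) fun s r m => by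
    change (s * envMap i r) • i m = s • i (r • m)
    rw [mul_smul, envMap_smul]

theorem multiply_smul_of (γ : Two k B B) (a : A) : multiply i (γ • of (envMap i) a) = γ • i a :=
  liftBase_smul_of _ _ γ a

variable {U : Bimod k A} (j : U →ₗ[k] B)

/-- The element `u ⊗ 1 - 1 ⊗ u` of `B ⊗_A A ⊗_A B`. -/
def difference : U →ₗ[k] BaseChange (envMap i) A :=
  LinearMap.flip (Algebra.lsmul k k (BaseChange (envMap i) A)).toLinearMap (of (envMap i) (1 : A)) ∘ₗ
    (Two.tm.flip 1 - Two.tm 1) ∘ₗ j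

theorem difference_apply (u : U) : difference i j u =
    (Two.tm (j u) 1 - Two.tm 1 (j u) : Two k B B) • of (envMap i) (1 : A) := rfl

variable {i j} (hj : ∀ (x : Two k A A) u, j (x • u) = envMap i x • j u)

include hj in
-- An outer scalar from `A` meets the middle tensor sign in one of the two terms and can be carried
-- across it, so `u ↦ u ⊗ 1 - 1 ⊗ u` is a bimodule map.
theorem difference_smul (x : Two k A A) (u : U) :
    difference i j (x • u) = envMap i x • difference i j u := by
  induction x using Two.induction with
  | h0 => simp
  | htm a b =>
    have h1 := tm_mul_base_smul_of_one i (i a * j u) 1 b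
    have h2 := tm_mul_base_smul_of_one i 1 (j u * i b) a
    rw [mul_one] at h1
    rw [one_mul] at h2
    rw [difference_apply, difference_apply, hj, ← mul_smul, mul_sub, sub_smul, sub_smul]
    simp only [Two.map_tm, Two.tm_smul_self, Two.tm_mul_tm, mul_one, one_mul]
    rw [h1, h2, mul_assoc]
  | hadd x y hx hy => simp only [add_smul, map_add, hx, hy]

/-- The map `B ⊗_A U ⊗_A B → B ⊗_A A ⊗_A B`, `x ⊗ u ⊗ y ↦ x u ⊗ y - x ⊗ u y`. -/
def koszul : BaseChange (envMap i) U →+ BaseChange (envMap i) A :=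
  liftBase ((Algebra.lsmul k k (BaseChange (envMap i) A)).toLinearMap.compl₂ (difference i j))
    fun s r m => by
      change (s * envMap i r) • difference i j m = s • difference i j (r • m)
      rw [mul_smul, difference_smul hj]

theorem koszul_smul_of (γ : Two k B B) (u : U) :
    koszul hj (γ • of (envMap i) u) = γ • difference i j u :=
  liftBase_smul_of _ _ γ u

theorem koszul_smul (γ : Two k B B) (z) : koszul hj (γ • z) = γ • koszul hj z := by
  induction z using BaseChange.induction with
  | h0 => simp
  | hof s m => rw [← mul_smul, koszul_smul_of, koszul_smul_of, mul_smul]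
  | hadd x y hx hy => simp only [smul_add, map_add, hx, hy]

end Koszul

/-! ### Exactness of the standard sequence and the universal derivation -/

namespace TensorAlg

open BaseChange

variable {k : Type u} [CommRing k] {A : Type v} [Ring A] [Algebra k A] {U : Bimod k A}

theorem gen_two_smul (x : Two k A A) (u : U) : gen U (x • u) = envMap (base U) x • gen U u := by
  induction x using Two.induction with
  | h0 => simp
  | htm a b =>
    rw [Two.tm_smul, gen_smul, gen_op_smul]
    simp [mul_assoc]
  | hadd x y hx hy => simp only [add_smul, map_add, hx, hy]

/-- Modulo elements `x ⊗ 1 - 1 ⊗ x`, every `z` is congruent to `1 ⊗ m` with `m` its product. Those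
elements obey a Leibniz rule in `x` and vanish for `x ∈ A`, so they all come from the generators `u
∈ U`. -/
theorem exists_koszul_eq (z : BaseChange (envMap (base U)) A)
    (hz : multiply (base U) z = 0) : ∃ y, koszul gen_two_smul y = z := by
  let e : BaseChange (envMap (base U)) A := of (envMap (base U)) (1 : A)
  have key (x : TensorAlg U) : ∃ y, koszul gen_two_smul y =
      (Two.tm x 1 - Two.tm 1 x : Two k (TensorAlg U) (TensorAlg U)) • e := by
    induction x using gen_induction with
    | h0 => exact ⟨0, by simp⟩
    | hbase a =>
      refine ⟨0, ?_⟩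
      have := tm_mul_base_smul_of_one (base U) 1 1 a
      rw [one_mul, mul_one] at this
      rw [map_zero, sub_smul, this, sub_self]
    | hgen u x hx =>
      obtain ⟨y, hy⟩ := hx
      refine ⟨(Two.tm (gen U u) 1 : Two k (TensorAlg U) (TensorAlg U)) • y +
        (Two.tm 1 x : Two k (TensorAlg U) (TensorAlg U)) • of (envMap (base U)) u, ?_⟩
      rw [map_add, koszul_smul, hy, koszul_smul_of, difference_apply, ← mul_smul, ← mul_smul,
        ← add_smul]
      congr 1
      simp only [mul_sub, Two.tm_mul_tm, mul_one, one_mul]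
      abel
    | hadd x y hx hy =>
      obtain ⟨x', hx⟩ := hx
      obtain ⟨y', hy⟩ := hy
      refine ⟨x' + y', ?_⟩
      rw [map_add, hx, hy, ← add_smul]
      simp only [map_add, LinearMap.add_apply]
      congr 1
      abel
  suffices H : ∃ y, koszul gen_two_smul y =
      z - (Two.tm 1 (multiply (base U) z) : Two k (TensorAlg U) (TensorAlg U)) • e by
    obtain ⟨y, hy⟩ := H
    refine ⟨y, ?_⟩
    rw [hy, hz]
    simp
  clear hz
  induction z using BaseChange.induction with
  | h0 => exact ⟨0, by simp⟩
  | hof s a =>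
    rw [multiply_smul_of, smul_of_eq]
    induction s using Two.induction with
    | h0 => exact ⟨0, by simp⟩
    | htm x y =>
      obtain ⟨z, hz⟩ := key (x * base U a)
      refine ⟨(Two.tm 1 y : Two k (TensorAlg U) (TensorAlg U)) • z, ?_⟩
      rw [koszul_smul, hz, ← mul_smul, ← sub_smul]
      congr 1
      simp [mul_sub, Two.tm_mul_tm]
    | hadd x y hx hy =>
      obtain ⟨x', hx⟩ := hx
      obtain ⟨y', hy⟩ := hy
      refine ⟨x' + y', ?_⟩
      rw [map_add, hx, hy, add_smul, add_mul, add_smul, map_add, add_smul]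
      abel
  | hadd x y hx hy =>
    obtain ⟨x', hx⟩ := hx
    obtain ⟨y', hy⟩ := hy
    refine ⟨x' + y', ?_⟩
    rw [map_add, hx, hy, map_add, map_add, add_smul]
    abel

/-- The bilinear map `(u, t) ↦ u S(t) + 1 ⊗ u ⊗ t`. -/
def derivStep {n : ℕ} (S : U.tpow n →ₗ[k] BaseChange (envMap (base U)) U) :
    U →ₗ[k] U.tpow n →ₗ[k] BaseChange (envMap (base U)) U :=
  ((Algebra.lsmul k k (BaseChange (envMap (base U)) U)).toLinearMap ∘ₗ
    (Two.tm.flip 1 : _ →ₗ[k] Two k (TensorAlg U) (TensorAlg U)) ∘ₗ gen U).compl₂ S +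
  ((Algebra.lsmul k k (BaseChange (envMap (base U)) U)).toLinearMap ∘ₗ
    (Two.tm 1 : _ →ₗ[k] Two k (TensorAlg U) (TensorAlg U)) ∘ₗ
      (incl U n).restrictScalars k).flip ∘ₗ of (envMap (base U))

theorem derivStep_apply {n : ℕ} (S : U.tpow n →ₗ[k] BaseChange (envMap (base U)) U) (u : U)
    (t : U.tpow n) : derivStep S u t =
      (Two.tm (gen U u) 1 : Two k (TensorAlg U) (TensorAlg U)) • S t +
      (Two.tm 1 (incl U n t) : Two k (TensorAlg U) (TensorAlg U)) • of (envMap (base U)) u := rfl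

variable (U) in
/-- The linear maps on a tensor power with values in `B ⊗_A U ⊗_A B` which are left `A`-linear. -/
def LeftLinearMaps (n : ℕ) : Type _ :=
  {S : U.tpow n →ₗ[k] BaseChange (envMap (base U)) U //
    ∀ a t, S (a • t) = (Two.tm (base U a) 1 : Two k (TensorAlg U) (TensorAlg U)) • S t}

theorem derivStep_balanced {n : ℕ} (S : LeftLinearMaps U n) (u : U) (a : A) (t : U.tpow n) :
    derivStep S.1 (op a • u) t = derivStep S.1 u (a • t) := by
  have h1 : op a • u = (Two.tm 1 a : Two k A A) • u := by rw [Two.tm_smul]; simp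
  rw [derivStep_apply, derivStep_apply, S.2, gen_op_smul, h1, of_smul, ← mul_smul, ← mul_smul,
    map_smul, ← base_mul]
  simp [Two.tm_mul_tm]

/-- The extension of a left linear map to the next tensor power by the Leibniz rule. -/
def derivSucc {n : ℕ} (S : LeftLinearMaps U n) :
    RelTensor U (U.tpow n) →ₗ[k] BaseChange (envMap (base U)) U :=
  RelTensor.lift (derivStep S.1) (derivStep_balanced S)

theorem derivSucc_smul {n : ℕ} (S : LeftLinearMaps U n) (a : A) (x : RelTensor U (U.tpow n)) :
    derivSucc S (a • x) =
      (Two.tm (base U a) 1 : Two k (TensorAlg U) (TensorAlg U)) • derivSucc S x := by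
  induction x using RelTensor.induction with
  | h0 => simp
  | hmk u t =>
    have h1 : a • u = (Two.tm a 1 : Two k A A) • u := by rw [Two.tm_smul]; simp
    rw [RelTensor.smul_mk, derivSucc, RelTensor.lift_mk, RelTensor.lift_mk, derivStep_apply,
      derivStep_apply, gen_smul, h1, of_smul, smul_add, ← mul_smul, ← mul_smul, ← mul_smul]
    simp [Two.tm_mul_tm]
  | hadd x y hx hy => simp only [smul_add, map_add, hx, hy]

variable (U) in
/-- The universal derivation of `A[U]` over `A`, restricted to a tensor power. -/
def derivAux : ∀ n, LeftLinearMaps U n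
  | 0 => ⟨0, by simp⟩
  | n + 1 => ⟨derivSucc (derivAux n), derivSucc_smul (derivAux n)⟩

variable (U) in
/-- The universal derivation of `A[U]` over `A`. -/
def deriv : TensorAlg U →ₗ[k] BaseChange (envMap (base U)) U := desc fun n => (derivAux U n).1

theorem deriv_base (a : A) : deriv U (base U a) = 0 := desc_incl _ 0 (scalar U a)

theorem deriv_insert (u : U) (x : TensorAlg U) : deriv U (gen U u * x) =
    (Two.tm (gen U u) 1 : Two k (TensorAlg U) (TensorAlg U)) • deriv U x +
      (Two.tm 1 x : Two k (TensorAlg U) (TensorAlg U)) • of (envMap (base U)) u := by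
  rw [gen_mul]
  induction x using induction with
  | h0 => simp
  | hincl n t =>
    rw [insert_incl, deriv, desc_incl, desc_incl]
    exact RelTensor.lift_mk _ (derivStep_balanced (derivAux U n)) u t
  | hadd x y hx hy =>
    rw [map_add, map_add, hx, hy, map_add, map_add, smul_add, add_smul]
    abel

theorem deriv_base_mul (a : A) (x : TensorAlg U) : deriv U (base U a * x) =
    (Two.tm (base U a) 1 : Two k (TensorAlg U) (TensorAlg U)) • deriv U x := by
  rw [base_mul]
  induction x using induction with
  | h0 => simp
  | hincl n t =>
    rw [← map_smul, deriv, desc_incl, desc_incl]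
    exact (derivAux U n).2 a t
  | hadd x y hx hy => rw [smul_add, map_add, hx, hy, map_add, smul_add]

theorem deriv_mul (x y : TensorAlg U) : deriv U (x * y) =
    (Two.tm x 1 : Two k (TensorAlg U) (TensorAlg U)) • deriv U y +
      (Two.tm 1 y : Two k (TensorAlg U) (TensorAlg U)) • deriv U x := by
  induction x using gen_induction with
  | h0 => simp
  | hbase a => rw [deriv_base_mul, deriv_base, smul_zero, add_zero]
  | hgen u x hx =>
    rw [mul_assoc, deriv_insert, hx, deriv_insert, smul_add, smul_add, ← mul_smul, ← mul_smul,
      ← mul_smul, ← mul_smul]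
    simp only [Two.tm_mul_tm, mul_one, one_mul]
    abel
  | hadd x z hx hz =>
    rw [add_mul, map_add, hx, hz]
    simp only [map_add, LinearMap.add_apply, add_smul, smul_add]
    abel

theorem deriv_gen (u : U) : deriv U (gen U u) = of (envMap (base U)) u := by
  have := deriv_insert u (1 : TensorAlg U)
  rw [mul_one, ← map_one (base U), deriv_base, smul_zero, zero_add, map_one, ← Two.one_def,
    one_smul] at this
  exact this

/-- A left inverse is `x ⊗ y ↦ d(x) y` with `d` the universal derivation: on the image of `x ⊗ u ⊗
y` it gives `d(xu) y - d(x) u y = x d(u) y`, and `d(u)` is the class of `u`. -/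
theorem koszul_injective : Function.Injective (koszul (gen_two_smul (U := U))) := by
  let φ : Two k (TensorAlg U) (TensorAlg U) →ₗ[k] A →ₗ[k] BaseChange (envMap (base U)) U :=
    Two.lift (LinearMap.mk₂ k (fun x y => (Algebra.lsmul k k (BaseChange (envMap (base U)) U)
      (Two.tm 1 y : Two k (TensorAlg U) (TensorAlg U))) ∘ₗ deriv U ∘ₗ
        LinearMap.mulLeft k x ∘ₗ (base U).toLinearMap)
      (fun x x' y => by ext; simp [add_mul]) (fun c x y => by ext; simp [smul_comm _ c])
      (fun x y y' => by ext; simp) (fun c x y => by ext; simp))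
  have hφ' (x y : TensorAlg U) (a : A) : φ (Two.tm x y) a =
      (Two.tm 1 y : Two k (TensorAlg U) (TensorAlg U)) • deriv U (x * base U a) := by
    simp [φ]
  have hφ (s r m) : φ (s * envMap (base U) r) m = φ s (r • m) := by
    induction s using Two.induction with
    | h0 => simp
    | htm x y =>
      induction r using Two.induction with
      | h0 => simp
      | htm a b =>
        rw [Two.map_tm, Two.tm_mul_tm, hφ', hφ', Two.tm_smul_self, map_mul (base U), map_mul (base U),
          ← mul_assoc, ← mul_assoc, deriv_mul _ (base U b), deriv_base, smul_zero, zero_add, ← mul_smul,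
          Two.tm_mul_tm, one_mul]
      | hadd r r' h h' => rw [map_add, mul_add, map_add, LinearMap.add_apply, h, h', add_smul,
          map_add]
    | hadd x y hx hy => simp only [add_mul, map_add, LinearMap.add_apply, hx, hy]
  suffices H : ∀ z, liftBase φ hφ (koszul gen_two_smul z) = z from
    Function.LeftInverse.injective H
  intro z
  induction z using BaseChange.induction with
  | h0 => simp
  | hof s u =>
    rw [koszul_smul_of, difference_apply, ← mul_smul, liftBase_smul_of]
    induction s using Two.induction with
    | h0 => simp
    | htm x y =>
      rw [mul_sub, Two.tm_mul_tm, Two.tm_mul_tm, map_sub, LinearMap.sub_apply, hφ', hφ', map_one (base U),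
        mul_one, mul_one, mul_one, one_mul, deriv_mul, deriv_gen, smul_add, ← mul_smul, ← mul_smul,
        Two.tm_mul_tm, Two.tm_mul_tm, one_mul, one_mul, one_mul, add_sub_cancel_right]
    | hadd x y hx hy => rw [add_mul, map_add, LinearMap.add_apply, hx, hy, add_smul]
  | hadd x y hx hy => simp only [map_add, hx, hy]

end TensorAlg

/-- A resolution of `A` by finitely generated projective bimodules of length `d` such that the dual
complex resolves `U`, given by matrices over the enveloping algebra. -/
structure DualityData {k : Type u} [CommRing k] {A : Type v} [Ring A] [Algebra k A] (U : Bimod k A)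
    (d : ℕ) (ι : Type) [Fintype ι] extends ResData k A ι where
  q : ι → U
  deg_le : ∀ s, deg s ≤ d
  q_deg : ∀ s, deg s ≠ d → q s = 0
  E_q : ∀ s, rowDot (Eᴴ s) q = q s
  D_q : ∀ s, rowDot (Dᴴ s) q = 0
  exact_q : ∀ v : ι → Two k A A, v ᵥ* Eᴴ = v → v ᵥ* Dᴴ = 0 → rowDot v q = 0 → ∃ w, w ᵥ* Dᴴ = v
  span_q : ∀ x : U, ∃ v : ι → Two k A A, rowDot v q = x

/-- A resolution is self-dual of dimension `n` if it is isomorphic to the dual complex up to signs,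
through a permutation of the basis. -/
structure ResData.IsSelfDual {k : Type u} [CommRing k] {A : Type v} [Ring A] [Algebra k A]
    {ι : Type} [Fintype ι] (X : ResData k A ι) (n : ℕ) (σ : ι ≃ ι) (ε : ι → ℤ) : Prop where
  deg_add : ∀ s, X.deg s + X.deg (σ s) = n
  ε_mul : ∀ s, ε s * ε s = 1
  star_E : ∀ s t, star (X.E t s) = (ε s * ε t) • X.E (σ s) (σ t)
  star_D : ∀ s t, star (X.D t s) = (ε s * ε t) • X.D (σ s) (σ t)

/-! ### The symmetric form and its mapping cone -/

namespace DualityData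

open BaseChange

section Extend

variable {k : Type u} [CommRing k] {A B : Type v} [Ring A] [Algebra k A] [Ring B] [Algebra k B]
  {U : Bimod k A} {d : ℕ} {ι : Type} [Fintype ι] (X : DualityData U d ι) (i : A →ₐ[k] B)

/-- A form `Φ` pairing the dual complex with the base change of the resolution, with the properties
needed to build the mapping cone. -/
structure IsForm (j : U →ₗ[k] B) (Φ : Matrix ι ι (Two k B B)) (c : ℤ) : Prop where
  sq : c * c = 1
  deg : ∀ s t, X.deg s + X.deg t ≠ d → Φ s t = 0
  mul_E : Φ * X.E.map (envMap i) = Φ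
  E_mul : (X.E.map (envMap i))ᴴ * Φ = Φ
  mul_D : Φ * X.D.map (envMap i) + (X.D.map (envMap i))ᴴ * Φ = 0
  adjoint : Φᴴ = -c • Φ
  dot : ∀ s, rowDot (Φ s) (fun t => of (envMap i) (X.p t)) = -difference i j (X.q s)

theorem mul_ofHalf (F : ι → ι → Two k A B) (M : Matrix ι ι (Two k A A)) :
    (Matrix.of fun s t => ofHalf i (F s t)) * M.map (envMap i) =
      Matrix.of fun s t => ofHalf i (ResData.rmul i M (F s) t) := by
  ext s t
  simp [Matrix.mul_apply, ResData.rmul_apply_apply, ofHalf_toHalf]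

theorem conjTranspose_mul_ofHalf (F : ι → ι → Two k A B) (M : Matrix ι ι (Two k A A)) :
    (M.map (envMap i))ᴴ * (Matrix.of fun s t => ofHalf i (F s t)) =
      Matrix.of fun s t => ofHalf i (ResData.lact i M F s t) := by
  ext s t
  simp [Matrix.mul_apply, ResData.lact_apply, ofHalf_toHalf, star_envMap]

/-- The left coefficient lies in `A`, so it can be carried into the right factor: only `1 ⊗ b`
remains in front of the class of `1`. -/
theorem ofHalf_smul_of (c : Two k A B) (a : A) :
    ofHalf i c • of (envMap i) a =
      (Two.tm 1 (ofHalf i c • i a) : Two k B B) • of (envMap i) (1 : A) := by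
  induction c using Two.induction with
  | h0 => simp
  | htm x b =>
    have := tm_mul_base_smul_of_one i 1 b (x * a)
    rw [one_mul] at this
    rw [smul_of_eq]
    simp only [Two.map_tm, Two.tm_mul_tm, Two.tm_smul_self, ← map_mul, AlgHom.id_apply, one_mul]
    exact this
  | hadd x y hx hy => simp only [map_add, add_smul, hx, hy]

theorem star_ofHalf_smul_of (c : Two k A B) (a : A) :
    star (ofHalf i c) • of (envMap i) a =
      (Two.tm (star (ofHalf i c) • i a) 1 : Two k B B) • of (envMap i) (1 : A) := by
  induction c using Two.induction with
  | h0 => simp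
  | htm x b =>
    have := tm_mul_base_smul_of_one i (b * i a) 1 x
    rw [mul_one] at this
    rw [smul_of_eq]
    simp only [Two.map_tm, Two.star_tm, Two.tm_mul_tm, Two.tm_smul_self, AlgHom.id_apply, one_mul]
    exact this.symm
  | hadd x y hx hy =>
    simp only [map_add, star_add, add_smul, LinearMap.add_apply, hx, hy]

/-- With `G` the comparison map covering `u ↦ 1 ⊗ u`, its adjoint covers `c (u ⊗ 1)`. Put `Φ = G - c
G^*`: since `c * c = 1` it covers `1 ⊗ u - u ⊗ 1`, and its adjoint is exactly `-c Φ`. The chain map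
identities are stable under adjoints, so they pass from `G` to `Φ`. -/
theorem exists_form [Module.Projective k A] (hi : LeftProj i) {j : U →ₗ[k] B}
    (hj : ∀ (x : Two k A A) u, j (x • u) = envMap i x • j u) :
    ∃ Φ c, X.IsForm i j Φ c := by
  classical
  have hdot (v : ι → Two k A A) : rowDot (fun t => envMap i (v t)) (fun t => j (X.q t)) =
      j (rowDot v X.q) := by
    simp [rowDot, hj]
  obtain ⟨F, c, hc, hF1, hF2, hF3, hF4, hF5, hF6⟩ :=
    X.toResData.exists_symmetric_comparison i hi (q := fun s => j (X.q s)) X.deg_le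
      (fun s hs => by simp only [X.q_deg s hs, map_zero])
      (fun s => (hdot _).trans (by rw [← map_zero j, ← X.D_q s]; rfl))
      (fun s => (hdot _).trans (by simp only [← X.E_q s]; rfl))
  let G : Matrix ι ι (Two k B B) := Matrix.of fun s t => ofHalf i (F s t)
  have hG1 : G * X.E.map (envMap i) = G := by
    refine (mul_ofHalf i F X.E).trans ?_
    simp only [hF1]
    rfl
  have hG2 : (X.E.map (envMap i))ᴴ * G = G := by
    refine (conjTranspose_mul_ofHalf i F X.E).trans ?_
    simp only [hF2]
    rfl
  have hG3 : G * X.D.map (envMap i) + (X.D.map (envMap i))ᴴ * G = 0 := by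
    refine (congrArg₂ (· + ·) (mul_ofHalf i F X.D) (conjTranspose_mul_ofHalf i F X.D)).trans ?_
    ext s t
    have := congrFun (hF4 s) t
    rw [Pi.add_apply] at this
    simp only [Matrix.add_apply, Matrix.of_apply, ← map_add, this]
    simp
  have hG1' : (X.E.map (envMap i))ᴴ * Gᴴ = Gᴴ := by rw [← Matrix.conjTranspose_mul, hG1]
  have hG2' : Gᴴ * X.E.map (envMap i) = Gᴴ := by
    conv_rhs => rw [← hG2, Matrix.conjTranspose_mul, Matrix.conjTranspose_conjTranspose]
  have hG3' : Gᴴ * X.D.map (envMap i) + (X.D.map (envMap i))ᴴ * Gᴴ = 0 := by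
    have := congrArg Matrix.conjTranspose hG3
    rw [Matrix.conjTranspose_add, Matrix.conjTranspose_mul, Matrix.conjTranspose_mul,
      Matrix.conjTranspose_conjTranspose, Matrix.conjTranspose_zero, add_comm] at this
    exact this
  refine ⟨G - c • Gᴴ, c, hc, fun s t hst => ?_, ?_, ?_, ?_, ?_, fun s => ?_⟩
  · have h1 : F s t = 0 := hF3 s t hst
    have h2 : F t s = 0 := hF3 t s (by omega)
    change ofHalf i (F s t) - c • star (ofHalf i (F t s)) = 0
    rw [h1, h2]
    simp
  · rw [Matrix.sub_mul, Matrix.smul_mul, hG1, hG2']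
  · rw [Matrix.mul_sub, Matrix.mul_smul, hG2, hG1']
  · rw [Matrix.mul_sub, Matrix.sub_mul, Matrix.smul_mul, Matrix.mul_smul, sub_add_sub_comm, hG3,
      ← smul_add, hG3', smul_zero, sub_zero]
  · rw [Matrix.conjTranspose_sub, Matrix.conjTranspose_smul, Matrix.conjTranspose_conjTranspose,
      smul_sub, ← mul_smul, neg_mul, hc]
    simp only [star_trivial, neg_smul, one_smul]
    abel
  · have h1 : rowDot (G s) (fun t => of (envMap i) (X.p t)) =
        (Two.tm 1 (j (X.q s)) : Two k B B) • of (envMap i) (1 : A) := by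
      have := hF5 s
      rw [ResData.aug_apply] at this
      rw [← this, rowDot, rowDot, map_sum, Finset.sum_smul]
      exact Finset.sum_congr rfl fun t _ => ofHalf_smul_of i (F s t) (X.p t)
    have h2 : rowDot (Gᴴ s) (fun t => of (envMap i) (X.p t)) =
        c • (Two.tm (j (X.q s)) 1 : Two k B B) • of (envMap i) (1 : A) := by
      have h3 : rowDot (Gᴴ s) (fun t => of (envMap i) (X.p t)) =
          (Two.tm (c • j (X.q s)) 1 : Two k B B) • of (envMap i) (1 : A) := by
        rw [← hF6 s, rowDot, rowDot, map_sum, LinearMap.sum_apply, Finset.sum_smul]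
        exact Finset.sum_congr rfl fun t _ => star_ofHalf_smul_of i (F t s) (X.p t)
      rw [h3, map_zsmul, LinearMap.smul_apply, smul_assoc]
    have h4 : (G - c • Gᴴ) s = G s - c • Gᴴ s := rfl
    have h5 : rowDot (c • Gᴴ s) (fun t => of (envMap i) (X.p t)) =
        c • rowDot (Gᴴ s) (fun t => of (envMap i) (X.p t)) := by
      rw [rowDot, rowDot, Finset.smul_sum]
      exact Finset.sum_congr rfl fun t _ => smul_assoc c (Gᴴ s t) _
    rw [h4, rowDot_sub, h5, h1, h2, ← mul_smul, hc, one_smul, difference_apply, sub_smul, neg_sub]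

variable {i} {j : U →ₗ[k] B} (hj : ∀ (x : Two k A A) u, j (x • u) = envMap i x • j u)
  {Φ : Matrix ι ι (Two k B B)} {c : ℤ}

theorem rowDot_vecMul_form (hΦ : X.IsForm i j Φ c) (w : ι → Two k B B) :
    rowDot (w ᵥ* Φ) (fun t => of (envMap i) (X.p t)) =
      -koszul hj (rowDot w fun t => of (envMap i) (X.q t)) := by
  rw [rowDot_vecMul, rowDot, rowDot, map_sum, ← Finset.sum_neg_distrib]
  refine Finset.sum_congr rfl fun s _ => ?_
  rw [koszul_smul_of, hΦ.dot, smul_neg]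

theorem multiply_rowDot (v : ι → Two k B B) :
    multiply i (rowDot v fun t => of (envMap i) (X.p t)) = rowDot v fun t => i (X.p t) := by
  rw [rowDot, rowDot, map_sum]
  exact Finset.sum_congr rfl fun t _ => multiply_smul_of i _ _

/-- The generators `q` sit in degree `d`, the bottom of the dual complex, where everything is a
cycle. So elements of `B ⊗_A U ⊗_A B` have closed representatives, which serve to correct lifts. -/
theorem exists_rowDot_eq (z : BaseChange (envMap i) U) :
    ∃ w, w ᵥ* (X.E.map (envMap i))ᴴ = w ∧ w ᵥ* (X.D.map (envMap i))ᴴ = 0 ∧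
      rowDot w (fun t => of (envMap i) (X.q t)) = z := by
  classical
  have hE (s) : rowDot ((X.E.map (envMap i))ᴴ s) (fun t => of (envMap i) (X.q t)) =
      of (envMap i) (X.q s) := by
    rw [← X.E_q s, rowDot, rowDot, map_sum]
    refine Finset.sum_congr rfl fun t _ => ?_
    rw [of_smul]
    congr 1
    simp [star_envMap]
  obtain ⟨w, hw⟩ : ∃ w : ι → Two k B B, rowDot w (fun t => of (envMap i) (X.q t)) = z := by
    induction z using BaseChange.induction with
    | h0 => exact ⟨0, rowDot_zero _⟩
    | hof s u =>
      obtain ⟨v, hv⟩ := X.span_q u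
      refine ⟨s • fun t => envMap i (v t), ?_⟩
      rw [rowDot_smul, ← hv, rowDot, rowDot, map_sum]
      congr 1
      exact Finset.sum_congr rfl fun t _ => (of_smul _ _ _).symm
    | hadd x y hx hy =>
      obtain ⟨v, hv⟩ := hx
      obtain ⟨w, hw⟩ := hy
      exact ⟨v + w, by rw [rowDot_add, hv, hw]⟩
  have h1 : rowDot (fun t => if X.deg t = d then w t else 0) (fun t => of (envMap i) (X.q t)) =
      z := by
    rw [← hw]
    refine Finset.sum_congr rfl fun t _ => ?_
    by_cases ht : X.deg t = d
    · simp [ht]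
    · simp [X.q_deg t ht]
  refine ⟨(fun t => if X.deg t = d then w t else 0) ᵥ* (X.E.map (envMap i))ᴴ, ?_, ?_, ?_⟩
  · rw [Matrix.vecMul_vecMul, ← Matrix.conjTranspose_mul, ← Matrix.map_mul, X.E_E]
  · rw [Matrix.vecMul_vecMul, ← Matrix.conjTranspose_mul, ← Matrix.map_mul, X.D_E]
    funext t
    refine Finset.sum_eq_zero fun s _ => ?_
    change (if X.deg s = d then w s else 0) * star (envMap i (X.D t s)) = 0
    by_cases hs : X.deg s = d
    · rw [X.D_deg t s (by have := X.deg_le t; omega)]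
      simp
    · rw [if_neg hs, zero_mul]
  · rw [rowDot_vecMul]
    simp only [hE, h1]

theorem map_conjTranspose (M : Matrix ι ι (Two k A A)) :
    (M.map (envMap i))ᴴ = Mᴴ.map (envMap i) := by
  ext s t
  simp [star_envMap]

/-- The long exact sequence of the cone by hand: its outer complexes resolve `B ⊗_A U ⊗_A B` and `B
⊗_A B`, and the connecting map is minus the Koszul map, which is injective with image the kernel of
multiplication. -/
theorem total_exact (hr : RightProj i) (hl : LeftProj i) (hΦ : X.IsForm i j Φ c)
    (hinj : Function.Injective (koszul hj))
    (hker : ∀ z, multiply i z = 0 → ∃ y, koszul hj y = z) (v w : ι → Two k B B)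
    (hv : v ᵥ* X.E.map (envMap i) = v) (hw : w ᵥ* (X.E.map (envMap i))ᴴ = w)
    (hvw : v ᵥ* X.D.map (envMap i) + w ᵥ* Φ = 0) (hwD : w ᵥ* (X.D.map (envMap i))ᴴ = 0)
    (hvp : rowDot v (fun t => i (X.p t)) = 0) :
    ∃ v' w', v' ᵥ* X.D.map (envMap i) + w' ᵥ* Φ = v ∧ w' ᵥ* (X.D.map (envMap i))ᴴ = w := by
  have hf : RightProj (envMap i) := hr.two hl
  have hDp (v : ι → Two k B B) :
      rowDot (v ᵥ* X.D.map (envMap i)) (fun t => of (envMap i) (X.p t)) = 0 := by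
    rw [rowDot_vecMul]
    refine Finset.sum_eq_zero fun s _ => ?_
    have : rowDot (X.D.map (envMap i) s) (fun t => of (envMap i) (X.p t)) =
        of (envMap i) (rowDot (X.D s) X.p) := by
      rw [rowDot, rowDot, map_sum]
      exact Finset.sum_congr rfl fun t _ => (of_smul _ _ _).symm
    exact (congrArg (v s • ·) this).trans (by rw [X.D_p, map_zero, smul_zero])
  -- Since `w Φ` is minus a boundary it has zero augmentation, so the Koszul image of the class of
  -- `w` is zero and injectivity applies.
  have hwq : rowDot w (fun t => of (envMap i) (X.q t)) = 0 := by
    apply hinj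
    rw [map_zero, ← neg_eq_zero, ← X.rowDot_vecMul_form hj hΦ,
      ← neg_eq_of_add_eq_zero_right hvw, rowDot_neg, hDp, neg_zero]
  obtain ⟨w', hw'⟩ : ∃ w', w' ᵥ* (X.D.map (envMap i))ᴴ = w := by
    rw [map_conjTranspose] at hw hwD ⊢
    exact hf.exact X.exact_q w hw hwD hwq
  have hΦE (w : ι → Two k B B) : w ᵥ* Φ ᵥ* X.E.map (envMap i) = w ᵥ* Φ := by
    rw [Matrix.vecMul_vecMul, hΦ.mul_E]
  have hΦD (w : ι → Two k B B) : w ᵥ* Φ ᵥ* X.D.map (envMap i) =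
      -(w ᵥ* (X.D.map (envMap i))ᴴ ᵥ* Φ) := by
    rw [Matrix.vecMul_vecMul, Matrix.vecMul_vecMul, eq_neg_of_add_eq_zero_left hΦ.mul_D,
      Matrix.vecMul_neg]
  have hmk (w : ι → Two k B B) : multiply i (rowDot (w ᵥ* Φ) fun t => of (envMap i) (X.p t)) = 0 := by
    rw [X.rowDot_vecMul_form hj hΦ, map_neg, neg_eq_zero]
    induction rowDot w (fun t => of (envMap i) (X.q t)) using BaseChange.induction with
    | h0 => simp
    | hof s u =>
      rw [koszul_smul_of, difference_apply, ← mul_smul, multiply_smul_of, map_one i, mul_smul,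
        sub_smul]
      simp
    | hadd x y hx hy => rw [map_add, map_add, hx, hy, add_zero]
  -- The row `v - w' Φ` is a cycle, but its class is only known to be killed by multiplication; it
  -- is a Koszul image, to be removed by a closed `w''` representing `z`. The plus sign in front of
  -- `w'' Φ` below reflects that `Φ` covers minus the Koszul map.
  obtain ⟨z, hz⟩ := hker (rowDot (v - w' ᵥ* Φ) fun t => of (envMap i) (X.p t)) (by
    rw [rowDot_sub, map_sub, hmk, multiply_rowDot, hvp, sub_zero])
  obtain ⟨w'', h1, h2, h3⟩ := X.exists_rowDot_eq z
  obtain ⟨v', hv'⟩ : ∃ v', v' ᵥ* X.D.map (envMap i) = v - w' ᵥ* Φ + w'' ᵥ* Φ := by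
    refine hf.exact X.exact _ ?_ ?_ ?_
    · rw [Matrix.add_vecMul, Matrix.sub_vecMul, hΦE, hΦE, hv]
    · rw [Matrix.add_vecMul, Matrix.sub_vecMul, hΦD, hΦD, h2, hw', Matrix.zero_vecMul, neg_zero,
        add_zero, sub_neg_eq_add, hvw]
    · rw [rowDot_add, X.rowDot_vecMul_form hj hΦ w'', h3, hz, add_neg_cancel]
  refine ⟨v', w' - w'', ?_, ?_⟩
  · rw [hv', Matrix.sub_vecMul]
    abel
  · rw [Matrix.sub_vecMul, hw', h2, sub_zero]

/-- The mapping cone of the form `Φ`. -/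
def cone (hr : RightProj i) (hl : LeftProj i) (hΦ : X.IsForm i j Φ c)
    (hinj : Function.Injective (koszul hj))
    (hker : ∀ z, multiply i z = 0 → ∃ y, koszul hj y = z) : ResData k B (ι ⊕ ι) where
  -- The dual vector of `s` has degree `d - deg s` in the dual complex, raised by one in the cone.
  -- The subtraction is not truncated because degrees are at most `d`.
  deg := Sum.elim X.deg fun s => d + 1 - X.deg s
  E := Matrix.fromBlocks (X.E.map (envMap i)) 0 0 (X.E.map (envMap i))ᴴ
  D := Matrix.fromBlocks (X.D.map (envMap i)) 0 Φ (X.D.map (envMap i))ᴴ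
  p := Sum.elim (fun s => i (X.p s)) 0
  p₀ := Sum.elim (fun s => envMap i (X.p₀ s)) 0
  E_E := by
    rw [Matrix.fromBlocks_multiply]
    simp [← Matrix.conjTranspose_mul, ← Matrix.map_mul, X.E_E]
  E_D := by
    rw [Matrix.fromBlocks_multiply]
    simp [← Matrix.conjTranspose_mul, ← Matrix.map_mul, X.E_D, X.D_E, hΦ.E_mul]
  D_E := by
    rw [Matrix.fromBlocks_multiply]
    simp [← Matrix.conjTranspose_mul, ← Matrix.map_mul, X.E_D, X.D_E, hΦ.mul_E]
  D_D := by
    rw [Matrix.fromBlocks_multiply]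
    simp [← Matrix.conjTranspose_mul, ← Matrix.map_mul, X.D_D, hΦ.mul_D, Matrix.map_zero]
  E_deg := by
    rintro (s | s) (t | t) h
    · simp [X.E_deg s t h]
    · rfl
    · rfl
    · simp only [Sum.elim_inr] at h
      simp [X.E_deg t s (by omega)]
  D_deg := by
    rintro (s | s) (t | t) h
    · simp [X.D_deg s t h]
    · rfl
    · have := X.deg_le s
      simp only [Sum.elim_inr, Sum.elim_inl] at h
      exact hΦ.deg s t (by omega)
    · have := X.deg_le s
      have := X.deg_le t
      simp only [Sum.elim_inr] at h
      simp [X.D_deg t s (by omega)]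
  p_deg := by
    rintro (s | s) h
    · simp [X.p_deg s h]
    · rfl
  E_p := by
    rintro (s | s)
    · rw [rowDot, Fintype.sum_sum_type]
      simp only [Matrix.fromBlocks_apply₁₁, Sum.elim_inr, Pi.zero_apply, smul_zero,
        Finset.sum_const_zero, add_zero, Sum.elim_inl]
      exact (rowDot_envMap i _ _).trans (congrArg i (X.E_p s))
    · rw [rowDot, Fintype.sum_sum_type]
      simp
  D_p := by
    rintro (s | s)
    · rw [rowDot, Fintype.sum_sum_type]
      simp only [Matrix.fromBlocks_apply₁₁, Sum.elim_inr, Pi.zero_apply, smul_zero,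
        Finset.sum_const_zero, add_zero, Sum.elim_inl]
      exact (rowDot_envMap i _ _).trans ((congrArg i (X.D_p s)).trans (map_zero i))
    · rw [rowDot, Fintype.sum_sum_type]
      simp only [Matrix.fromBlocks_apply₂₁, Sum.elim_inr, Pi.zero_apply, smul_zero,
        Finset.sum_const_zero, add_zero, Sum.elim_inl]
      refine (X.multiply_rowDot (Φ s)).symm.trans ?_
      rw [hΦ.dot, difference_apply, map_neg, multiply_smul_of, map_one i, sub_smul]
      simp
  p₀_deg := by
    rintro (s | s) h
    · simp [X.p₀_deg s h]
    · rfl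
  p₀_E := by
    rw [Matrix.vecMul_fromBlocks]
    have : (fun s => envMap i (X.p₀ s)) ᵥ* X.E.map (envMap i) = fun s => envMap i (X.p₀ s) := by
      conv_rhs => rw [← X.p₀_E]
      funext t
      simp [Matrix.vecMul, dotProduct]
    simp [this]
  p₀_p := by
    rw [rowDot, Fintype.sum_sum_type]
    simp only [Sum.elim_inr, Pi.zero_apply, smul_zero, Finset.sum_const_zero, add_zero,
      Sum.elim_inl]
    exact (rowDot_envMap i _ _).trans ((congrArg i X.p₀_p).trans (map_one i))
  exact := by
    intro v hE hD hp
    rw [Matrix.vecMul_fromBlocks] at hE hD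
    rw [rowDot, Fintype.sum_sum_type] at hp
    simp only [Sum.elim_inr, Pi.zero_apply, smul_zero, Finset.sum_const_zero, add_zero,
      Sum.elim_inl] at hp
    have hE1 := congrArg (· ∘ Sum.inl) hE
    have hE2 := congrArg (· ∘ Sum.inr) hE
    have hD1 := congrArg (· ∘ Sum.inl) hD
    have hD2 := congrArg (· ∘ Sum.inr) hD
    simp only [Sum.elim_comp_inl, Sum.elim_comp_inr, Matrix.vecMul_zero, add_zero, zero_add]
      at hE1 hE2 hD1 hD2
    obtain ⟨v', w', h1, h2⟩ := X.total_exact hj hr hl hΦ hinj hker _ _ hE1 hE2 hD1 hD2 hp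
    refine ⟨Sum.elim v' w', ?_⟩
    rw [Matrix.vecMul_fromBlocks, Sum.elim_comp_inl, Sum.elim_comp_inr, h1, h2]
    simp

/-- The conjugate transpose exchanges the two diagonal blocks, and the off-diagonal block becomes
the adjoint `-c Φ` of `Φ`; the sign `-c` on the second summand absorbs the factor. -/
theorem cone_isSelfDual (hr : RightProj i) (hl : LeftProj i) (hΦ : X.IsForm i j Φ c)
    (hinj : Function.Injective (koszul hj))
    (hker : ∀ z, multiply i z = 0 → ∃ y, koszul hj y = z) :
    (X.cone hj hr hl hΦ hinj hker).IsSelfDual (d + 1) (Equiv.sumComm ι ι)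
      (Sum.elim (fun _ => 1) fun _ => -c) where
  deg_add := by
    rintro (s | s)
    · have := X.deg_le s
      change X.deg s + (d + 1 - X.deg s) = d + 1
      omega
    · have := X.deg_le s
      change d + 1 - X.deg s + X.deg s = d + 1
      omega
  ε_mul := by
    rintro (s | s)
    · rfl
    · change -c * -c = 1
      rw [neg_mul_neg, hΦ.sq]
  star_E := by
    rintro (s | s) (t | t)
    · simp [cone]
    · simp [cone]
    · simp [cone]
    · simp [cone, hΦ.sq]
  star_D := by
    rintro (s | s) (t | t)
    · simp [cone]
    · have := congrFun (congrFun hΦ.adjoint s) t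
      rw [Matrix.conjTranspose_apply] at this
      simp [cone, this]
    · simp [cone]
    · simp [cone, hΦ.sq]

end Extend

end DualityData

/-- The tensor algebra of `A` along its dualizing bimodule has a self-dual resolution. -/
theorem DualityData.exists_selfDual {k : Type u} [CommRing k] {A : Type v} [Ring A] [Algebra k A]
    [Module.Projective k A] {U : Bimod k A} (hU : U.IsInvertible) {d : ℕ} {ι : Type} [Fintype ι]
    (X : DualityData U d ι) : ∃ (Y : ResData k (TensorAlg U) (ι ⊕ ι)) (σ : _) (ε : _),
      Y.IsSelfDual (d + 1) σ ε := by
  have := hU.projective.1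
  have := hU.projective.2
  obtain ⟨Φ, c, hΦ⟩ := X.exists_form (TensorAlg.base U) TensorAlg.leftProj_base
    TensorAlg.gen_two_smul
  exact ⟨X.cone TensorAlg.gen_two_smul TensorAlg.rightProj_base TensorAlg.leftProj_base hΦ
    TensorAlg.koszul_injective TensorAlg.exists_koszul_eq, _, _, X.cone_isSelfDual ..⟩

/-- A projective resolution of a module from an exact complex of modules. -/
def resolutionOfExact {R : Type v} [Ring R] {M : ModuleCat.{v} R}
    (K : ChainComplex (ModuleCat.{v} R) ℕ) (hK : ∀ n, Projective (K.X n)) (π : K.X 0 ⟶ M)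
    (h : ∀ x, π.hom ((K.d 1 0).hom x) = 0) (hπ : Function.Surjective π.hom)
    (h0 : ∀ x, π.hom x = 0 → ∃ y, (K.d 1 0).hom y = x)
    (hn : ∀ n x, (K.d (n + 1) n).hom x = 0 → ∃ y, (K.d (n + 2) (n + 1)).hom y = x) :
    ProjectiveResolution M where
  complex := K
  projective := hK
  π := (ChainComplex.toSingle₀Equiv K M).symm ⟨π, ModuleCat.hom_ext (LinearMap.ext h)⟩
  quasiIso := ⟨fun n => by
    cases n with
    | zero =>
      rw [ChainComplex.quasiIsoAt₀_iff, ShortComplex.quasiIso_iff_of_zeros' _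
        (K.shape 0 0 (by simp)) rfl rfl]
      have hf : ((ChainComplex.toSingle₀Equiv K M).symm
          ⟨π, ModuleCat.hom_ext (LinearMap.ext h)⟩).f 0 = π := by
        simp [ChainComplex.toSingle₀Equiv]
      constructor
      · rw [ShortComplex.moduleCat_exact_iff]
        intro x hx
        refine h0 x ?_
        rw [← hf]
        exact hx
      · rw [ModuleCat.epi_iff_surjective]
        have : Function.Surjective ((((ChainComplex.toSingle₀Equiv K M).symm
          ⟨π, ModuleCat.hom_ext (LinearMap.ext h)⟩).f 0)).hom := by rw [hf]; exact hπ
        exact this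
    | succ n =>
      rw [quasiIsoAt_iff_exactAt' (hL := ChainComplex.exactAt_succ_single_obj ..),
        HomologicalComplex.exactAt_iff' _ (n + 2) (n + 1) n (by simp) (by simp),
        ShortComplex.moduleCat_exact_iff]
      intro x hx
      exact hn n x hx⟩

namespace ResData

variable {k : Type u} [CommRing k] {B : Type v} [Ring B] [Algebra k B]
  {ι : Type} [Fintype ι] (X : ResData k B ι)

/-! ### The projective resolution given by matrices -/

/-- The part of degree `n` of a row vector. -/
def restr (n : ℕ) (v : ι → Two k B B) (t : ι) : Two k B B := if X.deg t = n then v t else 0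

theorem restr_of_eq {n : ℕ} (v : ι → Two k B B) {t : ι} (h : X.deg t = n) :
    X.restr n v t = v t := if_pos h

theorem restr_of_ne {n : ℕ} (v : ι → Two k B B) {t : ι} (h : X.deg t ≠ n) :
    X.restr n v t = 0 := if_neg h

theorem restr_add (n : ℕ) (v w : ι → Two k B B) :
    X.restr n (v + w) = X.restr n v + X.restr n w := by
  funext t
  by_cases h : X.deg t = n
  · simp [restr_of_eq, h]
  · simp [restr_of_ne, h]

theorem restr_smul (n : ℕ) (c : Two k B B) (v : ι → Two k B B) :
    X.restr n (c • v) = c • X.restr n v := by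
  funext t
  by_cases h : X.deg t = n
  · simp [restr_of_eq, h]
  · simp [restr_of_ne, h]

theorem restr_vecMul_E (n : ℕ) (v : ι → Two k B B) : X.restr n v ᵥ* X.E = X.restr n (v ᵥ* X.E) := by
  funext t
  by_cases h : X.deg t = n
  · rw [X.restr_of_eq _ h]
    refine Finset.sum_congr rfl fun s _ => ?_
    change X.restr n v s * X.E s t = v s * X.E s t
    by_cases hs : X.deg s = n
    · rw [X.restr_of_eq v hs]
    · rw [X.E_deg s t (by omega), mul_zero, mul_zero]
  · rw [X.restr_of_ne _ h]
    refine Finset.sum_eq_zero fun s _ => ?_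
    change X.restr n v s * X.E s t = 0
    by_cases hs : X.deg s = n
    · rw [X.E_deg s t (by omega), mul_zero]
    · rw [X.restr_of_ne v hs, zero_mul]

theorem restr_vecMul_D (n : ℕ) (v : ι → Two k B B) :
    X.restr (n + 1) v ᵥ* X.D = X.restr n (v ᵥ* X.D) := by
  funext t
  by_cases h : X.deg t = n
  · rw [X.restr_of_eq _ h]
    refine Finset.sum_congr rfl fun s _ => ?_
    change X.restr (n + 1) v s * X.D s t = v s * X.D s t
    by_cases hs : X.deg s = n + 1
    · rw [X.restr_of_eq v hs]
    · rw [X.D_deg s t (by omega), mul_zero, mul_zero]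
  · rw [X.restr_of_ne _ h]
    refine Finset.sum_eq_zero fun s _ => ?_
    change X.restr (n + 1) v s * X.D s t = 0
    by_cases hs : X.deg s = n + 1
    · rw [X.D_deg s t (by omega), mul_zero]
    · rw [X.restr_of_ne v hs, zero_mul]

/-- The term of degree `n` of the resolution. -/
def term (n : ℕ) : Submodule (Two k B B) (ι → Two k B B) where
  carrier := {v | v ᵥ* X.E = v ∧ X.restr n v = v}
  add_mem' {v w} hv hw := ⟨by rw [Matrix.add_vecMul, hv.1, hw.1], by rw [restr_add, hv.2, hw.2]⟩
  zero_mem' := ⟨Matrix.zero_vecMul _, by funext t; simp [restr]⟩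
  smul_mem' c v hv := ⟨by rw [Matrix.smul_vecMul, hv.1], by rw [restr_smul, hv.2]⟩

theorem restr_restr (n : ℕ) (v : ι → Two k B B) : X.restr n (X.restr n v) = X.restr n v := by
  funext t
  simp only [restr]
  split_ifs <;> rfl

theorem restr_vecMul_E_mem (n : ℕ) (v : ι → Two k B B) : X.restr n v ᵥ* X.E ∈ X.term n :=
  ⟨by rw [Matrix.vecMul_vecMul, X.E_E], by rw [restr_vecMul_E, restr_restr]⟩

/-- The projection of all row vectors onto a term of the resolution. -/
def proj (n : ℕ) : (ι → Two k B B) →ₗ[Two k B B] X.term n where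
  toFun v := ⟨X.restr n v ᵥ* X.E, X.restr_vecMul_E_mem n v⟩
  map_add' v w := Subtype.ext ((congrArg (· ᵥ* X.E) (X.restr_add n v w)).trans
    (Matrix.add_vecMul _ _ _))
  map_smul' c v := Subtype.ext ((congrArg (· ᵥ* X.E) (X.restr_smul n c v)).trans
    (Matrix.smul_vecMul _ _ _))

theorem proj_apply (n : ℕ) (v : ι → Two k B B) :
    (X.proj n v : ι → Two k B B) = X.restr n v ᵥ* X.E := rfl

theorem proj_coe {n : ℕ} (v : X.term n) : X.proj n v = v :=
  Subtype.ext (by rw [proj_apply, v.2.2, v.2.1])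

instance (n : ℕ) : Module.Projective (Two k B B) (X.term n) :=
  Module.Projective.of_split (X.term n).subtype (X.proj n) (LinearMap.ext fun v => X.proj_coe v)

instance (n : ℕ) : Module.Finite (Two k B B) (X.term n) :=
  Module.Finite.of_surjective (X.proj n) fun v => ⟨v, X.proj_coe v⟩

theorem vecMul_D_mem {n : ℕ} {v : ι → Two k B B} (hv : X.restr (n + 1) v = v) :
    v ᵥ* X.D ∈ X.term n :=
  ⟨by rw [Matrix.vecMul_vecMul, X.D_E], by rw [← restr_vecMul_D, hv]⟩

/-- The differential of the resolution. -/
def diff (n : ℕ) : X.term (n + 1) →ₗ[Two k B B] X.term n :=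
  (X.D.vecMulLinear ∘ₗ (X.term (n + 1)).subtype).codRestrict _ fun v => X.vecMul_D_mem v.2.2

theorem diff_apply (n : ℕ) (v : X.term (n + 1)) :
    (X.diff n v : ι → Two k B B) = (v : ι → Two k B B) ᵥ* X.D := rfl

theorem diff_diff (n : ℕ) (v : X.term (n + 2)) : X.diff n (X.diff (n + 1) v) = 0 :=
  Subtype.ext (by rw [diff_apply, diff_apply, Matrix.vecMul_vecMul, X.D_D, Matrix.vecMul_zero]; rfl)

theorem rowDot_restr_p {n : ℕ} (hn : n ≠ 0) (v : ι → Two k B B) :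
    rowDot (X.restr n v) X.p = 0 := by
  refine Finset.sum_eq_zero fun t _ => ?_
  by_cases ht : X.deg t = n
  · rw [X.p_deg t (by omega), smul_zero]
  · rw [X.restr_of_ne v ht, zero_smul]

/-- The total complex is graded, so a primitive of a homogeneous cycle may be replaced by its
component of the right degree. The augmentation is a condition in degree zero only. -/
theorem exact_restr {n : ℕ} {v : ι → Two k B B} (hE : v ∈ X.term n) (hD : v ᵥ* X.D = 0)
    (hp : n = 0 → rowDot v X.p = 0) : ∃ w, X.diff n w = v := by
  obtain ⟨w, hw⟩ := X.exact v hE.1 hD (by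
    by_cases hn : n = 0
    · exact hp hn
    · rw [← hE.2, rowDot_restr_p X hn])
  refine ⟨X.proj (n + 1) w, ?_⟩
  rw [diff_apply, proj_apply, Matrix.vecMul_vecMul, X.E_D, restr_vecMul_D, hw, hE.2]

/-- The augmentation of the resolution. -/
def augment : X.term 0 →ₗ[Two k B B] B where
  toFun v := rowDot (v : ι → Two k B B) X.p
  map_add' _ _ := rowDot_add _ _ _
  map_smul' _ _ := rowDot_smul _ _ _

theorem augment_diff (v : X.term 1) : X.augment (X.diff 0 v) = 0 := by
  change rowDot ((v : ι → Two k B B) ᵥ* X.D) X.p = 0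
  rw [rowDot_vecMul]
  refine Finset.sum_eq_zero fun s _ => ?_
  exact (congrArg (v.1 s • ·) (X.D_p s)).trans (smul_zero _)

theorem vecMul_D_eq_zero {v : ι → Two k B B} (hv : X.restr 0 v = v) : v ᵥ* X.D = 0 := by
  rw [← hv]
  funext t
  refine Finset.sum_eq_zero fun s _ => ?_
  change X.restr 0 v s * X.D s t = 0
  by_cases hs : X.deg s = 0
  · rw [X.D_deg s t (by omega), mul_zero]
  · rw [X.restr_of_ne v hs, zero_mul]

theorem smul_p₀_mem (c : Two k B B) : c • X.p₀ ∈ X.term 0 := by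
  refine Submodule.smul_mem _ _ ⟨X.p₀_E, ?_⟩
  funext t
  by_cases ht : X.deg t = 0
  · rw [X.restr_of_eq _ ht]
  · rw [X.restr_of_ne _ ht, X.p₀_deg t ht]

theorem rowDot_smul_p₀ (b : B) : rowDot ((Two.tm b 1 : Two k B B) • X.p₀) X.p = b := by
  rw [rowDot_smul, X.p₀_p]
  simp

/-- The chain complex of the resolution. -/
def chain : ChainComplex (ModuleCat.{v} (Two k B B)) ℕ :=
  ChainComplex.of (fun n => ModuleCat.of (Two k B B) (X.term n))
    (fun n => ModuleCat.ofHom (X.diff n)) fun n =>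
      ModuleCat.hom_ext (LinearMap.ext fun v => X.diff_diff n v)

theorem chain_d (n : ℕ) : X.chain.d (n + 1) n = ModuleCat.ofHom (X.diff n) :=
  ChainComplex.of_d (fun n => ModuleCat.of (Two k B B) (X.term n))
    (fun n => ModuleCat.ofHom (X.diff n)) n

theorem chain_d_apply (n : ℕ) (v : X.term (n + 1)) : (X.chain.d (n + 1) n).hom v = X.diff n v := by
  rw [chain_d]
  rfl

/-- The projective resolution given by the matrices. -/
def resolution : ProjectiveResolution (ModuleCat.of (Two k B B) B) :=
  resolutionOfExact X.chain
    (fun n => (ModuleCat.of (Two k B B) (X.term n)).projective_of_categoryTheory_projective)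
    (ModuleCat.ofHom X.augment)
    (fun v => (congrArg X.augment (X.chain_d_apply 0 v)).trans (X.augment_diff v))
    (fun b => ⟨⟨_, X.smul_p₀_mem (Two.tm b 1)⟩, X.rowDot_smul_p₀ b⟩)
    (fun v hv => by
      obtain ⟨w, hw⟩ := X.exact_restr v.2 (X.vecMul_D_eq_zero v.2.2) fun _ => hv
      exact ⟨w, (X.chain_d_apply 0 w).trans (Subtype.ext hw)⟩)
    (fun n v hv => by
      have hv' : X.diff n v = 0 := (X.chain_d_apply n v).symm.trans hv
      obtain ⟨w, hw⟩ := X.exact_restr v.2 (congrArg Subtype.val hv') fun h => by omega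
      exact ⟨w, (X.chain_d_apply (n + 1) w).trans (Subtype.ext hw)⟩)

end ResData

namespace ResData

variable {k : Type u} [CommRing k] {B : Type v} [Ring B] [Algebra k B]
  {ι : Type} [Fintype ι] (X : ResData k B ι)

/-! ### Functionals on the resolution -/

/-- The functional `v ↦ v c` given by a column vector. -/
def functional (n : ℕ) (c : ι → Two k B B) : X.term n →ₗ[Two k B B] Two k B B where
  toFun v := (v : ι → Two k B B) ⬝ᵥ c
  map_add' _ _ := add_dotProduct _ _ _
  map_smul' _ _ := smul_dotProduct _ _ _

theorem functional_apply (n : ℕ) (c : ι → Two k B B) (v : X.term n) :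
    X.functional n c v = (v : ι → Two k B B) ⬝ᵥ c := rfl

theorem functional_comp_diff (n : ℕ) (c : ι → Two k B B) :
    X.functional n c ∘ₗ X.diff n = X.functional (n + 1) (X.D *ᵥ c) :=
  LinearMap.ext fun _ => (Matrix.dotProduct_mulVec _ _ _).symm

/-- The column vector of a functional. -/
def column [DecidableEq ι] {n : ℕ} (f : X.term n →ₗ[Two k B B] Two k B B) (t : ι) : Two k B B :=
  f (X.proj n (Pi.single t 1))

section

variable [DecidableEq ι] {n : ℕ}

theorem dotProduct_column (f : X.term n →ₗ[Two k B B] Two k B B) (v : ι → Two k B B) :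
    v ⬝ᵥ X.column f = f (X.proj n v) := by
  conv_rhs => rw [← Finset.univ_sum_single v]
  rw [map_sum, map_sum]
  refine Finset.sum_congr rfl fun t _ => ?_
  have : (Pi.single t (v t) : ι → Two k B B) = v t • Pi.single t 1 := by
    rw [← Pi.single_smul, smul_eq_mul, mul_one]
  rw [this, map_smul, map_smul]
  rfl

theorem functional_column (f : X.term n →ₗ[Two k B B] Two k B B) :
    X.functional n (X.column f) = f :=
  LinearMap.ext fun v => by rw [functional_apply, dotProduct_column, proj_coe]

theorem proj_eq_zero {v : ι → Two k B B} (h : ∀ t, X.deg t = n → v t = 0) : X.proj n v = 0 := by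
  have : X.restr n v = 0 := by
    funext t
    by_cases ht : X.deg t = n
    · rw [X.restr_of_eq v ht, h t ht]; rfl
    · exact X.restr_of_ne v ht
  exact Subtype.ext (by rw [proj_apply, this, Matrix.zero_vecMul]; rfl)

theorem column_of_ne (f : X.term n →ₗ[Two k B B] Two k B B) {t : ι} (h : X.deg t ≠ n) :
    X.column f t = 0 := by
  rw [column, proj_eq_zero, map_zero]
  intro s hs
  exact Pi.single_eq_of_ne (by rintro rfl; exact h hs) _

theorem proj_E (n : ℕ) (v : ι → Two k B B) : X.proj n (v ᵥ* X.E) = X.proj n v :=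
  Subtype.ext (by rw [proj_apply, proj_apply, ← restr_vecMul_E, Matrix.vecMul_vecMul, X.E_E])

theorem proj_D (n : ℕ) (v : ι → Two k B B) : X.proj n (v ᵥ* X.D) = X.diff n (X.proj (n + 1) v) :=
  Subtype.ext (by
    rw [proj_apply, diff_apply, proj_apply, ← restr_vecMul_D, Matrix.vecMul_vecMul,
      Matrix.vecMul_vecMul, X.D_E, X.E_D])

theorem dotProduct_ext {c c' : ι → Two k B B} (h : ∀ v : ι → Two k B B, v ⬝ᵥ c = v ⬝ᵥ c') :
    c = c' := by
  funext t
  have := h (Pi.single t 1)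
  rwa [single_one_dotProduct, single_one_dotProduct] at this

theorem E_column (f : X.term n →ₗ[Two k B B] Two k B B) : X.E *ᵥ X.column f = X.column f :=
  dotProduct_ext fun v => by
    rw [Matrix.dotProduct_mulVec, dotProduct_column, dotProduct_column, proj_E]

theorem D_column (f : X.term n →ₗ[Two k B B] Two k B B) :
    X.D *ᵥ X.column f = X.column (f ∘ₗ X.diff n) :=
  dotProduct_ext fun v => by
    rw [Matrix.dotProduct_mulVec, dotProduct_column, dotProduct_column, proj_D]
    rfl

theorem column_functional {c : ι → Two k B B} (hE : X.E *ᵥ c = c)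
    (hc : ∀ t, X.deg t ≠ n → c t = 0) : X.column (X.functional n c) = c :=
  dotProduct_ext fun v => by
    rw [dotProduct_column, functional_apply, proj_apply, ← Matrix.dotProduct_mulVec, hE]
    refine Finset.sum_congr rfl fun t _ => ?_
    by_cases ht : X.deg t = n
    · rw [X.restr_of_eq v ht]
    · rw [hc t ht, mul_zero, mul_zero]

theorem column_add (f g : X.term n →ₗ[Two k B B] Two k B B) :
    X.column (f + g) = X.column f + X.column g := rfl

end

/-! ### Self-duality and vanishing of `Ext` -/

namespace IsSelfDual

variable {X} {n : ℕ} {σ : ι ≃ ι} {ε : ι → ℤ} (h : X.IsSelfDual n σ ε)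

variable (σ ε) in
/-- The row vector dual to a column vector. -/
def dual (c : ι → Two k B B) (s : ι) : Two k B B := ε (σ.symm s) • star (c (σ.symm s))

theorem dual_apply (c : ι → Two k B B) (t : ι) : dual σ ε c (σ t) = ε t • star (c t) := by
  rw [dual, σ.symm_apply_apply]

theorem dual_add (c c' : ι → Two k B B) : dual σ ε (c + c') = dual σ ε c + dual σ ε c' := by
  funext s
  simp [dual]

/-- Right multiplication on cochains, which defines the inner bimodule structure on `Ext`, becomes
the left action through the flip. This is how the inner structure turns into the ordinary one on
`B`. -/
theorem dual_mul (c : ι → Two k B B) (r : Two k B B) :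
    dual σ ε (fun t => c t * r) = star r • dual σ ε c := by
  funext s
  simp only [dual, star_mul, Pi.smul_apply, smul_eq_mul, mul_smul_comm]

theorem zsmul_zsmul_cancel {a : ℤ} (ha : a * a = 1) (x : Two k B B) : a • a • x = x := by
  rw [← mul_smul, ha, one_smul]

theorem star_zsmul' (a : ℤ) (x : Two k B B) : star (a • x) = a • star x := by
  rw [star_smul, star_trivial]

include h in
theorem exists_dual (y : ι → Two k B B) : ∃ c, dual σ ε c = y := by
  refine ⟨fun t => ε t • star (y (σ t)), ?_⟩
  funext s
  obtain ⟨t, rfl⟩ := σ.surjective s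
  rw [dual_apply, star_zsmul', star_star, zsmul_zsmul_cancel (h.ε_mul t)]

include h in
theorem dual_injective {c c' : ι → Two k B B} (hc : dual σ ε c = dual σ ε c') : c = c' := by
  funext t
  have := congrFun hc (σ t)
  rw [dual_apply, dual_apply] at this
  have := congrArg (fun x => star (ε t • x)) this
  simpa only [zsmul_zsmul_cancel (h.ε_mul t), star_star] using this

include h in
-- Self-duality of a matrix is exactly what is needed for its action on columns (cochains) to become
-- its action on rows (chains).
theorem dual_vecMul {M : Matrix ι ι (Two k B B)}
    (hM : ∀ s t, star (M t s) = (ε s * ε t) • M (σ s) (σ t)) (c : ι → Two k B B) :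
    dual σ ε c ᵥ* M = dual σ ε (M *ᵥ c) := by
  funext s
  obtain ⟨s, rfl⟩ := σ.surjective s
  rw [dual_apply]
  change ∑ t, dual σ ε c t * M t (σ s) = ε s • star (∑ t, M s t * c t)
  rw [← σ.sum_comp, star_sum, Finset.smul_sum]
  refine Finset.sum_congr rfl fun t _ => ?_
  rw [dual_apply, star_mul, hM, mul_smul_comm, ← mul_smul, smul_mul_assoc, mul_comm (ε t),
    ← mul_assoc, h.ε_mul, one_mul]

include h in
theorem dual_E (c : ι → Two k B B) : dual σ ε c ᵥ* X.E = dual σ ε (X.E *ᵥ c) :=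
  h.dual_vecMul h.star_E c

include h in
theorem dual_D (c : ι → Two k B B) : dual σ ε c ᵥ* X.D = dual σ ε (X.D *ᵥ c) :=
  h.dual_vecMul h.star_D c

include h in
theorem restr_dual {m l : ℕ} (hml : m + l = n) {c : ι → Two k B B}
    (hc : ∀ t, X.deg t ≠ m → c t = 0) : X.restr l (dual σ ε c) = dual σ ε c := by
  funext s
  obtain ⟨t, rfl⟩ := σ.surjective s
  have := h.deg_add t
  by_cases ht : X.deg t = m
  · exact X.restr_of_eq _ (by omega)
  · rw [X.restr_of_ne _ (by omega), dual_apply, hc t ht, star_zero, smul_zero]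

include h in
theorem deg_le (t : ι) : X.deg t ≤ n := by
  have := h.deg_add t
  omega

theorem dual_zero : dual σ ε (0 : ι → Two k B B) = 0 := by
  funext s
  simp [dual]

variable [DecidableEq ι]

include h in
theorem dual_column_mem {m l : ℕ} (hml : m + l = n) (f : X.term m →ₗ[Two k B B] Two k B B) :
    dual σ ε (X.column f) ∈ X.term l :=
  ⟨by rw [h.dual_E, X.E_column], h.restr_dual hml fun _ ht => X.column_of_ne f ht⟩

include h in
/-- Cocycles of degree different from `n` are coboundaries. -/
theorem exists_column_eq {m l : ℕ} (hml : m + l = n) (f : X.term m →ₗ[Two k B B] Two k B B)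
    (hf : f ∘ₗ X.diff m = 0) (hl : l = 0 → rowDot (dual σ ε (X.column f)) X.p = 0) :
    ∃ c, X.D *ᵥ c = X.column f ∧ (m = 0 → c = 0) := by
  obtain ⟨w, hw⟩ := X.exact_restr (h.dual_column_mem hml f) (by
    rw [h.dual_D, X.D_column, hf]
    exact (congrArg (dual σ ε) (funext fun t => rfl)).trans dual_zero) hl
  obtain ⟨c, hc⟩ := h.exists_dual w
  refine ⟨c, h.dual_injective ?_, fun hm => h.dual_injective ?_⟩
  · rw [← h.dual_D, hc, ← hw, diff_apply]
  -- For `m = 0` the primitive `w` has degree `l + 1 = n + 1`, beyond the length of the resolution,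
  -- so it is zero.
  · rw [hc, dual_zero, ← w.2.2]
    funext t
    exact X.restr_of_ne _ (by have := h.deg_le t; omega)

include h in
theorem eq_zero_of_lt {m : ℕ} (hm : n < m) (f : X.term m →ₗ[Two k B B] Two k B B) : f = 0 := by
  rw [← X.functional_column f]
  have : X.column f = 0 := funext fun t => X.column_of_ne f (by have := h.deg_le t; omega)
  rw [this]
  exact LinearMap.ext fun v => dotProduct_zero _

include h in
-- A cocycle of degree `m ≤ n` dualizes to a cycle of degree `n - m` in the resolution. For `m < n`
-- this is positive, so the cycle is a boundary; for `m > n` there are no cochains.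
theorem ext_eq_zero {m : ℕ} (hm : m ≠ n)
    (x : Abelian.Ext.{v} (ModuleCat.of (Two k B B) B) (ModuleCat.of (Two k B B) (Two k B B)) m) :
    x = 0 := by
  obtain ⟨f, hf, rfl⟩ := X.resolution.extMk_surjective x (m + 1) rfl
  let g : X.term m →ₗ[Two k B B] Two k B B := f.hom
  have hg : g ∘ₗ X.diff m = 0 := LinearMap.ext fun v =>
    (congrArg g (X.chain_d_apply m v)).symm.trans (LinearMap.congr_fun (congrArg ModuleCat.Hom.hom hf) v)
  have hfg : g = 0 → f = 0 := fun h => ModuleCat.hom_ext h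
  rcases lt_or_gt_of_ne hm with hlt | hgt
  · obtain ⟨c, hc, hc'⟩ := h.exists_column_eq (m := m) (l := n - m) (by omega) g hg
      fun h => by omega
    cases m with
    | zero =>
      have hf0 : f = 0 := hfg (by
        rw [← X.functional_column g, ← hc, hc' rfl, Matrix.mulVec_zero]
        exact LinearMap.ext fun v => dotProduct_zero _)
      subst hf0
      exact X.resolution.extMk_zero 1 rfl
    | succ m =>
      rw [X.resolution.extMk_eq_zero_iff f _ rfl hf m rfl]
      refine ⟨ModuleCat.ofHom (X.functional m c), ModuleCat.hom_ext (LinearMap.ext fun v => ?_)⟩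
      have h1 : X.functional m c (X.diff m v) = g v := by
        rw [← X.functional_column g, ← hc, ← functional_comp_diff]
        rfl
      exact (congrArg (X.functional m c) (X.chain_d_apply m v)).trans h1
  · have hf0 : f = 0 := hfg (h.eq_zero_of_lt hgt g)
    subst hf0
    exact X.resolution.extMk_zero _ rfl

end IsSelfDual

end ResData

/-- `Ext^n_{A^e}(A, A ⊗ A)`, for the enveloping algebra in the form `Two k A A`. -/
abbrev TwoExt (k : Type u) [CommRing k] (A : Type v) [Ring A] [Algebra k A] (n : ℕ) : Type v :=
  Abelian.Ext.{v} (ModuleCat.of (Two k A A) A) (ModuleCat.of (Two k A A) (Two k A A)) n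

section TwoExt

variable {k : Type u} [CommRing k] {A : Type v} [Ring A] [Algebra k A] {n : ℕ}

/-- The identification of the two forms of `Ext^n_{A^e}(A, A ⊗ A)`. -/
def extEnvEquiv : ExtEnv k A n ≃+ TwoExt k A n := AddEquiv.refl (ExtEnv k A n)

theorem extEnvEquiv_smul (a : A) (x : ExtEnv k A n) : extEnvEquiv (a • x) =
    (extEnvEquiv x).comp (Abelian.Ext.mk₀ (rightMul (Two.tm 1 a))) (add_zero _) := rfl

theorem extEnvEquiv_op_smul (a : Aᵐᵒᵖ) (x : ExtEnv k A n) : extEnvEquiv (a • x) =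
    (extEnvEquiv x).comp (Abelian.Ext.mk₀ (rightMul (Two.tm a.unop 1))) (add_zero _) := rfl

end TwoExt

/-! ### The top `Ext` as a bimodule -/

namespace ResData

namespace IsSelfDual

variable {k : Type u} [CommRing k] {B : Type v} [Ring B] [Algebra k B]
  {ι : Type} [Fintype ι] {X : ResData k B ι} {n : ℕ} {σ : ι ≃ ι} {ε : ι → ℤ}
  (h : X.IsSelfDual (n + 1) σ ε)

/-- The class of a functional on the top term of the resolution. -/
def toExt (g : X.term (n + 1) →ₗ[Two k B B] Two k B B) : TwoExt k B (n + 1) :=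
  X.resolution.extMk (ModuleCat.ofHom g) (n + 2) rfl (ModuleCat.hom_ext (by
    classical exact h.eq_zero_of_lt (Nat.lt_succ_self _) _))

theorem toExt_add (g g' : X.term (n + 1) →ₗ[Two k B B] Two k B B) :
    h.toExt (g + g') = h.toExt g + h.toExt g' :=
  (X.resolution.add_extMk _ _ _ rfl _ _).symm

theorem exists_toExt (x : TwoExt k B (n + 1)) : ∃ g, h.toExt g = x := by
  obtain ⟨f, hf, rfl⟩ := X.resolution.extMk_surjective x (n + 2) rfl
  exact ⟨f.hom, rfl⟩

theorem comp_toExt (g : X.term (n + 1) →ₗ[Two k B B] Two k B B) (r : Two k B B) :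
    (h.toExt g).comp (Abelian.Ext.mk₀ (rightMul r)) (add_zero _) = h.toExt (LinearMap.toSpanSingleton _ _ r ∘ₗ g) :=
  X.resolution.extMk_comp_mk₀ _ _ rfl _ _

theorem toExt_eq_zero_iff (g : X.term (n + 1) →ₗ[Two k B B] Two k B B) :
    h.toExt g = 0 ↔ ∃ g' : X.term n →ₗ[Two k B B] Two k B B, g' ∘ₗ X.diff n = g := by
  refine (X.resolution.extMk_eq_zero_iff _ _ rfl _ n rfl).trans ⟨?_, ?_⟩
  · rintro ⟨f, hf⟩
    refine ⟨f.hom, LinearMap.ext fun v => ?_⟩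
    have h1 := LinearMap.congr_fun (congrArg ModuleCat.Hom.hom hf) v
    have h2 : f.hom ((X.chain.d (n + 1) n).hom v) = f.hom (X.diff n v) :=
      congrArg f.hom (X.chain_d_apply n v)
    exact h2.symm.trans h1
  · rintro ⟨g', rfl⟩
    exact ⟨ModuleCat.ofHom g', ModuleCat.hom_ext (LinearMap.ext fun v =>
      congrArg g' (X.chain_d_apply n v))⟩

variable [DecidableEq ι]

variable (X σ ε) in
/-- The value at the augmentation of the row vector dual to a functional. -/
def value (g : X.term (n + 1) →ₗ[Two k B B] Two k B B) : B :=
  rowDot (dual σ ε (X.column g)) X.p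

theorem value_add (g g' : X.term (n + 1) →ₗ[Two k B B] Two k B B) :
    value X σ ε (g + g') = value X σ ε g + value X σ ε g' := by
  rw [value, X.column_add, dual_add, rowDot_add]
  rfl

theorem value_sub (g g' : X.term (n + 1) →ₗ[Two k B B] Two k B B) :
    value X σ ε (g - g') = value X σ ε g - value X σ ε g' := by
  rw [eq_sub_iff_add_eq, ← value_add, sub_add_cancel]

theorem value_mul (g : X.term (n + 1) →ₗ[Two k B B] Two k B B) (r : Two k B B) :
    value X σ ε (LinearMap.toSpanSingleton _ _ r ∘ₗ g) = star r • value X σ ε g := by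
  have : X.column (LinearMap.toSpanSingleton _ _ r ∘ₗ g) = fun t => X.column g t * r := rfl
  rw [value, this, dual_mul, rowDot_smul]
  rfl

include h in
-- The functional is the one whose dual row is `b` times the vector `p₀` of augmentation `1`.
theorem exists_value (b : B) : ∃ g, value (n := n) X σ ε g = b := by
  obtain ⟨c, hc⟩ := h.exists_dual ((Two.tm b 1 : Two k B B) • X.p₀)
  have hmem := X.smul_p₀_mem (Two.tm b 1)
  rw [← hc] at hmem
  have hE : X.E *ᵥ c = c := h.dual_injective (by rw [← h.dual_E, hmem.1])
  have hdeg (t : ι) (ht : X.deg t ≠ n + 1) : c t = 0 := by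
    have h1 := congrFun hmem.2 (σ t)
    have h2 := h.deg_add t
    rw [X.restr_of_ne _ (by omega), dual_apply] at h1
    rw [← star_star (c t), ← zsmul_zsmul_cancel (h.ε_mul t) (star (c t)), ← h1, smul_zero,
      star_zero]
  refine ⟨X.functional (n + 1) c, ?_⟩
  rw [value, X.column_functional hE hdeg, hc, X.rowDot_smul_p₀]

/-- Functionals of top degree dualize to degree zero of the resolution, coboundaries to boundaries,
and by exactness the boundaries there are the kernel of the augmentation. -/
theorem toExt_eq_zero_iff_value (g : X.term (n + 1) →ₗ[Two k B B] Two k B B) :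
    h.toExt g = 0 ↔ value X σ ε g = 0 := by
  rw [toExt_eq_zero_iff]
  constructor
  · rintro ⟨g', rfl⟩
    rw [value, ← X.D_column, ← h.dual_D, rowDot_vecMul]
    exact Finset.sum_eq_zero fun s _ => (congrArg _ (X.D_p s)).trans (smul_zero _)
  · intro hg
    obtain ⟨c, hc, -⟩ := h.exists_column_eq (l := 0) rfl g (h.eq_zero_of_lt (Nat.lt_succ_self _) _)
      fun _ => hg
    refine ⟨X.functional n c, ?_⟩
    rw [functional_comp_diff, hc, functional_column]

theorem toExt_eq_iff_value (g g' : X.term (n + 1) →ₗ[Two k B B] Two k B B) :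
    h.toExt g = h.toExt g' ↔ value X σ ε g = value X σ ε g' := by
  have h1 : h.toExt (g - g') = h.toExt g - h.toExt g' := by
    rw [eq_sub_iff_add_eq, ← toExt_add, sub_add_cancel]
  rw [← sub_eq_zero, ← h1, toExt_eq_zero_iff_value, value_sub, sub_eq_zero]

include h in
-- The augmentation of the dual row depends only on the class in `Ext` and gives the bijection onto
-- `B`; bilinearity is `value_mul`, the flip matching the inner action with the two multiplications
-- of `B`.
theorem extBimod_isIso : (extBimod k B (n + 1)).IsIso (Bimod.self k B) := by
  choose s hs using h.exists_toExt
  let e (x : TwoExt k B (n + 1)) : B := value X σ ε (s x)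
  have he (g) : e (h.toExt g) = value X σ ε g := (h.toExt_eq_iff_value _ _).1 (hs _)
  have he_op (r : Two k B B) (x : TwoExt k B (n + 1)) :
      e (x.comp (Abelian.Ext.mk₀ (rightMul r)) (add_zero _)) = star r • e x := by
    obtain ⟨g, rfl⟩ := h.exists_toExt x
    rw [comp_toExt, he, he, value_mul]
  have he_add (x y : TwoExt k B (n + 1)) : e (x + y) = e x + e y := by
    obtain ⟨g, rfl⟩ := h.exists_toExt x
    obtain ⟨g', rfl⟩ := h.exists_toExt y
    rw [← toExt_add, he, he, he, value_add]
  have he_bij : Function.Bijective e := by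
    refine ⟨fun x y hxy => ?_, fun b => ?_⟩
    · obtain ⟨g, rfl⟩ := h.exists_toExt x
      obtain ⟨g', rfl⟩ := h.exists_toExt y
      exact (h.toExt_eq_iff_value _ _).2 ((he g).symm.trans (hxy.trans (he g')))
    · obtain ⟨g, hg⟩ := h.exists_value b
      exact ⟨h.toExt g, (he g).trans hg⟩
  let e' : ExtEnv k B (n + 1) →ₗ[B] B :=
    { toFun := fun x => e (extEnvEquiv x)
      map_add' := fun x y => by rw [map_add, he_add]
      map_smul' := fun b x => by
        rw [extEnvEquiv_smul, he_op]
        simp }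
  refine ⟨LinearEquiv.ofBijective e' (he_bij.comp extEnvEquiv.bijective), fun b x => ?_⟩
  refine (he_op (Two.tm b.unop 1) (extEnvEquiv x)).trans ?_
  rw [Two.star_tm, Two.tm_smul_self, one_mul]
  rfl

include h in
theorem isCalabiYau : IsCalabiYau k B (n + 1) where
  smooth := by
    refine ⟨X.resolution, fun m => inferInstanceAs (Module.Finite (Two k B B) (X.term m)),
      n + 2, fun m hm => ?_⟩
    have : Subsingleton (X.term m) := ⟨fun v w => by
      have key (v : X.term m) : v = 0 := Subtype.ext (by
        rw [← v.2.2]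
        exact funext fun t => X.restr_of_ne _ (by have := h.deg_le t; omega))
      rw [key v, key w]⟩
    exact ModuleCat.isZero_of_subsingleton (ModuleCat.of (Two k B B) (X.term m))
  vanishing m hm := ⟨fun x y => extEnvEquiv.injective
    ((h.ext_eq_zero hm (extEnvEquiv x)).trans (h.ext_eq_zero hm (extEnvEquiv y)).symm)⟩
  dualizing := h.extBimod_isIso

end IsSelfDual

end ResData

/-! ### Consequences of vanishing of `Ext` for a projective resolution -/

section Resolution

variable {R : Type v} [Ring R] {M : ModuleCat.{v} R} (P : ProjectiveResolution M)

/-- The differentials of a resolution, as linear maps. -/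
abbrev bdry (n m : ℕ) : P.complex.X n →ₗ[R] P.complex.X m := (P.complex.d n m).hom

/-- The augmentation of a resolution, as a linear map. -/
def aug₀ : P.complex.X 0 →ₗ[R] M := (P.π.f 0).hom

theorem bdry_bdry (n m l : ℕ) (x : P.complex.X n) : bdry P m l (bdry P n m x) = 0 :=
  LinearMap.congr_fun (congrArg ModuleCat.Hom.hom (P.complex.d_comp_d n m l)) x

theorem bdry_eq_zero {n m : ℕ} (h : n ≠ m + 1) : bdry P n m = 0 :=
  congrArg ModuleCat.Hom.hom (P.complex.shape n m fun h' => h (by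
    simpa using h'.symm))

theorem bdry_exact (n : ℕ) (x : P.complex.X (n + 1)) (hx : bdry P (n + 1) n x = 0) :
    ∃ y, bdry P (n + 2) (n + 1) y = x :=
  (ShortComplex.moduleCat_exact_iff _).1 (P.exact_succ n) x hx

theorem aug₀_bdry (x : P.complex.X 1) : aug₀ P (bdry P 1 0 x) = 0 :=
  LinearMap.congr_fun (congrArg ModuleCat.Hom.hom P.complex_d_comp_π_f_zero) x

theorem aug₀_surjective : Function.Surjective (aug₀ P) :=
  (ModuleCat.epi_iff_surjective (P.π.f 0)).1 inferInstance

theorem aug₀_exact (x : P.complex.X 0) (hx : aug₀ P x = 0) : ∃ y, bdry P 1 0 y = x := by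
  have h : QuasiIsoAt P.π 0 := inferInstance
  rw [ChainComplex.quasiIsoAt₀_iff, ShortComplex.quasiIso_iff_of_zeros' _
    (P.complex.shape 0 0 (by simp)) rfl rfl] at h
  exact (ShortComplex.moduleCat_exact_iff _).1 h.1 x hx

/-- A functional on a term of the resolution which vanishes on boundaries defines a class in
`Ext`. -/
def extClass (n : ℕ) (f : P.complex.X n →ₗ[R] R) (hf : f ∘ₗ bdry P (n + 1) n = 0) :
    Abelian.Ext.{v} M (ModuleCat.of R R) n :=
  P.extMk (ModuleCat.ofHom f) (n + 1) rfl (ModuleCat.hom_ext hf)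

theorem exists_extClass {n : ℕ} (x : Abelian.Ext.{v} M (ModuleCat.of R R) n) :
    ∃ f hf, extClass P n f hf = x := by
  obtain ⟨f, hf, rfl⟩ := P.extMk_surjective x (n + 1) rfl
  exact ⟨f.hom, congrArg ModuleCat.Hom.hom hf, rfl⟩

theorem extClass_add {n : ℕ} (f g : P.complex.X n →ₗ[R] R) (hf hg hfg) :
    extClass P n (f + g) hfg = extClass P n f hf + extClass P n g hg :=
  (P.add_extMk _ _ _ rfl _ _).symm

theorem extClass_comp {n : ℕ} (f : P.complex.X n →ₗ[R] R) (hf) (r : R) (hfr) :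
    (extClass P n f hf).comp (Abelian.Ext.mk₀ (rightMul r)) (add_zero _) =
      extClass P n (LinearMap.toSpanSingleton R R r ∘ₗ f) hfr :=
  P.extMk_comp_mk₀ _ _ rfl _ _

/-- There are no coboundaries in degree zero: one would factor through the term of the cochain
complex in degree `1`, which is zero. -/
theorem extMk_zero_eq_zero {C : Type*} [Category* C] [Abelian C] [HasExt.{v} C] {X Y : C}
    (P : ProjectiveResolution X) (f : P.complex.X 0 ⟶ Y) (hf : P.complex.d 1 0 ≫ f = 0)
    (h : P.extMk f 1 rfl hf = 0) : f = 0 := by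
  simp only [← P.extEquivCohomologyClass.apply_eq_iff_eq,
    ProjectiveResolution.extEquivCohomologyClass_extMk,
    ProjectiveResolution.extEquivCohomologyClass_zero,
    CochainComplex.HomComplex.CohomologyClass.mk_eq_zero_iff] at h
  rw [CochainComplex.HomComplex.Cocycle.toSingleMk_mem_coboundaries_iff _ _ _ _ _ 1 (by simp)] at h
  obtain ⟨g, hg⟩ := h
  have hz : Limits.IsZero (P.cochainComplex.X 1) :=
    CochainComplex.isZero_of_isStrictlyLE P.cochainComplex 0 1 (by lia)
  rw [hz.eq_zero_of_src g, Limits.comp_zero] at hg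
  rw [← cancel_epi (P.cochainComplexXIso (-(0 : ℕ)) 0 rfl).hom, ← hg, Limits.comp_zero]

/-- The truncated subtraction treats all degrees at once: for `n = 0` the map `bdry P 0 0` is zero,
so the right-hand side says `f = 0`. -/
theorem extClass_eq_zero_iff {n : ℕ} (f : P.complex.X n →ₗ[R] R) (hf) :
    extClass P n f hf = 0 ↔ ∃ g : P.complex.X (n - 1) →ₗ[R] R, g ∘ₗ bdry P n (n - 1) = f := by
  cases n with
  | zero =>
    have h0 : bdry P 0 (0 - 1) = 0 := bdry_eq_zero P (by omega)
    constructor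
    · intro h
      have := extMk_zero_eq_zero P _ _ h
      refine ⟨0, ?_⟩
      rw [LinearMap.zero_comp]
      exact (congrArg ModuleCat.Hom.hom this).symm
    · rintro ⟨g, rfl⟩
      have : ModuleCat.ofHom (g ∘ₗ bdry P 0 (0 - 1)) = 0 :=
        ModuleCat.hom_ext (by rw [h0, LinearMap.comp_zero]; rfl)
      exact (P.extMk_zero (Y := ModuleCat.of R R) 1 rfl) ▸ (by
        unfold extClass
        congr 1)
  | succ n =>
    refine (P.extMk_eq_zero_iff _ _ rfl _ n rfl).trans ⟨?_, ?_⟩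
    · rintro ⟨g, hg⟩
      exact ⟨g.hom, congrArg ModuleCat.Hom.hom hg⟩
    · rintro ⟨g, hg⟩
      exact ⟨ModuleCat.ofHom g, ModuleCat.hom_ext hg⟩

theorem exists_dualBasis (V : Type v) [AddCommGroup V] [Module R V] [Module.Finite R V]
    [Module.Projective R V] :
    ∃ (m : ℕ) (a : V →ₗ[R] Fin m → R) (b : (Fin m → R) →ₗ[R] V), ∀ x, b (a x) = x := by
  obtain ⟨m, b, hb⟩ := Module.Finite.exists_fin' R V
  obtain ⟨a, ha⟩ := Module.projective_lifting_property b LinearMap.id hb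
  exact ⟨m, a, b, LinearMap.congr_fun ha⟩

instance (n : ℕ) : Module.Projective R (P.complex.X n) :=
  (P.complex.X n).projective_of_module_projective

/-- If `Ext^{n}(M, R)` vanishes for all `n > d`, the image of the differential in degree `d` is a
direct summand. -/
theorem exists_section (hfin : ∀ n, Module.Finite R (P.complex.X n)) {N : ℕ}
    (hN : ∀ n, N ≤ n → Limits.IsZero (P.complex.X n)) {d : ℕ}
    (hd : ∀ n, d < n → ∀ f : P.complex.X n →ₗ[R] R, f ∘ₗ bdry P (n + 1) n = 0 →
      ∃ g : P.complex.X (n - 1) →ₗ[R] R, g ∘ₗ bdry P n (n - 1) = f) :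
    ∃ r : P.complex.X d →ₗ[R] P.complex.X (d + 1),
      ∀ x, bdry P (d + 1) d (r (bdry P (d + 1) d x)) = bdry P (d + 1) d x := by
  -- Descending induction on `n`, starting where the terms of the resolution are zero.
  suffices H : ∀ j n, d ≤ n → N ≤ n + j → ∃ r : P.complex.X n →ₗ[R] P.complex.X (n + 1),
      ∀ x, bdry P (n + 1) n (r (bdry P (n + 1) n x)) = bdry P (n + 1) n x from
    H N d le_rfl (by omega)
  intro j
  induction j with
  | zero =>
    intro n _ hn
    have : Subsingleton (P.complex.X n) := ModuleCat.subsingleton_of_isZero (hN n hn)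
    exact ⟨0, fun x => Subsingleton.elim _ _⟩
  | succ j ih =>
    intro n hdn hn
    obtain ⟨r, hr⟩ := ih (n + 1) (by omega) (by omega)
    obtain ⟨m, a, b, hba⟩ := exists_dualBasis (R := R) (P.complex.X (n + 1))
    -- The splitting one degree higher makes `g` vanish on boundaries, so its coordinate functionals
    -- are cocycles of degree above `d`, hence coboundaries; their primitives assemble to the
    -- section in degree `n`.
    let g : P.complex.X (n + 1) →ₗ[R] P.complex.X (n + 1) :=
      LinearMap.id - bdry P (n + 2) (n + 1) ∘ₗ r
    have hg (x) : g x = x - bdry P (n + 2) (n + 1) (r x) := rfl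
    have key (s : Fin m) : ∃ ψ : P.complex.X n →ₗ[R] R,
        ψ ∘ₗ bdry P (n + 1) n = LinearMap.proj s ∘ₗ a ∘ₗ g := by
      refine hd (n + 1) (by omega) _ (LinearMap.ext fun x => ?_)
      have : g (bdry P (n + 2) (n + 1) x) = 0 := by rw [hg, hr, sub_self]
      change a (g (bdry P (n + 2) (n + 1) x)) s = 0
      rw [this, map_zero]
      rfl
    choose ψ hψ using key
    refine ⟨b ∘ₗ LinearMap.pi ψ, fun x => ?_⟩
    have h1 : LinearMap.pi ψ (bdry P (n + 1) n x) = a (g x) :=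
      funext fun s => LinearMap.congr_fun (hψ s) x
    rw [LinearMap.comp_apply, h1, hba, hg, map_sub, bdry_bdry, sub_zero]

end Resolution

/-! ### The total module of a truncated resolution -/

section Total

variable {R : Type v} [Ring R] {M : ModuleCat.{v} R} (P : ProjectiveResolution M) (d : ℕ)

/-- The direct sum of the terms of degree at most `d`. -/
abbrev Tot : Type v := ∀ n : Fin (d + 1), P.complex.X n

/-- The total differential. -/
def totD : Tot P d →ₗ[R] Tot P d :=
  LinearMap.pi fun m => ∑ n : Fin (d + 1), bdry P n m ∘ₗ LinearMap.proj n

/-- The total augmentation. -/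
def totAug : Tot P d →ₗ[R] M := aug₀ P ∘ₗ LinearMap.proj (⟨0, Nat.succ_pos d⟩ : Fin (d + 1))

variable {P d}

theorem totD_apply (x : Tot P d) (m : Fin (d + 1)) :
    totD P d x m = ∑ n : Fin (d + 1), bdry P n m (x n) := by
  simp [totD, LinearMap.sum_apply]

theorem totD_apply_of_succ (x : Tot P d) (m : ℕ) (hm : m + 1 < d + 1) :
    totD P d x ⟨m, by omega⟩ = bdry P (m + 1) m (x ⟨m + 1, hm⟩) := by
  rw [totD_apply]
  refine (Finset.sum_eq_single ⟨m + 1, hm⟩ (fun n _ hn => ?_) (by simp)).trans rfl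
  rw [bdry_eq_zero P (n := n) (m := m) fun h => hn (Fin.ext h)]
  rfl

theorem totD_apply_last (x : Tot P d) : totD P d x (Fin.last d) = 0 := by
  rw [totD_apply]
  refine Finset.sum_eq_zero fun n _ => ?_
  rw [bdry_eq_zero P (n := n) (m := Fin.last d) (by have := n.2; simp only [Fin.val_last]; omega)]
  rfl

theorem totD_single (n : Fin (d + 1)) (z : P.complex.X n) (m : Fin (d + 1)) :
    totD P d (Pi.single n z) m = bdry P n m z := by
  rw [totD_apply]
  refine (Finset.sum_eq_single n (fun l _ hl => ?_) (by simp)).trans ?_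
  · rw [Pi.single_eq_of_ne hl, map_zero]
  · rw [Pi.single_eq_same]

theorem totD_single_succ (n : ℕ) (hn : n + 1 < d + 1) (z : P.complex.X (n + 1)) :
    totD P d (Pi.single (⟨n + 1, hn⟩ : Fin (d + 1)) z) =
      Pi.single (⟨n, by omega⟩ : Fin (d + 1)) (bdry P (n + 1) n z) := by
  funext m
  rw [totD_single]
  by_cases hm : m = ⟨n, by omega⟩
  · subst hm
    rw [Pi.single_eq_same]
  · rw [Pi.single_eq_of_ne hm, bdry_eq_zero P fun h => hm (Fin.ext (by simpa using h.symm))]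
    rfl

theorem totD_single_zero (h : 0 < d + 1) (z : P.complex.X 0) :
    totD P d (Pi.single (⟨0, h⟩ : Fin (d + 1)) z) = 0 := by
  funext m
  rw [totD_single, bdry_eq_zero P (by simp)]
  rfl

theorem totD_totD (x : Tot P d) : totD P d (totD P d x) = 0 := by
  funext m
  rw [totD_apply]
  refine Finset.sum_eq_zero fun n _ => ?_
  rw [totD_apply, map_sum]
  exact Finset.sum_eq_zero fun l _ => bdry_bdry P _ _ _ _

theorem totAug_apply (x : Tot P d) : totAug P d x = aug₀ P (x ⟨0, Nat.succ_pos d⟩) := rfl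

theorem aug₀_bdry' (n : ℕ) (z : P.complex.X n) : aug₀ P (bdry P n 0 z) = 0 := by
  by_cases hn : n = 0 + 1
  · subst hn
    exact aug₀_bdry P z
  · rw [bdry_eq_zero P hn]
    exact map_zero _

theorem totAug_totD (x : Tot P d) : totAug P d (totD P d x) = 0 := by
  rw [totAug_apply, totD_apply, map_sum]
  exact Finset.sum_eq_zero fun n _ => aug₀_bdry' n (x n)

/-- A splitting of the image of the differential in the top degree. -/
def IsSplitting (r : P.complex.X (Fin.last d) →ₗ[R] P.complex.X (d + 1)) : Prop :=
  ∀ x, bdry P (d + 1) (Fin.last d) (r (bdry P (d + 1) (Fin.last d) x)) =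
    bdry P (d + 1) (Fin.last d) x

variable (r : P.complex.X (Fin.last d) →ₗ[R] P.complex.X (d + 1))

/-- The projection which splits off the boundaries of the top degree. -/
def trunc : Tot P d →ₗ[R] Tot P d :=
  LinearMap.id - LinearMap.single R _ (Fin.last d) ∘ₗ bdry P (d + 1) (Fin.last d) ∘ₗ r ∘ₗ
    LinearMap.proj (Fin.last d)

theorem trunc_apply (x : Tot P d) : trunc r x = x -
    Pi.single (Fin.last d) (bdry P (d + 1) (Fin.last d) (r (x (Fin.last d)))) := rfl

theorem trunc_apply_of_ne (x : Tot P d) {n : Fin (d + 1)} (hn : n ≠ Fin.last d) :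
    trunc r x n = x n := by
  rw [trunc_apply, Pi.sub_apply, Pi.single_eq_of_ne hn, sub_zero]

theorem trunc_apply_last (x : Tot P d) : trunc r x (Fin.last d) =
    x (Fin.last d) - bdry P (d + 1) (Fin.last d) (r (x (Fin.last d))) := by
  rw [trunc_apply, Pi.sub_apply, Pi.single_eq_same]

theorem trunc_apply_eq_zero (x : Tot P d) {n : Fin (d + 1)} (hn : x n = 0) : trunc r x n = 0 := by
  by_cases h : n = Fin.last d
  · subst h
    rw [trunc_apply_last, hn, map_zero, map_zero, sub_zero]
  · rw [trunc_apply_of_ne r x h, hn]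

theorem trunc_totD (x : Tot P d) : trunc r (totD P d x) = totD P d x := by
  rw [trunc_apply, totD_apply_last, map_zero, map_zero, Pi.single_zero, sub_zero]

theorem totD_trunc (x : Tot P d) : totD P d (trunc r x) = totD P d x := by
  rw [trunc_apply, map_sub, sub_eq_self]
  funext m
  rw [totD_single]
  exact bdry_bdry P _ _ _ _

theorem totAug_trunc (x : Tot P d) : totAug P d (trunc r x) = totAug P d x := by
  rw [trunc_apply, map_sub, sub_eq_self, totAug_apply]
  by_cases h : (⟨0, Nat.succ_pos d⟩ : Fin (d + 1)) = Fin.last d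
  · have hd : d = 0 := (congrArg Fin.val h).symm
    subst hd
    exact (congrArg (aug₀ P) (Pi.single_eq_same (Fin.last 0) _)).trans (aug₀_bdry P _)
  · rw [Pi.single_eq_of_ne h]
    exact map_zero _

variable {r} (hr : IsSplitting r)

include hr

theorem trunc_single_bdry (z : P.complex.X (d + 1)) :
    trunc r (Pi.single (Fin.last d) (bdry P (d + 1) (Fin.last d) z)) = 0 := by
  rw [trunc_apply, Pi.single_eq_same, hr, sub_self]

theorem trunc_trunc (x : Tot P d) : trunc r (trunc r x) = trunc r x := by
  have := trunc_single_bdry hr (r (x (Fin.last d)))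
  conv_lhs => rw [trunc_apply r x, map_sub, this, sub_zero]

/-- Below the top this is exactness of the resolution. In top degree a cycle is a boundary from
degree `d + 1`, and these are precisely what the truncation removes, so that component is zero. -/
theorem exists_totD_eq (x : Tot P d) (h1 : trunc r x = x) (h2 : totD P d x = 0)
    (h3 : totAug P d x = 0) : ∃ y, totD P d y = x := by
  have hz : ∀ n (hn : n < d + 1), ∃ z, bdry P (n + 1) n z = x ⟨n, hn⟩ := by
    intro n hn
    cases n with
    | zero => exact aug₀_exact P _ h3
    | succ n =>
      refine bdry_exact P n _ ?_
      rw [← totD_apply_of_succ x n hn, h2]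
      rfl
  choose z hz using hz
  have hlast : x (Fin.last d) = 0 := by
    have h4 := congrFun h1 (Fin.last d)
    rw [trunc_apply_last, sub_eq_self] at h4
    have h5 : bdry P (d + 1) (Fin.last d) (z d (Nat.lt_succ_self d)) = x (Fin.last d) := hz d _
    rw [← h5, hr] at h4
    rw [← h5, h4]
  let y : Tot P d := fun n => match n with
    | ⟨0, _⟩ => 0
    | ⟨m + 1, hm⟩ => z m (by omega)
  refine ⟨y, funext fun m => ?_⟩
  obtain ⟨m, hm⟩ := m
  by_cases h : m + 1 < d + 1
  · rw [totD_apply_of_succ y m h]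
    exact hz m _
  · obtain rfl : m = d := by omega
    exact (totD_apply_last y).trans hlast.symm

/-- Exactness of the dual complex, one component at a time: vanishing of `Ext` gives primitives
below degree `d`, and in degree `d` the existence of a primitive is assumed. -/
theorem exists_comp_totD_eq (φ : Tot P d →ₗ[R] R) (h1 : ∀ x, φ (trunc r x) = φ x)
    (h2 : ∀ x, φ (totD P d x) = 0)
    (hlow : ∀ n, n < d → ∀ f : P.complex.X n →ₗ[R] R, f ∘ₗ bdry P (n + 1) n = 0 →
      ∃ g : P.complex.X (n - 1) →ₗ[R] R, g ∘ₗ bdry P n (n - 1) = f)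
    (htop : ∃ g : P.complex.X (d - 1) →ₗ[R] R, g ∘ₗ bdry P d (d - 1) =
      φ ∘ₗ LinearMap.single R _ (Fin.last d)) :
    ∃ ψ : Tot P d →ₗ[R] R, ∀ x, ψ (totD P d x) = φ x := by
  have hg : ∀ n (hn : n < d + 1), ∃ g : P.complex.X (n - 1) →ₗ[R] R,
      g ∘ₗ bdry P n (n - 1) = φ ∘ₗ LinearMap.single R _ (⟨n, hn⟩ : Fin (d + 1)) := by
    intro n hn
    by_cases hnd : n = d
    · subst hnd
      exact htop
    · refine hlow n (by omega) _ (LinearMap.ext fun z => ?_)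
      change φ (Pi.single (⟨n, hn⟩ : Fin (d + 1)) (bdry P (n + 1) n z)) = 0
      rw [← totD_single_succ n (by omega), h2]
  choose g hg using hg
  -- The component of `ψ` in degree `m` is the primitive of the component of `φ` in degree `m + 1`;
  -- the top component is zero.
  let ψ : Tot P d →ₗ[R] R := ∑ m : Fin (d + 1), if h : m.1 + 1 < d + 1 then
    (show P.complex.X m →ₗ[R] R from g (m.1 + 1) h) ∘ₗ LinearMap.proj m else 0
  refine ⟨ψ, fun x => ?_⟩
  suffices H : ψ ∘ₗ totD P d = φ from LinearMap.congr_fun H x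
  refine LinearMap.pi_ext fun n z => ?_
  obtain ⟨n, hn⟩ := n
  have h5 : φ (Pi.single (⟨n, hn⟩ : Fin (d + 1)) z) = g n hn (bdry P n (n - 1) z) :=
    (LinearMap.congr_fun (hg n hn) z).symm
  rw [LinearMap.comp_apply, h5]
  cases n with
  | zero =>
    rw [totD_single_zero, map_zero, bdry_eq_zero P (by omega)]
    exact (map_zero _).symm
  | succ n =>
    rw [totD_single_succ, LinearMap.sum_apply]
    refine (Finset.sum_eq_single (⟨n, by omega⟩ : Fin (d + 1)) (fun m _ hm => ?_) (by simp)).trans ?_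
    · split_ifs
      · rw [LinearMap.comp_apply, LinearMap.proj_apply, Pi.single_eq_of_ne hm, map_zero]
      · rfl
    · rw [dif_pos hn, LinearMap.comp_apply, LinearMap.proj_apply, Pi.single_eq_same]
      rfl

end Total

/-! ### Matrices of a truncated resolution -/

section Frame

variable {R : Type v} [Ring R] {M : ModuleCat.{v} R} {P : ProjectiveResolution M} {d : ℕ}

/-- A homogeneous dual basis of the truncated resolution: coordinates `toVec` and a retraction
`ofVec`. -/
structure Frame (P : ProjectiveResolution M) (d : ℕ) (ι : Type) [Fintype ι] [DecidableEq ι] where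
  deg : ι → Fin (d + 1)
  toVec : Tot P d →ₗ[R] ι → R
  ofVec : (ι → R) →ₗ[R] Tot P d
  ofVec_toVec : ∀ x, ofVec (toVec x) = x
  toVec_eq_zero : ∀ x s, x (deg s) = 0 → toVec x s = 0
  ofVec_single : ∀ s n, n ≠ deg s → ofVec (Pi.single s 1) n = 0

theorem exists_frame (hfin : ∀ n, Module.Finite R (P.complex.X n)) (d : ℕ) :
    ∃ (ι : Type) (_ : Fintype ι) (_ : DecidableEq ι), Nonempty (Frame P d ι) := by
  choose m a b hab using fun n : Fin (d + 1) => exists_dualBasis (R := R) (P.complex.X n)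
  let ι := Σ n : Fin (d + 1), Fin (m n)
  refine ⟨ι, inferInstance, inferInstance, ⟨?_⟩⟩
  exact
    { deg := Sigma.fst
      toVec := LinearMap.pi fun s : ι => (LinearMap.proj (R := R) (φ := fun _ => R) s.2) ∘ₗ a s.1 ∘ₗ LinearMap.proj s.1
      ofVec := LinearMap.pi fun n => b n ∘ₗ LinearMap.pi fun j => LinearMap.proj (R := R) (φ := fun _ : ι => R) ⟨n, j⟩
      ofVec_toVec := fun x => funext fun n => hab n (x n)
      toVec_eq_zero := fun x s h => by
        change a s.1 (x s.1) s.2 = 0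
        rw [h, map_zero]
        rfl
      ofVec_single := fun s n h => by
        change b n (fun j => (Pi.single s 1 : ι → R) ⟨n, j⟩) = 0
        rw [show (fun j => (Pi.single s 1 : ι → R) ⟨n, j⟩) = 0 from
          funext fun j => Pi.single_eq_of_ne (fun e => h (congrArg Sigma.fst e)) _, map_zero] }

namespace Frame

variable {ι : Type} [Fintype ι] [DecidableEq ι] (F : Frame P d ι)

/-- The matrix of an endomorphism, acting on row vectors. -/
def mat (f : Tot P d →ₗ[R] Tot P d) : Matrix ι ι R :=
  Matrix.of fun s t => F.toVec (f (F.ofVec (Pi.single s 1))) t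

/-- The values of a linear map on the generators. -/
def coeff {N : Type*} [AddCommGroup N] [Module R N] (φ : Tot P d →ₗ[R] N) (s : ι) : N :=
  φ (F.ofVec (Pi.single s 1))

/-- The functional with given values on the generators. -/
def functional (c : ι → R) : Tot P d →ₗ[R] R :=
  ∑ s, LinearMap.toSpanSingleton R R (c s) ∘ₗ LinearMap.proj s ∘ₗ F.toVec

theorem functional_apply (c : ι → R) (x : Tot P d) : F.functional c x = F.toVec x ⬝ᵥ c := by
  simp [functional, LinearMap.sum_apply, dotProduct]

theorem rowDot_coeff {N : Type*} [AddCommGroup N] [Module R N] (φ : Tot P d →ₗ[R] N) (v : ι → R) :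
    rowDot v (F.coeff φ) = φ (F.ofVec v) := by
  conv_rhs => rw [pi_eq_sum_univ' v]
  rw [map_sum, map_sum]
  refine Finset.sum_congr rfl fun s _ => ?_
  rw [map_smul, map_smul, coeff]

theorem functional_coeff (φ : Tot P d →ₗ[R] R) : F.functional (F.coeff φ) = φ := by
  refine LinearMap.ext fun x => ?_
  rw [functional_apply]
  refine (F.rowDot_coeff φ (F.toVec x)).trans ?_
  rw [F.ofVec_toVec]

theorem vecMul_mat (f : Tot P d →ₗ[R] Tot P d) (v : ι → R) :
    v ᵥ* F.mat f = F.toVec (f (F.ofVec v)) := by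
  funext t
  exact F.rowDot_coeff (LinearMap.proj t ∘ₗ F.toVec ∘ₗ f) v

theorem mat_mul_mat (f g : Tot P d →ₗ[R] Tot P d) : F.mat f * F.mat g = F.mat (g ∘ₗ f) := by
  funext s
  refine (F.vecMul_mat g (F.mat f s)).trans ?_
  change F.toVec (g (F.ofVec (F.toVec (f (F.ofVec (Pi.single s 1)))))) = _
  rw [F.ofVec_toVec]
  rfl

theorem mat_mulVec (f : Tot P d →ₗ[R] Tot P d) (c : ι → R) :
    F.mat f *ᵥ c = F.coeff (F.functional c ∘ₗ f) := by
  funext s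
  exact (F.functional_apply c _).symm

theorem ofVec_single_eq (s : ι) : F.ofVec (Pi.single s 1) =
    Pi.single (F.deg s) (F.ofVec (Pi.single s 1) (F.deg s)) := by
  funext n
  by_cases hn : n = F.deg s
  · subst hn
    rw [Pi.single_eq_same]
  · rw [F.ofVec_single s n hn, Pi.single_eq_of_ne hn]

theorem mat_trunc_eq_zero (r : P.complex.X (Fin.last d) →ₗ[R] P.complex.X (d + 1)) {s t : ι}
    (h : F.deg s ≠ F.deg t) : F.mat (trunc r) s t = 0 :=
  F.toVec_eq_zero _ t (trunc_apply_eq_zero r _ (F.ofVec_single s _ h.symm))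

theorem mat_totD_eq_zero {s t : ι} (h : (F.deg s : ℕ) ≠ F.deg t + 1) :
    F.mat (totD P d) s t = 0 := by
  refine F.toVec_eq_zero _ t ?_
  rw [ofVec_single_eq, totD_single, bdry_eq_zero P h]
  rfl

end Frame

/-! ### Classes of functionals on the truncated resolution -/

variable {r : P.complex.X (Fin.last d) →ₗ[R] P.complex.X (d + 1)}

variable (r) in
/-- The restriction of a functional to the truncated top degree. -/
def topRestrict (φ : Tot P d →ₗ[R] R) : P.complex.X d →ₗ[R] R :=
  (φ ∘ₗ trunc r ∘ₗ LinearMap.single R (fun n : Fin (d + 1) => P.complex.X n) (Fin.last d) : P.complex.X (Fin.last d) →ₗ[R] R)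

theorem topRestrict_bdry (hr : IsSplitting r) (φ : Tot P d →ₗ[R] R) :
    topRestrict r φ ∘ₗ bdry P (d + 1) d = 0 :=
  LinearMap.ext fun z => (congrArg φ (trunc_single_bdry hr z)).trans (map_zero φ)

/-- The class in `Ext^d` of the restriction of a functional to the truncated top degree. -/
def topClass (hr : IsSplitting r) :
    (Tot P d →ₗ[R] R) →+ Abelian.Ext.{v} M (ModuleCat.of R R) d :=
  AddMonoidHom.mk' (fun φ => extClass P d (topRestrict r φ) (topRestrict_bdry hr φ)) fun φ ψ => by
    rw [← extClass_add]
    rfl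

theorem topClass_comp (hr : IsSplitting r) (φ : Tot P d →ₗ[R] R) (a : R) :
    (topClass hr φ).comp (Abelian.Ext.mk₀ (rightMul a)) (add_zero _) =
      topClass hr (LinearMap.toSpanSingleton R R a ∘ₗ φ) :=
  extClass_comp P (topRestrict r φ) (topRestrict_bdry hr φ) a
    (topRestrict_bdry hr (LinearMap.toSpanSingleton R R a ∘ₗ φ))

theorem extClass_congr {n : ℕ} {f g : P.complex.X n →ₗ[R] R} (h : f = g) (hf hg) :
    extClass P n f hf = extClass P n g hg := by
  subst h
  rfl

theorem topClass_congr (hr : IsSplitting r) {φ ψ : Tot P d →ₗ[R] R}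
    (h : ∀ z, φ (trunc r (Pi.single (Fin.last d) z)) = ψ (trunc r (Pi.single (Fin.last d) z))) :
    topClass hr φ = topClass hr ψ :=
  extClass_congr (LinearMap.ext h) (topRestrict_bdry hr φ) (topRestrict_bdry hr ψ)

theorem topClass_comp_trunc (hr : IsSplitting r) (φ : Tot P d →ₗ[R] R) :
    topClass hr (φ ∘ₗ trunc r) = topClass hr φ :=
  topClass_congr hr fun _ => congrArg φ (trunc_trunc hr _)

theorem topClass_eq_zero_iff (hr : IsSplitting r) (φ : Tot P d →ₗ[R] R) : topClass hr φ = 0 ↔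
    ∃ g : P.complex.X (d - 1) →ₗ[R] R, g ∘ₗ bdry P d (d - 1) = topRestrict r φ :=
  extClass_eq_zero_iff P (topRestrict r φ) (topRestrict_bdry hr φ)

theorem topClass_comp_totD (hr : IsSplitting r) (φ : Tot P d →ₗ[R] R) :
    topClass hr (φ ∘ₗ totD P d) = 0 := by
  rw [topClass_eq_zero_iff]
  have h (z) : topRestrict r (φ ∘ₗ totD P d) z = φ (totD P d (Pi.single (Fin.last d) z)) :=
    congrArg φ (totD_trunc r _)
  by_cases hd : d = 0
  · subst hd
    refine ⟨0, LinearMap.ext fun z => ((h z).trans ?_).symm⟩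
    exact (congrArg φ (totD_single_zero (Nat.succ_pos 0) z)).trans (map_zero φ)
  · obtain ⟨d, rfl⟩ := Nat.exists_eq_succ_of_ne_zero hd
    refine ⟨φ ∘ₗ LinearMap.single R (fun n : Fin (d + 1 + 1) => P.complex.X n) ⟨d, by omega⟩,
      LinearMap.ext fun z => ?_⟩
    exact ((h z).trans (congrArg φ (totD_single_succ d (by omega) z))).symm

/-- A cocycle is already a functional on the truncated term, because the truncation changes a vector
only by a boundary. -/
theorem topClass_surjective (hr : IsSplitting r) : Function.Surjective (topClass hr) := by
  intro x
  obtain ⟨f, hf, rfl⟩ := exists_extClass P x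
  let f' : P.complex.X (Fin.last d) →ₗ[R] R := f
  refine ⟨f' ∘ₗ LinearMap.proj (Fin.last d), extClass_congr (LinearMap.ext fun z => ?_)
    (topRestrict_bdry hr _) hf⟩
  change f' (trunc r (Pi.single (Fin.last d) z) (Fin.last d)) = f' z
  rw [trunc_apply_last, Pi.single_eq_same, map_sub, sub_eq_self]
  exact LinearMap.congr_fun hf (r z)

end Frame

/-! ### From van den Bergh duality to matrices -/

section Duality

variable {k : Type u} [CommRing k] {A : Type v} [Ring A] [Algebra k A]

instance {n : ℕ} : Module (Two k A A) (ExtEnv k A n) := Two.bimodModule (extBimod k A n)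

/-- The inner bimodule structure swaps the factors, so the left action of `A^e` on `Ext` is right
multiplication by the flipped element. -/
theorem extEnvEquiv_two_smul {n : ℕ} (a : Two k A A) (x : ExtEnv k A n) :
    extEnvEquiv (a • x) =
      (extEnvEquiv x).comp (Abelian.Ext.mk₀ (rightMul (star a))) (add_zero _) := by
  induction a using Two.induction with
  | h0 =>
    have : rightMul (0 : Two k A A) = 0 := by ext; simp [rightMul]
    rw [zero_smul, star_zero, this, Abelian.Ext.mk₀_zero, Abelian.Ext.comp_zero]
    exact map_zero _
  | htm a b =>
    have : rightMul (Two.tm b a : Two k A A) = rightMul (Two.tm b 1) ≫ rightMul (Two.tm 1 a) := by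
      ext
      simp [rightMul, Two.tm_mul_tm]
    rw [Two.star_tm, this, ← Abelian.Ext.mk₀_comp_mk₀]
    refine (extEnvEquiv_smul a (op b • x)).trans ?_
    rw [extEnvEquiv_op_smul, Abelian.Ext.comp_assoc]
    · rfl
    · omega
  | hadd a b ha hb =>
    have : rightMul (star a + star b) = rightMul (star a) + rightMul (star b) := by
      ext
      simp [rightMul]
    rw [star_add, this, Abelian.Ext.mk₀_add, Abelian.Ext.comp_add, ← ha, ← hb, add_smul]
    exact map_add _ _ _

variable {P : ProjectiveResolution (ModuleCat.of (Two k A A) A)} {d : ℕ}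
  {r : P.complex.X (Fin.last d) →ₗ[Two k A A] P.complex.X (d + 1)}
  {ι : Type} [Fintype ι] [DecidableEq ι]

namespace Frame

variable (F : Frame P d ι)

/-- The classes of the coordinate functionals. -/
def coordClass (hr : IsSplitting r) (s : ι) : ExtEnv k A d :=
  extEnvEquiv.symm (topClass hr (LinearMap.proj s ∘ₗ F.toVec))

/-- The dictionary between rows of the dual complex and functionals: because of the flip in the
action on `Ext`, a row `v` corresponds to the functional with column `star v`. -/
theorem rowDot_coordClass (hr : IsSplitting r) (v : ι → Two k A A) :
    rowDot v (F.coordClass hr) = extEnvEquiv.symm (topClass hr (F.functional (star v))) := by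
  rw [functional, map_sum, map_sum]
  refine Finset.sum_congr rfl fun s _ => extEnvEquiv.injective ?_
  refine (extEnvEquiv_two_smul (v s) (F.coordClass hr s)).trans ?_
  rw [AddEquiv.apply_symm_apply]
  refine Eq.trans ?_ (topClass_comp hr _ _)
  rw [coordClass]
  exact congrArg (fun y : TwoExt k A d => y.comp (Abelian.Ext.mk₀ (rightMul (star (v s)))) (add_zero _))
    (AddEquiv.apply_symm_apply _ _)

theorem star_conjTranspose_mat (f : Tot P d →ₗ[Two k A A] Tot P d) (s : ι) :
    star ((F.mat f)ᴴ s) = F.coeff (LinearMap.proj s ∘ₗ F.toVec ∘ₗ f) :=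
  funext fun _ => star_star _

theorem rowDot_conjTranspose_mat (hr : IsSplitting r) (f : Tot P d →ₗ[Two k A A] Tot P d) (s : ι) :
    rowDot ((F.mat f)ᴴ s) (F.coordClass hr) =
      extEnvEquiv.symm (topClass hr ((LinearMap.proj s ∘ₗ F.toVec) ∘ₗ f)) := by
  rw [rowDot_coordClass, star_conjTranspose_mat, functional_coeff]
  rfl

theorem rowDot_mat_trunc (hr : IsSplitting r) (s : ι) :
    rowDot ((F.mat (trunc r))ᴴ s) (F.coordClass hr) = F.coordClass hr s := by
  rw [rowDot_conjTranspose_mat, topClass_comp_trunc]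
  rfl

theorem rowDot_mat_totD (hr : IsSplitting r) (s : ι) :
    rowDot ((F.mat (totD P d))ᴴ s) (F.coordClass hr) = 0 := by
  rw [rowDot_conjTranspose_mat, topClass_comp_totD, map_zero]

theorem coordClass_eq_zero (hr : IsSplitting r) {s : ι} (h : Fin.last d ≠ F.deg s) :
    F.coordClass hr s = 0 := by
  have : topClass hr (LinearMap.proj s ∘ₗ F.toVec) = topClass hr 0 :=
    topClass_congr hr fun z => F.toVec_eq_zero _ s (trunc_apply_eq_zero r _
      (Pi.single_eq_of_ne h.symm _))
  rw [coordClass, this, map_zero, map_zero]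

theorem exists_rowDot_coordClass (hr : IsSplitting r) (x : ExtEnv k A d) :
    ∃ v : ι → Two k A A, rowDot v (F.coordClass hr) = x := by
  obtain ⟨φ, hφ⟩ := topClass_surjective hr (extEnvEquiv x)
  refine ⟨star (F.coeff φ), ?_⟩
  rw [rowDot_coordClass, star_star, functional_coeff, hφ, AddEquiv.symm_apply_apply]

theorem vecMul_conjTranspose_mat (f : Tot P d →ₗ[Two k A A] Tot P d) (v : ι → Two k A A) :
    v ᵥ* (F.mat f)ᴴ = star (F.coeff (F.functional (star v) ∘ₗ f)) := by
  rw [← mat_mulVec, Matrix.star_mulVec, star_star]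

/-- The matrices of the truncated resolution. -/
def resData (hr : IsSplitting r) (x₀ : P.complex.X 0) (hx₀ : aug₀ P x₀ = (1 : A)) :
    ResData k A ι where
  deg s := F.deg s
  E := F.mat (trunc r)
  D := F.mat (totD P d)
  p := F.coeff (totAug P d)
  p₀ := F.toVec (trunc r (Pi.single (⟨0, Nat.succ_pos d⟩ : Fin (d + 1)) x₀))
  E_E := by
    rw [mat_mul_mat]
    exact congrArg F.mat (LinearMap.ext (trunc_trunc hr))
  E_D := by
    rw [mat_mul_mat]
    exact congrArg F.mat (LinearMap.ext (totD_trunc r))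
  D_E := by
    rw [mat_mul_mat]
    exact congrArg F.mat (LinearMap.ext (trunc_totD r))
  D_D := by
    rw [mat_mul_mat]
    ext s t
    refine (congrArg (fun y => F.toVec y t) (totD_totD _)).trans ?_
    rw [map_zero]
    rfl
  E_deg s t h := F.mat_trunc_eq_zero r fun e => h (congrArg Fin.val e)
  D_deg s t h := F.mat_totD_eq_zero h
  p_deg s h := by
    refine (congrArg (aug₀ P) (F.ofVec_single s _ ?_)).trans (map_zero _)
    exact fun e => h (congrArg Fin.val e).symm
  E_p s := by
    rw [rowDot_coeff]
    refine (congrArg (totAug P d) (F.ofVec_toVec _)).trans ?_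
    exact totAug_trunc r _
  D_p s := by
    rw [rowDot_coeff]
    refine (congrArg (totAug P d) (F.ofVec_toVec _)).trans ?_
    exact totAug_totD _
  p₀_deg s h := by
    refine F.toVec_eq_zero _ s (trunc_apply_eq_zero r _ (Pi.single_eq_of_ne ?_ _))
    exact fun e => h (congrArg Fin.val e)
  p₀_E := by
    rw [vecMul_mat, F.ofVec_toVec, trunc_trunc hr]
  p₀_p := by
    rw [rowDot_coeff, F.ofVec_toVec, totAug_trunc, totAug_apply]
    have := Pi.single_eq_same (M := fun n : Fin (d + 1) => P.complex.X n) ⟨0, Nat.succ_pos d⟩ x₀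
    rw [this, hx₀]
  exact v hE hD hp := by
    have hv : F.toVec (trunc r (F.ofVec v)) = v := (F.vecMul_mat _ v).symm.trans hE
    have h1 : trunc r (F.ofVec v) = F.ofVec v := by
      conv_rhs => rw [← hv, F.ofVec_toVec]
    have h2 : totD P d (F.ofVec v) = 0 := by
      rw [← F.ofVec_toVec (totD P d (F.ofVec v)), ← vecMul_mat, hD, map_zero]
    obtain ⟨y, hy⟩ := exists_totD_eq hr (F.ofVec v) h1 h2 ((F.rowDot_coeff _ v).symm.trans hp)
    refine ⟨F.toVec y, ?_⟩
    rw [vecMul_mat, F.ofVec_toVec, hy, ← h1, hv]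

/-- The matrices of the truncated resolution, with the classes of the coordinates in `Ext^d`. -/
def dualityData (hr : IsSplitting r) (x₀ : P.complex.X 0) (hx₀ : aug₀ P x₀ = (1 : A))
    (hlow : ∀ n, n < d → ∀ f : P.complex.X n →ₗ[Two k A A] Two k A A, f ∘ₗ bdry P (n + 1) n = 0 →
      ∃ g : P.complex.X (n - 1) →ₗ[Two k A A] Two k A A, g ∘ₗ bdry P n (n - 1) = f) :
    DualityData (extBimod k A d) d ι where
  toResData := F.resData hr x₀ hx₀
  q := F.coordClass hr
  deg_le s := Nat.lt_succ_iff.1 (F.deg s).2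
  q_deg s h := F.coordClass_eq_zero hr fun e => h (congrArg Fin.val e).symm
  E_q := F.rowDot_mat_trunc hr
  D_q := F.rowDot_mat_totD hr
  exact_q v hE hD hq := by
    -- The conditions on the row `v` are translated into conditions on the functional with column
    -- `star v`; the primitive found for it is translated back at the end.
    have hE' : F.coeff (F.functional (star v) ∘ₗ trunc r) = star v := by
      rw [← star_star (F.coeff _)]
      exact congrArg star ((F.vecMul_conjTranspose_mat _ v).symm.trans hE)
    have hD' : F.coeff (F.functional (star v) ∘ₗ totD P d) = 0 :=
      star_eq_zero.1 ((F.vecMul_conjTranspose_mat _ v).symm.trans hD)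
    have h1 : F.functional (star v) ∘ₗ trunc r = F.functional (star v) := by
      rw [← F.functional_coeff (_ ∘ₗ trunc r), hE']
    have h2 : F.functional (star v) ∘ₗ totD P d = 0 := by
      rw [← F.functional_coeff (_ ∘ₗ totD P d), hD']
      exact LinearMap.ext fun x => (F.functional_apply _ x).trans (dotProduct_zero _)
    have h3 : topClass hr (F.functional (star v)) = 0 := by
      refine (AddEquiv.map_eq_zero_iff extEnvEquiv.symm).1 ?_
      exact (F.rowDot_coordClass hr v).symm.trans hq
    obtain ⟨g, hg⟩ := (topClass_eq_zero_iff hr _).1 h3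
    obtain ⟨ψ, hψ⟩ := exists_comp_totD_eq hr (F.functional (star v)) (LinearMap.congr_fun h1)
      (LinearMap.congr_fun h2) hlow ⟨g, hg.trans (LinearMap.ext fun z => LinearMap.congr_fun h1 _)⟩
    refine ⟨star (F.coeff ψ), (F.vecMul_conjTranspose_mat _ _).trans ?_⟩
    rw [star_star, functional_coeff, show ψ ∘ₗ totD P d = F.functional (star v) from
      LinearMap.ext hψ, ← h1, hE', star_star]
  span_q := F.exists_rowDot_coordClass hr

end Frame

/-- Vanishing above `d` splits the resolution at degree `d`, which gives the truncation; vanishing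
below `d` makes the dual of the truncation exact except at `Ext^d`. -/
theorem VanDenBerghDuality.exists_dualityData (hA : VanDenBerghDuality k A d) :
    ∃ (ι : Type) (_ : Fintype ι), Nonempty (DualityData (extBimod k A d) d ι) := by
  obtain ⟨P, hfin, N, hN⟩ : ∃ P : ProjectiveResolution (ModuleCat.of (Two k A A) A),
    (∀ n, Module.Finite (Two k A A) (P.complex.X n)) ∧
      ∃ N, ∀ n, N ≤ n → Limits.IsZero (P.complex.X n) := hA.smooth
  have hvan (n : ℕ) (hn : n ≠ d) (f : P.complex.X n →ₗ[Two k A A] Two k A A)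
      (hf : f ∘ₗ bdry P (n + 1) n = 0) :
      ∃ g : P.complex.X (n - 1) →ₗ[Two k A A] Two k A A, g ∘ₗ bdry P n (n - 1) = f := by
    have := hA.vanishing n hn
    have : Subsingleton (TwoExt k A n) := extEnvEquiv.symm.injective.subsingleton
    exact (extClass_eq_zero_iff P f hf).1 (Subsingleton.elim _ _)
  obtain ⟨r, hr⟩ := exists_section P hfin hN fun n hn => hvan n hn.ne'
  obtain ⟨x₀, hx₀⟩ := aug₀_surjective P (1 : A)
  obtain ⟨ι, _, _, ⟨F⟩⟩ := exists_frame hfin d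
  exact ⟨ι, inferInstance, ⟨F.dualityData (r := r) hr x₀ hx₀ fun n hn => hvan n hn.ne⟩⟩

end Duality

end VdB

end

theorem mainTheorem1 (k : Type u) [CommRing k] (A : Type v) [Ring A] [Algebra k A]
    [Module.Projective k A] (d : ℕ) (hA : VdB.VanDenBerghDuality k A d) :
    VdB.IsCalabiYau k (VdB.TensorAlg (VdB.extBimod k A d)) (d + 1) := by
  classical
  obtain ⟨ι, _, ⟨X⟩⟩ := hA.exists_dualityData
  obtain ⟨Y, σ, ε, h⟩ := X.exists_selfDual hA.invertible
  exact h.isCalabiYau
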